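/- Let $X$ be a real Banach space and let $A:X\supset D(A)\to X$ be a sectorial operator; that is, its complexification $A_{\mathbb C}$ on $X_{\mathbb C}$ is closed and densely defined and there are $a\in\mathbb R$, $\varphi\in(0,\pi/2)$, $M\ge 1$ such that every $z\in\mathbb C$ with $z\ne a$, $\varphi\le|\arg(z-a)|\le\pi$ lies in the resolvent set of $A_{\mathbb C}$ and $\|(zI-A_{\mathbb C})^{-1}\|\le M/|z-a|$. Write $\sigma(\cdot)$ for the spectrum of the complexification. Assume: (A1) the resolvents $(\rho I-A)^{-1}$ of $A$ ($\rho$ real) are compact; (A2) there is a linear injection $i:X\to H$ into a real Hilbert space $H$ with scalar product $\langle\cdot,\cdot\rangle_H$; (A3) there is a self-adjoint operator $\widehat A:H\supset D(\widehat A)\to H$ with $(i\times i)[\mathrm{Gr}(A)]\subset \mathrm{Gr}(\widehat A)$. Let $\lambda\in\mathbb R$ be an eigenvalue of $A$. Then $-A$ generates a $C_0$ semigroup $\{S_A(t)\}_{t\ge0}$ on $X$; the real eigenvalues of $A$ that are $\le\lambda$ form a finite list $\lambda_1<\lambda_2<\dots<\lambda_k=\lambda$, $k\ge 1$; and there is a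 direct sum decomposition $X=X_+\oplus X_-\oplus X_0$ into closed subspaces with $$S_A(t)X_j\subset X_j\quad\text{for } t\ge0,\ j\in\{0,-,+\},$$ such that the following holds. (i) $X_0=\ker(\lambda I-A)$, the space $X_-$ is finite dimensional, $X_-=\bigoplus_{i=1}^{k-1}\ker(\lambda_iI-A)$ (so $X_-=\{0\}$ if $k=1$), and hence $\dim X_-=\sum_{i=1}^{k-1}\dim\ker(\lambda_iI-A)$. (ii) $X_-\subset D(A)$, $A(X_-)\subset X_-$, and with $A_-:=A|_{X_-}$ one has $S_A(t)x=\exp(-tA_-)x$ for $x\in X_-$, $t\ge0$; put $S_A(t)x:=\exp(-tA_-)x$ also for $x\in X_-$, $t<0$. For every $\delta\ge0$ such that $\mathrm{Re}\,z>0$ for all $z\in\sigma(A_\delta)$, where $A_\delta:=A+\delta I$, and every $\alpha\in[0,1)$ there are constants $c,K>0$ such that $$S_A(t)x\in D(A_\delta^\alpha)\ \text{ and }\ \|A_\delta^\alpha S_A(t)x\|\le Ke^{-(\lambda+c)t}t^{-\alpha}\|x\|\quad\text{for }x\in X_+,\ t>0,$$ $$\|e^{\lambda t}S_A(t)x\|\le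 Ke^{-ct}\|x\|\quad\text{for }x\in X_+,\ t\ge0,$$ $$\|e^{\lambda t}S_A(t)x\|\le Ke^{ct}\|x\|\quad\text{for }x\in X_-,\ t\le0.$$ Here $A_\delta^0=I$ and, for $\alpha>0$, $A_\delta^\alpha$ is the inverse of $A_\delta^{-\alpha}=\frac1{\Gamma(\alpha)}\int_0^\infty t^{\alpha-1}e^{-\delta t}S_A(t)\,dt$. (iii) $\langle i(u_l),i(u_m)\rangle_H=0$ for $u_l\in X_l$, $u_m\in X_m$, where $l,m\in\{0,-,+\}$, $l\ne m$. -/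

import Mathlib

open Filter Topology MeasureTheory

noncomputable section

/-- The complexification `X_ℂ = X × X` of a real vector space; `⟨x, y⟩` stands for `x + i y`. -/
@[ext]
structure Complexification (X : Type*) where
  re : X
  im : X

namespace Complexification

set_option linter.unusedSectionVars false

variable {X : Type*} [NormedAddCommGroup X] [NormedSpace ℝ X]

instance : Zero (Complexification X) := ⟨⟨0, 0⟩⟩
instance : Add (Complexification X) := ⟨fun p q => ⟨p.re + q.re, p.im + q.im⟩⟩
instance : Neg (Complexification X) := ⟨fun p => ⟨-p.re, -p.im⟩⟩

/-- `(a + i b) • (x + i y) = (a x - b y) + i (a y + b x)`. -/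
instance : SMul ℂ (Complexification X) :=
  ⟨fun z p => ⟨z.re • p.re - z.im • p.im, z.re • p.im + z.im • p.re⟩⟩

@[simp] theorem re_zero : (0 : Complexification X).re = 0 := rfl
@[simp] theorem im_zero : (0 : Complexification X).im = 0 := rfl
@[simp] theorem re_add (p q : Complexification X) : (p + q).re = p.re + q.re := rfl
@[simp] theorem im_add (p q : Complexification X) : (p + q).im = p.im + q.im := rfl
@[simp] theorem re_neg (p : Complexification X) : (-p).re = -p.re := rfl
@[simp] theorem im_neg (p : Complexification X) : (-p).im = -p.im := rfl
@[simp] theorem re_smul (z : ℂ) (p : Complexification X) :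
    (z • p).re = z.re • p.re - z.im • p.im := rfl
@[simp] theorem im_smul (z : ℂ) (p : Complexification X) :
    (z • p).im = z.re • p.im + z.im • p.re := rfl

instance : AddCommGroup (Complexification X) where
  add_assoc p q r := by ext <;> simp [add_assoc]
  zero_add p := by ext <;> simp
  add_zero p := by ext <;> simp
  add_comm p q := by ext <;> simp [add_comm]
  neg_add_cancel p := by ext <;> simp
  nsmul := nsmulRec
  zsmul := zsmulRec

instance : Module ℂ (Complexification X) where
  one_smul p := by ext <;> simp
  mul_smul z w p := by
    ext
    · simp only [re_smul, im_smul, Complex.mul_re, Complex.mul_im]; module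
    · simp only [re_smul, im_smul, Complex.mul_re, Complex.mul_im]; module
  smul_zero z := by ext <;> simp
  smul_add z p q := by
    ext
    · simp only [re_smul, re_add, im_add]; module
    · simp only [im_smul, re_add, im_add]; module
  add_smul z w p := by
    ext
    · simp only [re_smul, re_add, Complex.add_re, Complex.add_im]; module
    · simp only [im_smul, im_add, Complex.add_re, Complex.add_im]; module
  zero_smul p := by ext <;> simp

/-- The real-linear map `w ↦ Re (w • p) : ℂ → X` attached to `p = x + i y`. -/
def toCLM : Complexification X →+ (ℂ →L[ℝ] X) where
  toFun p := Complex.reCLM.smulRight p.re - Complex.imCLM.smulRight p.im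
  map_zero' := by
    ext w
    change w.re • (0 : X) - w.im • (0 : X) = 0
    simp
  map_add' p q := by
    ext w
    change w.re • (p.re + q.re) - w.im • (p.im + q.im)
      = (w.re • p.re - w.im • p.im) + (w.re • q.re - w.im • q.im)
    module

theorem toCLM_apply (p : Complexification X) (w : ℂ) :
    toCLM p w = w.re • p.re - w.im • p.im := rfl

theorem toCLM_injective : Function.Injective (toCLM (X := X)) := by
  intro p q h
  ext
  · simpa [toCLM_apply] using congrArg (fun f : ℂ →L[ℝ] X => f 1) h
  · simpa [toCLM_apply] using congrArg (fun f : ℂ →L[ℝ] X => f Complex.I) h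

/-- The norm `‖x + i y‖ = sup_{|w| ≤ 1} ‖Re (w (x + i y))‖ = sup_θ ‖cos θ x - sin θ y‖`
(it is equivalent to `‖x‖ + ‖y‖`). -/
instance : NormedAddCommGroup (Complexification X) :=
  NormedAddCommGroup.induced (Complexification X) (ℂ →L[ℝ] X) toCLM toCLM_injective

theorem norm_def (p : Complexification X) : ‖p‖ = ‖toCLM p‖ := rfl

instance : NormedSpace ℂ (Complexification X) where
  norm_smul_le z p := by
    rw [norm_def, norm_def]
    refine ContinuousLinearMap.opNorm_le_bound _ (by positivity) fun w => ?_
    have h : toCLM (z • p) w = toCLM p (z * w) := by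
      simp only [toCLM_apply, re_smul, im_smul, Complex.mul_re, Complex.mul_im]
      module
    rw [h]
    calc ‖toCLM p (z * w)‖ ≤ ‖toCLM p‖ * ‖z * w‖ := (toCLM p).le_opNorm _
      _ = ‖z‖ * ‖toCLM p‖ * ‖w‖ := by rw [norm_mul]; ring

end Complexification

namespace LinearPMap

/-- `R` is the resolvent `(z I - A)⁻¹ ∈ L(E)` of the operator `A : E ⊇ D(A) → E` at `z`. -/
def IsResolventAt {𝕜 E : Type*} [NontriviallyNormedField 𝕜] [NormedAddCommGroup E]
    [NormedSpace 𝕜 E] (A : E →ₗ.[𝕜] E) (z : 𝕜) (R : E →L[𝕜] E) : Prop :=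
  (∀ x : E, ∃ h : R x ∈ A.domain, z • R x - A ⟨R x, h⟩ = x) ∧
    ∀ x : A.domain, R (z • (x : E) - A x) = x

/-- Sectorial operators on a complex Banach space: closed, densely defined, and the sector
`φ ≤ |arg (z - a)| ≤ π`, `z ≠ a`, lies in the resolvent set, with
`‖(z I - A)⁻¹‖ ≤ M / |z - a|` there. -/
def IsSectorial {E : Type*} [NormedAddCommGroup E] [NormedSpace ℂ E]
    (A : E →ₗ.[ℂ] E) : Prop :=
  A.IsClosed ∧ Dense (A.domain : Set E) ∧
    ∃ a φ M : ℝ, 0 < φ ∧ φ < Real.pi / 2 ∧ 1 ≤ M ∧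
      ∀ z : ℂ, z ≠ (a : ℂ) → φ ≤ |Complex.arg (z - a)| →
        ∃ R : E →L[ℂ] E, A.IsResolventAt z R ∧ ‖R‖ ≤ M / ‖z - a‖

variable {X : Type*} [NormedAddCommGroup X] [NormedSpace ℝ X]

/-- The complexification `A_ℂ (x + i y) = A x + i A y`, `D(A_ℂ) = {x + i y | x, y ∈ D(A)}`. -/
def complexify (A : X →ₗ.[ℝ] X) : Complexification X →ₗ.[ℂ] Complexification X where
  domain :=
    { carrier := {p | p.re ∈ A.domain ∧ p.im ∈ A.domain}
      add_mem' := fun hp hq => ⟨A.domain.add_mem hp.1 hq.1, A.domain.add_mem hp.2 hq.2⟩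
      zero_mem' := ⟨A.domain.zero_mem, A.domain.zero_mem⟩
      smul_mem' := fun _ _ hp =>
        ⟨A.domain.sub_mem (A.domain.smul_mem _ hp.1) (A.domain.smul_mem _ hp.2),
          A.domain.add_mem (A.domain.smul_mem _ hp.2) (A.domain.smul_mem _ hp.1)⟩ }
  toFun :=
    { toFun := fun p => ⟨A ⟨p.1.re, p.2.1⟩, A ⟨p.1.im, p.2.2⟩⟩
      map_add' := fun p q => by
        ext
        · exact A.map_add ⟨p.1.re, p.2.1⟩ ⟨q.1.re, q.2.1⟩
        · exact A.map_add ⟨p.1.im, p.2.2⟩ ⟨q.1.im, q.2.2⟩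
      map_smul' := fun z p => by
        ext
        · have h := A.map_sub (z.re • ⟨p.1.re, p.2.1⟩) (z.im • ⟨p.1.im, p.2.2⟩)
          rw [A.map_smul, A.map_smul] at h
          exact h
        · have h := A.map_add (z.re • ⟨p.1.im, p.2.2⟩) (z.im • ⟨p.1.re, p.2.1⟩)
          rw [A.map_smul, A.map_smul] at h
          exact h }

/-- The complex spectrum `σ(A)` of an operator on a real Banach space, i.e. the set of
`z ∈ ℂ` at which `A_ℂ` has no bounded everywhere defined resolvent. -/
def complexSpectrum (A : X →ₗ.[ℝ] X) : Set ℂ :=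
  {z | ¬ ∃ R : Complexification X →L[ℂ] Complexification X, A.complexify.IsResolventAt z R}

/-- The shifted operator `A_δ = A + δ I`, with `D(A_δ) = D(A)`. -/
def shift (A : X →ₗ.[ℝ] X) (δ : ℝ) : X →ₗ.[ℝ] X :=
  (δ • (LinearMap.id : X →ₗ[ℝ] X)) +ᵥ A

/-- `ker (μ I - A)`. -/
def kerSub (A : X →ₗ.[ℝ] X) (μ : ℝ) : Submodule ℝ X where
  carrier := {x | ∃ h : x ∈ A.domain, A ⟨x, h⟩ = μ • x}
  add_mem' := by
    rintro x y ⟨hx, ex⟩ ⟨hy, ey⟩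
    refine ⟨A.domain.add_mem hx hy, ?_⟩
    have h := A.map_add ⟨x, hx⟩ ⟨y, hy⟩
    rw [ex, ey, ← smul_add] at h
    exact h
  zero_mem' := ⟨A.domain.zero_mem, by
    rw [smul_zero]; exact A.map_zero⟩
  smul_mem' := by
    rintro c x ⟨hx, ex⟩
    refine ⟨A.domain.smul_mem c hx, ?_⟩
    have h := A.map_smul c ⟨x, hx⟩
    rw [ex, smul_comm] at h
    exact h

/-- `μ` is a real eigenvalue of `A`. -/
def IsEigenvalue (A : X →ₗ.[ℝ] X) (μ : ℝ) : Prop := A.kerSub μ ≠ ⊥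

/-- `{S t}_{t ≥ 0}` is the `C₀` semigroup generated by `-A` (values at `t < 0` play no role). -/
structure GeneratesSemigroup (A : X →ₗ.[ℝ] X) (S : ℝ → X →L[ℝ] X) : Prop where
  map_zero : S 0 = ContinuousLinearMap.id ℝ X
  map_add : ∀ s t : ℝ, 0 ≤ s → 0 ≤ t → S (s + t) = (S s).comp (S t)
  strongly_continuous : ∀ x : X, Tendsto (fun t => S t x) (𝓝[>] 0) (𝓝 x)
  generator : ∀ x y : X,
    Tendsto (fun t : ℝ => t⁻¹ • (S t x - x)) (𝓝[>] 0) (𝓝 y) ↔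
      ∃ h : x ∈ A.domain, y = -A ⟨x, h⟩

end LinearPMap

/-- `exp (-t B)`, `t ∈ ℝ`, for a bounded operator `B`. -/
def expNeg {E : Type*} [NormedAddCommGroup E] [NormedSpace ℝ E]
    (B : E →L[ℝ] E) (t : ℝ) : E →L[ℝ] E :=
  NormedSpace.exp ((-t) • B)

/-- The graph of the fractional power `B ^ α` (`α ≥ 0`), where `T t = e^{-t B}`:
for `α > 0` it is the set of pairs `(x, y)` with
`x = B ^ (-α) y = Γ(α)⁻¹ ∫_0^∞ t ^ (α - 1) T(t) y dt`, and `B ^ 0 = I`. -/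
def fracPowGraph {X : Type*} [NormedAddCommGroup X] [NormedSpace ℝ X]
    (T : ℝ → X →L[ℝ] X) (α : ℝ) : Submodule ℝ (X × X) where
  carrier := {p | (α = 0 ∧ p.1 = p.2) ∨
    (α ≠ 0 ∧ IntegrableOn (fun t : ℝ => t ^ (α - 1) • T t p.2) (Set.Ioi 0) ∧
      p.1 = (Real.Gamma α)⁻¹ • ∫ t in Set.Ioi (0 : ℝ), t ^ (α - 1) • T t p.2)}
  add_mem' := by
    rintro p q (⟨h0, hp⟩ | ⟨h0, ip, hp⟩) (⟨h0', hq⟩ | ⟨h0', iq, hq⟩)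
    · exact Or.inl ⟨h0, by simp [hp, hq]⟩
    · exact absurd h0 h0'
    · exact absurd h0' h0
    · refine Or.inr ⟨h0, ?_, ?_⟩
      · have e : (fun t : ℝ => t ^ (α - 1) • T t (p + q).2)
            = (fun t : ℝ => t ^ (α - 1) • T t p.2) + fun t : ℝ => t ^ (α - 1) • T t q.2 := by
          funext t
          simp [smul_add]
        rw [e]; exact ip.add iq
      · simp only [Prod.fst_add, Prod.snd_add, map_add, smul_add]
        rw [integral_add ip iq, smul_add, ← hp, ← hq]
  zero_mem' := by
    by_cases h0 : α = 0
    · exact Or.inl ⟨h0, rfl⟩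
    · exact Or.inr ⟨h0, by simp, by simp⟩
  smul_mem' := by
    rintro c p (⟨h0, hp⟩ | ⟨h0, ip, hp⟩)
    · exact Or.inl ⟨h0, by simp [hp]⟩
    · have e : (fun t : ℝ => t ^ (α - 1) • T t (c • p).2)
          = fun t : ℝ => c • (t ^ (α - 1) • T t p.2) := by
        funext t
        rw [Prod.smul_snd, map_smul, smul_comm]
      refine Or.inr ⟨h0, ?_, ?_⟩
      · rw [e]; exact ip.smul c
      · rw [e, integral_smul, Prod.smul_fst, smul_comm, ← hp]

/-- The fractional power `B ^ α` (`α ≥ 0`) of the operator `B` with `T t = e^{-t B}`, i.e. the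
operator with graph `fracPowGraph T α`; its domain is the range of `B ^ (-α)`. -/
def fracPow {X : Type*} [NormedAddCommGroup X] [NormedSpace ℝ X]
    (T : ℝ → X →L[ℝ] X) (α : ℝ) : X →ₗ.[ℝ] X :=
  (fracPowGraph T α).toLinearPMap

end

/-!
The operator `A` is symmetric for the inner product `⟨ι x, ι y⟩` (`isSymmVia_of_isSelfAdjoint`) and
has compact resolvent. Neither `ι` nor the inner product is continuous on `X`, yet the Fredholm
alternative shows that the orthogonal projection onto an eigenspace of `A` is bounded on `X`
(`IsResolventAt.exists_isOrthProjVia`); these projections commute with `A` and replace the spectral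
projections given by contour integrals. The same alternative shows that outside the eigenvalues
the resolvent exists, that the eigenvalues of the complexification are real and isolated, and hence
that only finitely many of them lie below a given bound.

Let `Q` be the sum of the projections onto `ker (μ - A)` for the eigenvalues `μ ≤ lam`. For `κ` large
the operator `B = A + κ Q` has no spectrum in `Re z ≤ b` for some `b > lam`, and compactness together
with the sectorial estimate far out gives `‖(z - B)⁻¹‖ ≤ M / ‖z - b‖` on the half plane `Re z < b`
(`exists_halfPlane_bound_vadd`). Such a bound alone produces the semigroup of `-B` with the decay
`e^{-b t}` and the smoothing estimate `‖(B - b) e^{-t B}‖ ≤ K e^{-b t} / t`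
(`exists_isAnalyticSemigroup`): integrated by parts once, the Dunford integral
`(2 π i)⁻¹ ∫ e^{t z} (z + B)⁻¹ dz` converges absolutely on a vertical line, so that no sector and no
deformation of contours is needed. Since `Q` commutes with `e^{-t B}`, the semigroup of `-A` is
`e^{-t B} e^{κ t Q}` (`GeneratesSemigroup.of_vadd_smul_projection`). It agrees with `e^{-t B}` on
`X₊ = ker Q`, which gives the decay there, and acts by `e^{-μ t}` on `ker (μ - A)`.

For the fractional powers, the convolution identity `B^{-α} B^{-(1 - α)} = B⁻¹` shows that
`B ^ α v = B ^ {-(1 - α)} (B v)` for `v` in the domain of `B` (`exists_fracPow_apply_eq`). With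
`v = e^{-t A} x`, the smoothing estimate and `∫ s^{-α} / (s + t) ds = C t^{-α}` yield the bound by
`t^{-α}` (`GeneratesSemigroup.exists_norm_fracPow_shift_le`).
-/

/-! ### The holomorphic semigroup of a pseudo-resolvent on the right half plane -/

section PseudoResolvent

variable {E : Type*} [NormedAddCommGroup E] [NormedSpace ℂ E]

/-- A pseudo-resolvent `L z = (z + B)⁻¹` on the open right half plane with `‖L z‖ ≤ M / ‖z‖`;
the operator `B` itself is not mentioned. -/
structure IsHalfPlaneResolvent (L : ℂ → E →L[ℂ] E) (M : ℝ) : Prop where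
  resolvent_eq : ∀ z w : ℂ, 0 < z.re → 0 < w.re → L z - L w = (w - z) • (L z * L w)
  norm_le : ∀ z : ℂ, 0 < z.re → ‖L z‖ ≤ M / ‖z‖

/-- The points `1 + i y` of the vertical line over which all contour integrals are taken. -/
noncomputable def linePt (y : ℝ) : ℂ := 1 + y * Complex.I

theorem linePt_re (y : ℝ) : (linePt y).re = 1 := by simp [linePt]
theorem linePt_im (y : ℝ) : (linePt y).im = y := by simp [linePt]

theorem norm_linePt_sq (y : ℝ) : ‖linePt y‖ ^ 2 = 1 + y ^ 2 := by
  rw [Complex.sq_norm, Complex.normSq_apply, linePt_re, linePt_im]; ring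

theorem one_le_norm_linePt (y : ℝ) : 1 ≤ ‖linePt y‖ := by
  have := Complex.re_le_norm (linePt y)
  rwa [linePt_re] at this

theorem linePt_ne_zero (y : ℝ) : linePt y ≠ 0 := by
  intro h
  have := linePt_re y
  simp [h] at this

theorem norm_exp_linePt (y : ℝ) : ‖Complex.exp (linePt y)‖ = Real.exp 1 := by
  rw [Complex.norm_exp, linePt_re]

theorem hasDerivAt_linePt (y : ℝ) : HasDerivAt linePt Complex.I y := by
  have h : HasDerivAt (fun y : ℝ => (y : ℂ)) 1 y := Complex.ofRealCLM.hasDerivAt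
  have := (h.mul_const Complex.I).const_add 1
  rwa [one_mul] at this

theorem re_linePt_div_pos {t : ℝ} (ht : 0 < t) (y : ℝ) : 0 < (linePt y / (t : ℂ)).re := by
  rw [Complex.div_ofReal_re, linePt_re]; positivity

theorem continuous_linePt : Continuous linePt := by unfold linePt; fun_prop

/-- The rescaled resolvent `(ζ + t B)⁻¹ = t⁻¹ L (ζ / t)` at `ζ = 1 + i y`. -/
noncomputable def scaledRes (L : ℂ → E →L[ℂ] E) (t y : ℝ) : E →L[ℂ] E :=
  (t : ℂ)⁻¹ • L (linePt y / t)

/-- The operator `B (ζ + t B)⁻²`, which is minus the `t`-derivative of `scaledRes L t y`. -/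
noncomputable def scaledResDer (L : ℂ → E →L[ℂ] E) (t y : ℝ) : E →L[ℂ] E :=
  (t : ℂ)⁻¹ • (scaledRes L t y - linePt y • (scaledRes L t y * scaledRes L t y))

/-- The operator `e^{-t B} = (2 π i)⁻¹ ∫ e^{t z} (z + B)⁻¹ dz` for `t > 0`, integrated by parts
once so that the integral converges absolutely, and rescaled by `z = (1 + i y) / t`. -/
noncomputable def dunfordSemi (L : ℂ → E →L[ℂ] E) (t : ℝ) : E →L[ℂ] E :=
  ((2 * Real.pi : ℝ) : ℂ)⁻¹ •
    ∫ y : ℝ, Complex.exp (linePt y) • (scaledRes L t y * scaledRes L t y)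

/-- The operator `B e^{-t B}` for `t > 0`. -/
noncomputable def dunfordGen (L : ℂ → E →L[ℂ] E) (t : ℝ) : E →L[ℂ] E :=
  ((2 * Real.pi : ℝ) : ℂ)⁻¹ •
    ∫ y : ℝ, Complex.exp (linePt y) • ((2 : ℂ) • (scaledRes L t y * scaledResDer L t y))

theorem commute_scaledRes {L : ℂ → E →L[ℂ] E} {t : ℝ} (ht : 0 < t) (y : ℝ) {C : E →L[ℂ] E}
    (hC : ∀ z : ℂ, 0 < z.re → C * L z = L z * C) :
    C * scaledRes L t y = scaledRes L t y * C := by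
  rw [scaledRes, mul_smul_comm, smul_mul_assoc, hC _ (re_linePt_div_pos ht y)]

/-- Continuous functions on the line dominated by `C / (1 + y ^ 2)`. -/
theorem integrable_of_le_inv_one_add_sq {F : Type*} [NormedAddCommGroup F]
    {f : ℝ → F} (hf : Continuous f) {C : ℝ} (hC : ∀ y, ‖f y‖ ≤ C * (1 + y ^ 2)⁻¹) :
    Integrable f :=
  Integrable.mono' (integrable_inv_one_add_sq.const_mul C) hf.aestronglyMeasurable
    (Eventually.of_forall hC)

theorem norm_integral_le_of_le_inv_one_add_sq {F : Type*} [NormedAddCommGroup F] [NormedSpace ℝ F]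
    {f : ℝ → F} {C : ℝ} (hC : ∀ y, ‖f y‖ ≤ C * (1 + y ^ 2)⁻¹) :
    ‖∫ y, f y‖ ≤ C * Real.pi := by
  have := norm_integral_le_of_norm_le (integrable_inv_one_add_sq.const_mul C)
    (Eventually.of_forall hC)
  rwa [integral_const_mul, integral_univ_inv_one_add_sq] at this

/-- Only an integral is multiplied by `a`, so that `a * ∫ (f - k) = 0` can be dropped. -/
theorem mul_integral_add_integral_eq {R : Type*} [NormedRing R] [NormedSpace ℝ R]
    [IsScalarTower ℝ R R] [SMulCommClass ℝ R R] (a : R) {f g k : ℝ → R}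
    (hf : Integrable f) (hg : Integrable g) (hk : Integrable k) (e : ∫ y, f y = ∫ y, k y)
    (hfgk : ∀ y, a * (f y + g y) = a * (f y - k y) + k y) :
    a * ((∫ y, f y) + ∫ y, g y) = ∫ y, f y := by
  have h1 : ∫ y, (f + g) y = (∫ y, f y) + ∫ y, g y := integral_add hf hg
  have h2 : ∫ y, (f - k) y = (∫ y, f y) - ∫ y, k y := integral_sub hf hk
  replace hfgk : ∀ y, a * (f + g) y = (fun y => a * (f - k) y) y + k y := hfgk
  have h3 : ∫ y, (fun y => a * (f - k) y) y + k y = (∫ y, a * (f - k) y) + ∫ y, k y :=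
    integral_add ((hf.sub hk).const_mul' a) hk
  rw [← h1, ← integral_const_mul_of_integrable (hf.add hg), funext hfgk, h3,
    integral_const_mul_of_integrable (hf.sub hk), h2, e, sub_self, mul_zero, zero_add]

namespace IsHalfPlaneResolvent

variable {L : ℂ → E →L[ℂ] E} {M : ℝ} (h : IsHalfPlaneResolvent L M)
include h

theorem M_nonneg : 0 ≤ M := by
  have := (norm_nonneg _).trans (h.norm_le 1 (by simp))
  simpa using this

theorem commute {z w : ℂ} (hz : 0 < z.re) (hw : 0 < w.re) : L z * L w = L w * L z := by
  by_cases e : z = w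
  · rw [e]
  have h1 := h.resolvent_eq z w hz hw
  have h2 := h.resolvent_eq w z hw hz
  have h3 : (w - z) • (L z * L w) = (w - z) • (L w * L z) := by
    rw [← h1, ← neg_sub, h2]; module
  exact smul_right_injective _ (sub_ne_zero.2 (Ne.symm e)) h3

theorem hasDerivAt {z : ℂ} (hz : 0 < z.re) : HasDerivAt L (-(L z * L z)) z := by
  have hnear : ∀ᶠ w in 𝓝 z, 0 < w.re :=
    (isOpen_lt continuous_const Complex.continuous_re).mem_nhds hz
  have hM := h.M_nonneg
  have hz0 : z ≠ 0 := by rintro rfl; simp at hz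
  have hcont : Tendsto L (𝓝 z) (𝓝 (L z)) := by
    rw [tendsto_iff_norm_sub_tendsto_zero]
    have hb : Tendsto (fun w : ℂ => ‖z - w‖ * ((M / ‖w‖) * ‖L z‖)) (𝓝 z) (𝓝 0) := by
      have : ContinuousAt (fun w : ℂ => ‖z - w‖ * ((M / ‖w‖) * ‖L z‖)) z := by
        have : ‖z‖ ≠ 0 := by simpa using hz0
        fun_prop (disch := assumption)
      simpa [ContinuousAt] using this
    refine squeeze_zero' (Eventually.of_forall fun _ => norm_nonneg _) ?_ hb
    filter_upwards [hnear] with w hw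
    rw [h.resolvent_eq w z hw hz, norm_smul]
    gcongr
    exact (norm_mul_le _ _).trans (by gcongr; exact h.norm_le w hw)
  rw [hasDerivAt_iff_tendsto_slope]
  have h2 : Tendsto (fun w => -(L w * L z)) (𝓝[≠] z) (𝓝 (-(L z * L z))) :=
    ((hcont.mul_const (L z)).neg).mono_left nhdsWithin_le_nhds
  refine h2.congr' ?_
  filter_upwards [nhdsWithin_le_nhds hnear, self_mem_nhdsWithin] with w hw hne
  have hne' : w - z ≠ 0 := sub_ne_zero.2 hne
  rw [slope_def_module, h.resolvent_eq w z hw hz, smul_smul, ← neg_sub w z, mul_neg,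
    inv_mul_cancel₀ hne', neg_one_smul]

theorem norm_scaledRes_le {t : ℝ} (ht : 0 < t) (y : ℝ) :
    ‖scaledRes L t y‖ ≤ M / ‖linePt y‖ := by
  have hre := re_linePt_div_pos ht y
  have hp := one_le_norm_linePt y
  rw [scaledRes, norm_smul]
  calc _ ≤ ‖(t : ℂ)⁻¹‖ * (M / ‖linePt y / (t : ℂ)‖) := by gcongr; exact h.norm_le _ hre
    _ = _ := by
      rw [norm_div, norm_inv, Complex.norm_real, Real.norm_of_nonneg ht.le]
      field_simp

theorem hasDerivAt_scaledRes_line {t : ℝ} (ht : 0 < t) (y : ℝ) :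
    HasDerivAt (scaledRes L t) (-Complex.I • (scaledRes L t y * scaledRes L t y)) y := by
  have h1 : HasDerivAt (fun y => linePt y / (t : ℂ)) (Complex.I / t) y :=
    (hasDerivAt_linePt y).div_const _
  have h2 := ((h.hasDerivAt (re_linePt_div_pos ht y)).scomp y h1).const_smul ((t : ℂ)⁻¹)
  refine h2.congr_deriv ?_
  simp only [scaledRes, smul_mul_assoc, mul_smul_comm, smul_smul, smul_neg]
  match_scalars
  ring

theorem continuous_scaledRes {t : ℝ} (ht : 0 < t) : Continuous (scaledRes L t) :=
  continuous_iff_continuousAt.2 fun y => (h.hasDerivAt_scaledRes_line ht y).continuousAt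

theorem continuous_scaledResDer {t : ℝ} (ht : 0 < t) : Continuous (scaledResDer L t) := by
  have h1 := h.continuous_scaledRes ht
  have h2 := continuous_linePt
  unfold scaledResDer
  fun_prop

theorem hasDerivAt_scaledRes_time {t : ℝ} (ht : 0 < t) (y : ℝ) :
    HasDerivAt (fun t => scaledRes L t y) (-scaledResDer L t y) t := by
  have ht' : (t : ℂ) ≠ 0 := by exact_mod_cast ht.ne'
  have h0 : HasDerivAt (fun t : ℝ => ((t : ℝ) : ℂ)) 1 t := Complex.ofRealCLM.hasDerivAt
  have hi : HasDerivAt (fun t : ℝ => ((t : ℝ) : ℂ)⁻¹) (-1 / (t : ℂ) ^ 2) t := h0.inv ht'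
  have h1 : HasDerivAt (fun t : ℝ => linePt y / (t : ℂ)) (linePt y * (-1 / (t : ℂ) ^ 2)) t := by
    simpa [div_eq_mul_inv] using hi.const_mul (linePt y)
  have h2 := hi.smul ((h.hasDerivAt (re_linePt_div_pos ht y)).scomp t h1)
  refine h2.congr_deriv ?_
  simp only [scaledResDer, scaledRes, smul_mul_assoc, mul_smul_comm, smul_smul, smul_neg,
    Function.comp, smul_sub]
  match_scalars <;> field_simp

theorem norm_scaledRes_mul_le {t : ℝ} (ht : 0 < t) (y : ℝ) :
    ‖scaledRes L t y * scaledRes L t y‖ ≤ M ^ 2 * (1 + y ^ 2)⁻¹ := by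
  have hp := one_le_norm_linePt y
  have hM := h.M_nonneg
  calc _ ≤ (M / ‖linePt y‖) * (M / ‖linePt y‖) :=
        (norm_mul_le _ _).trans (mul_le_mul (h.norm_scaledRes_le ht y) (h.norm_scaledRes_le ht y)
          (norm_nonneg _) (by positivity))
    _ = _ := by rw [← norm_linePt_sq]; field_simp

theorem norm_scaledRes_mul_der_le {t : ℝ} (ht : 0 < t) (y : ℝ) :
    ‖scaledRes L t y * scaledResDer L t y‖ ≤ (M ^ 2 + M ^ 3) / t * (1 + y ^ 2)⁻¹ := by
  have hp := one_le_norm_linePt y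
  have hM := h.M_nonneg
  have h1 := h.norm_scaledRes_le ht y
  have h2 : ‖scaledResDer L t y‖ ≤ t⁻¹ * (M / ‖linePt y‖ +
      ‖linePt y‖ * ((M / ‖linePt y‖) * (M / ‖linePt y‖))) := by
    rw [scaledResDer, norm_smul, norm_inv, Complex.norm_real, Real.norm_of_nonneg ht.le]
    gcongr
    refine (norm_sub_le _ _).trans ?_
    gcongr
    rw [norm_smul]
    gcongr
    exact (norm_mul_le _ _).trans (by gcongr)
  calc _ ≤ (M / ‖linePt y‖) * (t⁻¹ * (M / ‖linePt y‖ +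
      ‖linePt y‖ * ((M / ‖linePt y‖) * (M / ‖linePt y‖)))) :=
        (norm_mul_le _ _).trans (mul_le_mul h1 h2 (norm_nonneg _) (by positivity))
    _ = _ := by rw [← norm_linePt_sq]; field_simp

theorem norm_semi_integrand_le {t : ℝ} (ht : 0 < t) (y : ℝ) :
    ‖Complex.exp (linePt y) • (scaledRes L t y * scaledRes L t y)‖
      ≤ Real.exp 1 * M ^ 2 * (1 + y ^ 2)⁻¹ := by
  rw [norm_smul, norm_exp_linePt, mul_assoc]
  gcongr
  exact h.norm_scaledRes_mul_le ht y

theorem norm_gen_integrand_le {t : ℝ} (ht : 0 < t) (y : ℝ) :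
    ‖Complex.exp (linePt y) • ((2 : ℂ) • (scaledRes L t y * scaledResDer L t y))‖
      ≤ Real.exp 1 * 2 * (M ^ 2 + M ^ 3) / t * (1 + y ^ 2)⁻¹ := by
  rw [norm_smul, norm_exp_linePt, norm_smul, Complex.norm_two]
  calc _ ≤ Real.exp 1 * (2 * ((M ^ 2 + M ^ 3) / t * (1 + y ^ 2)⁻¹)) := by
        gcongr; exact h.norm_scaledRes_mul_der_le ht y
    _ = _ := by ring

theorem integrable_semi {t : ℝ} (ht : 0 < t) :
    Integrable fun y => Complex.exp (linePt y) • (scaledRes L t y * scaledRes L t y) := by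
  have h1 := h.continuous_scaledRes ht
  have h2 := continuous_linePt
  exact integrable_of_le_inv_one_add_sq (by fun_prop) (h.norm_semi_integrand_le ht)

theorem integrable_gen {t : ℝ} (ht : 0 < t) :
    Integrable fun y => Complex.exp (linePt y) •
      ((2 : ℂ) • (scaledRes L t y * scaledResDer L t y)) := by
  have h1 := h.continuous_scaledRes ht
  have h2 := continuous_linePt
  have h3 := h.continuous_scaledResDer ht
  exact integrable_of_le_inv_one_add_sq (by fun_prop) (h.norm_gen_integrand_le ht)

theorem norm_dunfordSemi_le {t : ℝ} (ht : 0 < t) :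
    ‖dunfordSemi L t‖ ≤ Real.exp 1 * M ^ 2 / 2 := by
  rw [dunfordSemi, norm_smul, norm_inv, Complex.norm_real, Real.norm_of_nonneg (by positivity)]
  calc _ ≤ (2 * Real.pi)⁻¹ * (Real.exp 1 * M ^ 2 * Real.pi) := by
        gcongr; exact norm_integral_le_of_le_inv_one_add_sq (h.norm_semi_integrand_le ht)
    _ = _ := by field_simp

theorem norm_dunfordGen_le {t : ℝ} (ht : 0 < t) :
    ‖dunfordGen L t‖ ≤ Real.exp 1 * (M ^ 2 + M ^ 3) / t := by
  rw [dunfordGen, norm_smul, norm_inv, Complex.norm_real, Real.norm_of_nonneg (by positivity)]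
  calc _ ≤ (2 * Real.pi)⁻¹ * (Real.exp 1 * 2 * (M ^ 2 + M ^ 3) / t * Real.pi) := by
        gcongr; exact norm_integral_le_of_le_inv_one_add_sq (h.norm_gen_integrand_le ht)
    _ = _ := by field_simp

theorem commute_dunfordSemi {t : ℝ} (ht : 0 < t) {C : E →L[ℂ] E}
    (hC : ∀ z : ℂ, 0 < z.re → C * L z = L z * C) :
    C * dunfordSemi L t = dunfordSemi L t * C := by
  rw [dunfordSemi, mul_smul_comm, smul_mul_assoc,
    ← integral_const_mul_of_integrable (h.integrable_semi ht),
    ← integral_mul_const_of_integrable (h.integrable_semi ht)]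
  congr 2
  funext y
  rw [mul_smul_comm, smul_mul_assoc, ← mul_assoc, commute_scaledRes ht y hC, mul_assoc,
    commute_scaledRes ht y hC, mul_assoc]

/-- `d/dt e^{-t B} = - B e^{-t B}` in operator norm. -/
theorem hasDerivAt_dunfordSemi {t : ℝ} (ht : 0 < t) :
    HasDerivAt (dunfordSemi L) (-dunfordGen L t) t := by
  have hball : ∀ x ∈ Metric.ball t (t / 2), t / 2 < x := fun x hx => by
    rw [Metric.mem_ball, Real.dist_eq, abs_lt] at hx; linarith
  have key := hasDerivAt_integral_of_dominated_loc_of_deriv_le (μ := volume) (𝕜 := ℝ)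
    (F := fun t y => Complex.exp (linePt y) • (scaledRes L t y * scaledRes L t y))
    (F' := fun t y => -(Complex.exp (linePt y) •
      ((2 : ℂ) • (scaledRes L t y * scaledResDer L t y)))) (x₀ := t)
    (s := Metric.ball t (t / 2))
    (bound := fun y => Real.exp 1 * 2 * (M ^ 2 + M ^ 3) / (t / 2) * (1 + y ^ 2)⁻¹)
    (Metric.ball_mem_nhds _ (by positivity)) ?_ (h.integrable_semi ht) ?_ ?_ ?_ ?_
  · have := key.2.const_smul (((2 * Real.pi : ℝ) : ℂ)⁻¹)
    refine this.congr_deriv ?_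
    rw [integral_neg, smul_neg, dunfordGen]
  · filter_upwards [Metric.ball_mem_nhds t (half_pos ht)] with x hx
    exact (h.integrable_semi (by linarith [hball x hx])).aestronglyMeasurable
  · exact (h.integrable_gen ht).aestronglyMeasurable.neg
  · refine Eventually.of_forall fun y x hx => ?_
    have hx' := hball x hx
    have hM := h.M_nonneg
    rw [norm_neg]
    refine (h.norm_gen_integrand_le (by linarith) y).trans ?_
    gcongr
  · exact integrable_inv_one_add_sq.const_mul _
  · refine Eventually.of_forall fun y x hx => ?_
    have hx' : 0 < x := by linarith [hball x hx]
    have h1 := h.hasDerivAt_scaledRes_time hx' y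
    have h2 := (h1.mul h1).const_smul (Complex.exp (linePt y))
    refine h2.congr_deriv ?_
    have hc : scaledResDer L x y * scaledRes L x y = scaledRes L x y * scaledResDer L x y := by
      simp only [scaledResDer, smul_mul_assoc, mul_smul_comm, mul_sub, sub_mul, mul_assoc]
    rw [neg_mul, mul_neg, hc, ← neg_add, smul_neg, two_smul]

theorem integrable_scaledRes_cube {t : ℝ} (ht : 0 < t) :
    Integrable fun y : ℝ => Complex.exp (linePt y) •
      ((2 : ℂ) • (scaledRes L t y * (scaledRes L t y * scaledRes L t y))) := by
  have c1 := h.continuous_scaledRes ht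
  have c2 := continuous_linePt
  have hM := h.M_nonneg
  refine integrable_of_le_inv_one_add_sq (by fun_prop) (C := Real.exp 1 * (2 * (M * M ^ 2)))
    fun y => ?_
  rw [norm_smul, norm_exp_linePt, norm_smul, Complex.norm_two, mul_assoc, mul_assoc, mul_assoc]
  gcongr
  refine (norm_mul_le _ _).trans ?_
  gcongr
  · exact (h.norm_scaledRes_le ht y).trans (div_le_self hM (one_le_norm_linePt y))
  · exact h.norm_scaledRes_mul_le ht y

/-- Integration by parts along the line: `∫ e^ζ (ζ + t B)⁻² = 2 ∫ e^ζ (ζ + t B)⁻³`. -/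
theorem integral_scaledRes_sq {t : ℝ} (ht : 0 < t) :
    ∫ y : ℝ, Complex.exp (linePt y) • (scaledRes L t y * scaledRes L t y)
      = ∫ y : ℝ, Complex.exp (linePt y) •
        ((2 : ℂ) • (scaledRes L t y * (scaledRes L t y * scaledRes L t y))) := by
  have hi := h.integrable_scaledRes_cube ht
  have hz := integral_eq_zero_of_hasDerivAt_of_integrable
    (f := fun y : ℝ => Complex.exp (linePt y) • (scaledRes L t y * scaledRes L t y))
    (f' := fun y : ℝ => Complex.I • (Complex.exp (linePt y) • (scaledRes L t y * scaledRes L t y)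
      - Complex.exp (linePt y) •
        ((2 : ℂ) • (scaledRes L t y * (scaledRes L t y * scaledRes L t y))))) ?_
    (((h.integrable_semi ht).sub hi).smul Complex.I) (h.integrable_semi ht)
  · rw [integral_smul, integral_sub (h.integrable_semi ht) hi] at hz
    exact sub_eq_zero.1 ((smul_eq_zero.1 hz).resolve_left Complex.I_ne_zero)
  · intro y
    have h1 := h.hasDerivAt_scaledRes_line ht y
    have h2 : HasDerivAt (fun y => Complex.exp (linePt y))
      (Complex.exp (linePt y) * Complex.I) y := (hasDerivAt_linePt y).cexp
    refine (h2.smul (h1.mul h1)).congr_deriv ?_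
    simp only [smul_mul_assoc, mul_smul_comm, mul_assoc]
    module

/-- `(1 + B)⁻¹ (1 + B) (ζ + t B)⁻¹ = (ζ + t B)⁻¹`, where `B (ζ + t B)⁻¹` is expressed by the
resolvent itself. -/
theorem resolvent_mul_scaledRes {t : ℝ} (ht : 0 < t) (y : ℝ) :
    L 1 * scaledRes L t y + L 1 * ((t : ℂ)⁻¹ • (1 - linePt y • scaledRes L t y))
      = scaledRes L t y := by
  have ht' : (t : ℂ) ≠ 0 := by exact_mod_cast ht.ne'
  have hre := re_linePt_div_pos ht y
  have := h.resolvent_eq 1 (linePt y / t) (by simp) hre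
  have e : L (linePt y / t) = (t : ℂ) • scaledRes L t y := by
    rw [scaledRes, smul_smul, mul_inv_cancel₀ ht', one_smul]
  rw [e, mul_smul_comm, smul_smul, sub_mul, div_mul_cancel₀ _ ht', one_mul] at this
  have h3 : L 1 = (linePt y - t) • (L 1 * scaledRes L t y) + (t : ℂ) • scaledRes L t y := by
    rw [← this]; abel
  rw [mul_smul_comm, mul_sub, mul_one, mul_smul_comm]
  nth_rewrite 2 [h3]
  match_scalars <;> field_simp
  ring

/-- The identity `(1 + B)⁻¹ (e^{-t B} + B e^{-t B}) = e^{-t B}` at the level of integrands, up to the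
difference of the two sides of `integral_scaledRes_sq`. -/
theorem resolvent_mul_integrand {t : ℝ} (ht : 0 < t) (y : ℝ) :
    L 1 * (Complex.exp (linePt y) • (scaledRes L t y * scaledRes L t y) +
      Complex.exp (linePt y) • ((2 : ℂ) • (scaledRes L t y * scaledResDer L t y)))
      = L 1 * (Complex.exp (linePt y) • (scaledRes L t y * scaledRes L t y)
      - Complex.exp (linePt y) •
        ((2 : ℂ) • (scaledRes L t y * (scaledRes L t y * scaledRes L t y))))
      + Complex.exp (linePt y) • ((2 : ℂ) •
          (scaledRes L t y * (scaledRes L t y * scaledRes L t y))) := by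
  have k := congrArg (fun T => T * (scaledRes L t y * scaledRes L t y))
    (h.resolvent_mul_scaledRes ht y)
  simp only [scaledResDer, mul_add, add_mul, mul_sub, sub_mul, mul_smul_comm, smul_mul_assoc,
    mul_assoc, mul_one] at k ⊢
  linear_combination (norm := module) (2 * Complex.exp (linePt y)) • k

/-- `(1 + B)⁻¹ (e^{-t B} + B e^{-t B}) = e^{-t B}`: so the range of `e^{-t B}` lies in the domain
of `B`, and `dunfordGen` is `B e^{-t B}`. -/
theorem resolvent_mul_add {t : ℝ} (ht : 0 < t) :
    L 1 * (dunfordSemi L t + dunfordGen L t) = dunfordSemi L t := by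
  rw [dunfordSemi, dunfordGen, ← smul_add, mul_smul_comm,
    mul_integral_add_integral_eq (L 1) (h.integrable_semi ht) (h.integrable_gen ht)
      (h.integrable_scaledRes_cube ht) (h.integral_scaledRes_sq ht) (h.resolvent_mul_integrand ht)]

end IsHalfPlaneResolvent
end PseudoResolvent

/-! ### An inverse Laplace transform -/

section InverseLaplace

theorem hasDerivAt_primitive_mul_exp {c : ℂ} (hc : c ≠ 0) (t : ℝ) :
    HasDerivAt (fun t : ℝ => -((t : ℂ) / c + 1 / c ^ 2) * Complex.exp (-(c * t)))
      (t * Complex.exp (-(c * t))) t := by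
  have h0 : HasDerivAt (fun t : ℝ => ((t : ℝ) : ℂ)) 1 t := Complex.ofRealCLM.hasDerivAt
  have h1 := ((h0.div_const c).add_const (1 / c ^ 2)).neg
  have h2 := (h0.const_mul c).neg.cexp
  refine (h1.mul h2).congr_deriv ?_
  simp only [Pi.neg_apply]
  field_simp
  ring

theorem integrableOn_mul_exp_neg {c : ℂ} (hc : 0 < c.re) :
    IntegrableOn (fun t : ℝ => (t : ℂ) * Complex.exp (-(c * t))) (Set.Ioi 0) := by
  have h1 := integrableOn_rpow_mul_exp_neg_mul_rpow (s := 1) (p := 1) (b := c.re) (by norm_num)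
    one_pos hc
  refine h1.mono' (by fun_prop) ?_
  refine (ae_restrict_mem measurableSet_Ioi).mono fun t ht => ?_
  rw [norm_mul, Complex.norm_exp, Complex.norm_real, Real.norm_of_nonneg (le_of_lt ht)]
  simp

theorem integral_mul_exp_neg {c : ℂ} (hc : 0 < c.re) :
    ∫ t in Set.Ioi (0 : ℝ), (t : ℂ) * Complex.exp (-(c * t)) = (c ^ 2)⁻¹ := by
  have hc0 : c ≠ 0 := by rintro rfl; simp at hc
  have key := integral_Ioi_of_hasDerivAt_of_tendsto (a := 0) (m := 0)
    (f := fun t : ℝ => -((t : ℂ) / c + 1 / c ^ 2) * Complex.exp (-(c * t)))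
    (hasDerivAt_primitive_mul_exp hc0 0).continuousAt.continuousWithinAt
    (fun t _ => hasDerivAt_primitive_mul_exp hc0 t) (integrableOn_mul_exp_neg hc) ?_
  · rw [key]; simp
  · rw [tendsto_zero_iff_norm_tendsto_zero]
    have e1 : Tendsto (fun t : ℝ => (t * Real.exp (-c.re * t)) * (1 / ‖c‖)
        + (1 / ‖c‖ ^ 2) * Real.exp (-c.re * t)) atTop (𝓝 0) := by
      have a1 : Tendsto (fun t : ℝ => t * Real.exp (-c.re * t)) atTop (𝓝 0) := by
        simpa using tendsto_rpow_mul_exp_neg_mul_atTop_nhds_zero 1 c.re hc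
      have a2 : Tendsto (fun t : ℝ => Real.exp (-c.re * t)) atTop (𝓝 0) := by
        simpa using tendsto_rpow_mul_exp_neg_mul_atTop_nhds_zero 0 c.re hc
      have a3 := (a1.mul_const (1 / ‖c‖)).add (a2.const_mul (1 / ‖c‖ ^ 2))
      rwa [zero_mul, mul_zero, add_zero] at a3
    refine squeeze_zero' (Eventually.of_forall fun _ => norm_nonneg _) ?_ e1
    filter_upwards [eventually_ge_atTop 0] with t ht
    rw [norm_mul, norm_neg, Complex.norm_exp]
    have : ‖(t : ℂ) / c + 1 / c ^ 2‖ ≤ t * (1 / ‖c‖) + 1 / ‖c‖ ^ 2 := by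
      refine (norm_add_le _ _).trans (le_of_eq ?_)
      rw [norm_div, norm_div, norm_pow, Complex.norm_real, Real.norm_of_nonneg ht, norm_one]
      ring
    calc _ ≤ (t * (1 / ‖c‖) + 1 / ‖c‖ ^ 2) * Real.exp (-c.re * t) := by
          gcongr
          simp
      _ = _ := by ring

open FourierTransform in
/-- The inverse Laplace transform of `ζ⁻²` at `1`, obtained by Fourier inversion of
`t ↦ t e^{-t}` on the half line. -/
theorem integral_exp_linePt_inv_sq :
    ∫ y : ℝ, Complex.exp (linePt y) * (linePt y ^ 2)⁻¹ = 2 * Real.pi := by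
  set f : ℝ → ℂ := fun t => ((max t 0 : ℝ) : ℂ) * Complex.exp (-t) with hf
  have hcont : Continuous f := by rw [hf]; fun_prop
  have hsupp : ∀ g : ℝ → ℂ, ∀ t ∉ Set.Ioi (0 : ℝ), g t • f t = 0 := fun g t ht => by
    have : max t 0 = 0 := max_eq_right (by simpa using ht)
    simp [hf, this]
  have hint : Integrable f := by
    have h1 := integrableOn_mul_exp_neg (c := 1) (by simp)
    have h2 : IntegrableOn f (Set.Ioi 0) := by
      refine h1.congr_fun (fun t ht => ?_) measurableSet_Ioi
      have : max t 0 = t := max_eq_left (le_of_lt ht)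
      simp [hf, this]
    rwa [integrableOn_iff_integrable_of_support_subset] at h2
    intro t ht
    by_contra hn
    exact ht (by simpa using hsupp 1 t hn)
  have hF : 𝓕 f = fun ξ => (linePt (2 * Real.pi * ξ) ^ 2)⁻¹ := by
    funext ξ
    rw [Real.fourier_real_eq_integral_exp_smul, ← integral_mul_exp_neg
      (by rw [linePt_re]; exact one_pos), ← setIntegral_eq_integral_of_forall_compl_eq_zero
      (s := Set.Ioi 0) (fun t ht =>
        hsupp (fun v => Complex.exp (((-2 * Real.pi * v * ξ : ℝ) : ℂ) * Complex.I)) t ht)]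
    refine setIntegral_congr_fun measurableSet_Ioi fun t ht => ?_
    have : max t 0 = t := max_eq_left (le_of_lt ht)
    simp only [hf, this, smul_eq_mul]
    rw [mul_left_comm, ← Complex.exp_add]
    congr 2
    rw [linePt]; push_cast; ring
  have hFint : Integrable (𝓕 f) := by
    rw [hF]
    have h1 : Integrable fun y : ℝ => (linePt y ^ 2)⁻¹ := by
      refine integrable_of_le_inv_one_add_sq (C := 1) ?_ fun y => ?_
      · exact (continuous_linePt.pow 2).inv₀ fun y => pow_ne_zero 2 (linePt_ne_zero y)
      · rw [norm_inv, norm_pow, norm_linePt_sq, one_mul]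
    exact h1.comp_mul_left' (by positivity)
  have hinv := congrFun (hcont.fourierInv_fourier_eq hint hFint) 1
  rw [Real.fourierInv_eq', hF] at hinv
  have e : (fun v : ℝ => Complex.exp (((2 * Real.pi * inner ℝ v 1 : ℝ) : ℂ) * Complex.I) •
      (linePt (2 * Real.pi * v) ^ 2)⁻¹) = fun v => (fun y : ℝ => Complex.exp (-1) *
        (Complex.exp (linePt y) * (linePt y ^ 2)⁻¹)) (2 * Real.pi * v) := by
    funext v
    simp only [smul_eq_mul, ← mul_assoc, ← Complex.exp_add]
    congr 2
    simp [linePt]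
  rw [e, Measure.integral_comp_mul_left (fun y : ℝ => Complex.exp (-1) *
        (Complex.exp (linePt y) * (linePt y ^ 2)⁻¹)) (2 * Real.pi), integral_const_mul,
    abs_of_pos (by positivity)] at hinv
  have h3 : Complex.exp (-1) ≠ 0 := Complex.exp_ne_zero _
  have hpi : (Real.pi : ℂ) ≠ 0 := by exact_mod_cast Real.pi_ne_zero
  simp only [hf, Complex.real_smul] at hinv
  push_cast at hinv
  simp only [zero_le_one, sup_of_le_left, Complex.ofReal_one, one_mul] at hinv
  rw [mul_left_comm] at hinv
  have h4 := mul_left_cancel₀ h3 (hinv.trans (mul_one _).symm)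
  field_simp at h4
  exact h4
end InverseLaplace

/-! ### Strong continuity and the semigroup law -/

section
variable {E : Type*} [NormedAddCommGroup E] [NormedSpace ℂ E]

namespace IsHalfPlaneResolvent
variable {L : ℂ → E →L[ℂ] E} {M : ℝ} (h : IsHalfPlaneResolvent L M)
include h

/-- `ζ (ζ + t B)⁻¹ x = x - t (ζ + t B)⁻¹ B x` for `x = (1 + B)⁻¹ w`, where `B x = w - x`. -/
theorem linePt_smul_scaledRes_apply {t : ℝ} (ht : 0 < t) (y : ℝ) (w : E) :
    linePt y • scaledRes L t y (L 1 w) = L 1 w - (t : ℂ) • scaledRes L t y (w - L 1 w) := by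
  have ht' : (t : ℂ) ≠ 0 := by exact_mod_cast ht.ne'
  have h1 := congrArg (fun T => T w) (h.resolvent_eq (linePt y / t) 1 (re_linePt_div_pos ht y)
    (by simp))
  have e : L (linePt y / t) = (t : ℂ) • scaledRes L t y := by
    rw [scaledRes, smul_smul, mul_inv_cancel₀ ht', one_smul]
  replace h1 : (t : ℂ) • scaledRes L t y w - L 1 w
      = ((1 - linePt y / t) * t) • scaledRes L t y (L 1 w) := by
    rw [mul_smul]
    rw [e] at h1
    exact h1
  rw [sub_mul, div_mul_cancel₀ _ ht', one_mul, sub_smul] at h1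
  rw [map_sub, smul_sub]
  linear_combination (norm := module) h1

theorem commute_dunfordSemi_resolvent {t : ℝ} (ht : 0 < t) {z : ℂ} (hz : 0 < z.re) :
    L z * dunfordSemi L t = dunfordSemi L t * L z :=
  h.commute_dunfordSemi ht fun _ hw => h.commute hz hw

theorem dunfordGen_mul_dunfordSemi (hinj : Function.Injective (L 1)) {s t : ℝ} (hs : 0 < s)
    (ht : 0 < t) : dunfordGen L s * dunfordSemi L t = dunfordSemi L s * dunfordGen L t := by
  have hcancel : ∀ T T' : E →L[ℂ] E, L 1 * T = L 1 * T' → T = T' := fun T T' e => by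
    ext x
    exact hinj (congrArg (fun S => S x) e)
  have hV : ∀ r : ℝ, 0 < r → L 1 * dunfordGen L r = dunfordSemi L r - L 1 * dunfordSemi L r :=
    fun r hr => by rw [eq_sub_iff_add_eq, add_comm, ← mul_add, h.resolvent_mul_add hr]
  have hc := h.commute_dunfordSemi_resolvent hs (z := 1) (by simp)
  apply hcancel
  rw [← mul_assoc, hV s hs, ← mul_assoc, hc, mul_assoc, hV t ht, sub_mul, mul_sub, mul_assoc]

variable [CompleteSpace E]

/-- The rate at which `e^{-t B} x → x` for `x = (1 + B)⁻¹ w` in the domain of `B`;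
here `w - x = B x`. -/
theorem norm_dunfordSemi_sub_le {t : ℝ} (ht : 0 < t) (w : E) :
    ‖dunfordSemi L t (L 1 w) - L 1 w‖ ≤
      t * (Real.exp 1 * (M + M ^ 2) * ‖w - L 1 w‖ / 2) := by
  set x := L 1 w with hx
  set b := w - x with hb
  have hM := h.M_nonneg
  have hi : Integrable fun y : ℝ => Complex.exp (linePt y) * (linePt y ^ 2)⁻¹ := by
    refine integrable_of_le_inv_one_add_sq (C := Real.exp 1) ?_ fun y => ?_
    · exact continuous_linePt.cexp.mul
        ((continuous_linePt.pow 2).inv₀ fun y => pow_ne_zero 2 (linePt_ne_zero y))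
    · rw [norm_mul, norm_exp_linePt, norm_inv, norm_pow, norm_linePt_sq]
  have hpi : ((2 * Real.pi : ℝ) : ℂ) ≠ 0 := by exact_mod_cast (by positivity)
  have e1 : x = ((2 * Real.pi : ℝ) : ℂ)⁻¹ •
      ∫ y : ℝ, (Complex.exp (linePt y) * (linePt y ^ 2)⁻¹) • x := by
    rw [integral_smul_const, integral_exp_linePt_inv_sq, smul_smul]
    push_cast at hpi ⊢
    rw [inv_mul_cancel₀ hpi, one_smul]
  have e2 : dunfordSemi L t x = ((2 * Real.pi : ℝ) : ℂ)⁻¹ •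
      ∫ y : ℝ, (Complex.exp (linePt y) • (scaledRes L t y * scaledRes L t y)) x := by
    rw [dunfordSemi, _root_.smul_apply,
      ContinuousLinearMap.integral_apply (h.integrable_semi ht)]
  have e3 : dunfordSemi L t x - x = ((2 * Real.pi : ℝ) : ℂ)⁻¹ •
      ∫ y : ℝ, ((Complex.exp (linePt y) • (scaledRes L t y * scaledRes L t y)) x
        - (Complex.exp (linePt y) * (linePt y ^ 2)⁻¹) • x) := by
    rw [integral_sub ((h.integrable_semi ht).apply_continuousLinearMap x) (hi.smul_const x),
      smul_sub, ← e1, ← e2]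
  rw [e3, norm_smul, norm_inv, Complex.norm_real, Real.norm_of_nonneg (by positivity)]
  have hbound := norm_integral_le_of_le_inv_one_add_sq
    (f := fun y : ℝ => ((Complex.exp (linePt y) • (scaledRes L t y * scaledRes L t y)) x
        - (Complex.exp (linePt y) * (linePt y ^ 2)⁻¹) • x))
    (C := t * (Real.exp 1 * (M + M ^ 2) * ‖b‖)) ?_
  · calc _ ≤ (2 * Real.pi)⁻¹ * (t * (Real.exp 1 * (M + M ^ 2) * ‖b‖) * Real.pi) := by gcongr
      _ = _ := by field_simp
  · intro y
    have hp := one_le_norm_linePt y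
    have hne := linePt_ne_zero y
    have k := h.linePt_smul_scaledRes_apply ht y w
    rw [← hx, ← hb] at k
    have k2 : (linePt y ^ 2) • scaledRes L t y (scaledRes L t y x) =
        x - (t : ℂ) • scaledRes L t y b
          - (t : ℂ) • linePt y • scaledRes L t y (scaledRes L t y b) := by
      rw [pow_two, mul_smul, ← map_smul, k, map_sub, map_smul, smul_sub, k, smul_comm]
    have k3 : scaledRes L t y (scaledRes L t y x) - (linePt y ^ 2)⁻¹ • x =
        -((t : ℂ) • ((linePt y ^ 2)⁻¹ • scaledRes L t y b
          + (linePt y)⁻¹ • scaledRes L t y (scaledRes L t y b))) := by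
      have : scaledRes L t y (scaledRes L t y x) = (linePt y ^ 2)⁻¹ •
        (linePt y ^ 2) • scaledRes L t y (scaledRes L t y x) := by
        rw [smul_smul, inv_mul_cancel₀ (pow_ne_zero 2 hne), one_smul]
      rw [this, k2]
      match_scalars <;> field_simp
      ring
    have k4 : (Complex.exp (linePt y) • (scaledRes L t y * scaledRes L t y)) x
        - (Complex.exp (linePt y) * (linePt y ^ 2)⁻¹) • x = Complex.exp (linePt y) •
        (scaledRes L t y (scaledRes L t y x) - (linePt y ^ 2)⁻¹ • x) := by
      rw [smul_sub, mul_smul]; rfl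
    have b1 : ‖scaledRes L t y b‖ ≤ M * ‖b‖ := by
      refine (ContinuousLinearMap.le_opNorm _ _).trans ?_
      gcongr
      exact (h.norm_scaledRes_le ht y).trans (div_le_self hM hp)
    have b2 : ‖scaledRes L t y (scaledRes L t y b)‖ ≤ M ^ 2 * (1 + y ^ 2)⁻¹ * ‖b‖ :=
      ((scaledRes L t y * scaledRes L t y).le_opNorm b).trans
        (by gcongr; exact h.norm_scaledRes_mul_le ht y)
    rw [k4, k3, norm_smul, norm_exp_linePt, norm_neg, norm_smul, Complex.norm_real,
      Real.norm_of_nonneg ht.le]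
    have b3 : ‖(linePt y ^ 2)⁻¹ • scaledRes L t y b‖ ≤ (1 + y ^ 2)⁻¹ * (M * ‖b‖) := by
      rw [norm_smul, norm_inv, norm_pow, norm_linePt_sq]; gcongr
    have b4 : ‖(linePt y)⁻¹ • scaledRes L t y (scaledRes L t y b)‖ ≤
        1 * (M ^ 2 * (1 + y ^ 2)⁻¹ * ‖b‖) := by
      rw [norm_smul, norm_inv]
      gcongr
      exact inv_le_one_of_one_le₀ hp
    calc _ ≤ Real.exp 1 * (t * ((1 + y ^ 2)⁻¹ * (M * ‖b‖)
            + 1 * (M ^ 2 * (1 + y ^ 2)⁻¹ * ‖b‖))) := by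
          gcongr
          exact (norm_add_le _ _).trans (add_le_add b3 b4)
      _ = _ := by ring

/-- Strong continuity at `0`: the bound on the range of `L 1` extends by density. -/
theorem tendsto_dunfordSemi (hd : DenseRange (L 1)) (x : E) :
    Tendsto (fun t => dunfordSemi L t x) (𝓝[>] 0) (𝓝 x) := by
  have hM := h.M_nonneg
  set K := Real.exp 1 * M ^ 2 / 2 with hK
  have hK0 : 0 ≤ K := by positivity
  rw [Metric.tendsto_nhds]
  intro ε hε
  obtain ⟨w, hw⟩ := hd.exists_dist_lt x (ε := ε / (2 * (K + 1))) (by positivity)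
  rw [dist_eq_norm] at hw
  set C := Real.exp 1 * (M + M ^ 2) * ‖w - L 1 w‖ / 2 with hC
  have hlim : Tendsto (fun t : ℝ => t * C) (𝓝[>] 0) (𝓝 0) := by
    have : Tendsto (fun t : ℝ => t * C) (𝓝 0) (𝓝 (0 * C)) := tendsto_id.mul_const C
    rw [zero_mul] at this
    exact this.mono_left nhdsWithin_le_nhds
  filter_upwards [hlim.eventually (gt_mem_nhds (half_pos hε)), self_mem_nhdsWithin] with t h1 ht
  rw [dist_eq_norm]
  have e : dunfordSemi L t x - x = dunfordSemi L t (x - L 1 w) - (x - L 1 w)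
      + (dunfordSemi L t (L 1 w) - L 1 w) := by rw [map_sub]; abel
  rw [e]
  have b1 : ‖dunfordSemi L t (x - L 1 w)‖ ≤ K * ‖x - L 1 w‖ :=
    (ContinuousLinearMap.le_opNorm _ _).trans (by gcongr; exact h.norm_dunfordSemi_le ht)
  have b2 := h.norm_dunfordSemi_sub_le ht w
  have b3 : (K + 1) * ‖x - L 1 w‖ < ε / 2 := by
    calc _ < (K + 1) * (ε / (2 * (K + 1))) := by gcongr
      _ = ε / 2 := by field_simp
  calc _ ≤ ‖dunfordSemi L t (x - L 1 w)‖ + ‖x - L 1 w‖ + ‖dunfordSemi L t (L 1 w) - L 1 w‖ :=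
        (norm_add_le _ _).trans (by gcongr; exact norm_sub_le _ _)
    _ < ε := by rw [← hC] at b2; linarith

/-- The semigroup law: `s ↦ e^{-(t - s) B} e^{-s B}` has derivative zero on `(0, t)`. -/
theorem dunfordSemi_add (hinj : Function.Injective (L 1)) (hd : DenseRange (L 1)) {s t : ℝ}
    (hs : 0 < s) (ht : 0 < t) :
    dunfordSemi L (s + t) = dunfordSemi L s * dunfordSemi L t := by
  have hder : ∀ r ∈ Set.Ioo 0 (s + t),
      HasDerivAt (fun r => dunfordSemi L (s + t - r) * dunfordSemi L r) 0 r := by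
    intro r hr
    have hr' : 0 < s + t - r := by linarith [hr.2]
    have h1 : HasDerivAt (fun r => dunfordSemi L (s + t - r)) (dunfordGen L (s + t - r)) r := by
      have := (h.hasDerivAt_dunfordSemi hr').scomp r ((hasDerivAt_id r).const_sub (s + t))
      simpa [Function.comp_def] using this
    refine (h1.mul (h.hasDerivAt_dunfordSemi hr.1)).congr_deriv ?_
    rw [h.dunfordGen_mul_dunfordSemi hinj hr' hr.1, mul_neg, add_neg_cancel]
  have hconst : ∀ r ∈ Set.Ioo 0 (s + t), dunfordSemi L (s + t - r) * dunfordSemi L r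
      = dunfordSemi L s * dunfordSemi L t := by
    intro r hr
    have := isOpen_Ioo.is_const_of_deriv_eq_zero isPreconnected_Ioo
      (fun r hr => (hder r hr).differentiableAt.differentiableWithinAt)
      (fun r hr => (hder r hr).deriv) hr (y := t) ⟨ht, by linarith⟩
    simpa using this
  ext x
  have hl : Tendsto (fun r => dunfordSemi L (s + t - r) (dunfordSemi L r x)) (𝓝[>] 0)
      (𝓝 (dunfordSemi L (s + t) x)) := by
    have c1 : Tendsto (fun r => dunfordSemi L (s + t - r)) (𝓝[>] 0) (𝓝 (dunfordSemi L (s + t))) := by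
      have c2 : ContinuousAt (dunfordSemi L) (s + t - 0) := by
        rw [sub_zero]; exact (h.hasDerivAt_dunfordSemi (add_pos hs ht)).continuousAt
      have c3 : ContinuousAt (fun r : ℝ => s + t - r) 0 := by fun_prop
      have := (c2.tendsto.comp c3.tendsto).mono_left (nhdsWithin_le_nhds (s := Set.Ioi 0))
      rwa [sub_zero] at this
    exact (isBoundedBilinearMap_apply (𝕜 := ℂ) (E := E) (F := E)).continuous.continuousAt.tendsto.comp
      (c1.prodMk_nhds (h.tendsto_dunfordSemi hd x))
  refine tendsto_nhds_unique hl (tendsto_const_nhds.congr' ?_)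
  filter_upwards [Ioo_mem_nhdsGT (add_pos hs ht)] with r hr
  exact (congrArg (fun T => T x) (hconst r hr)).symm

end IsHalfPlaneResolvent
end

/-! ### Complexification -/

namespace Complexification
variable {X : Type*} [NormedAddCommGroup X] [NormedSpace ℝ X]

theorem re_real_smul (r : ℝ) (p : Complexification X) : (r • p).re = r • p.re := by
  change ((r : ℂ) • p).re = _
  rw [re_smul]
  simp

theorem im_real_smul (r : ℝ) (p : Complexification X) : (r • p).im = r • p.im := by
  change ((r : ℂ) • p).im = _
  rw [im_smul]
  simp

theorem re_sub (p q : Complexification X) : (p - q).re = p.re - q.re := by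
  rw [sub_eq_add_neg, re_add, re_neg, sub_eq_add_neg]

theorem im_sub (p q : Complexification X) : (p - q).im = p.im - q.im := by
  rw [sub_eq_add_neg, im_add, im_neg, sub_eq_add_neg]

theorem norm_re_le (p : Complexification X) : ‖p.re‖ ≤ ‖p‖ := by
  have := (toCLM p).le_opNorm 1
  simpa [toCLM_apply, norm_def] using this

theorem norm_im_le (p : Complexification X) : ‖p.im‖ ≤ ‖p‖ := by
  have := (toCLM p).le_opNorm Complex.I
  simpa [toCLM_apply, norm_def] using this

theorem norm_le (p : Complexification X) : ‖p‖ ≤ ‖p.re‖ + ‖p.im‖ := by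
  rw [norm_def]
  refine ContinuousLinearMap.opNorm_le_bound _ (by positivity) fun w => ?_
  rw [toCLM_apply, add_mul]
  refine (norm_sub_le _ _).trans (add_le_add ?_ ?_)
  · rw [norm_smul, mul_comm]
    gcongr
    exact Complex.abs_re_le_norm w
  · rw [norm_smul, mul_comm]
    gcongr
    exact Complex.abs_im_le_norm w

/-- The real part as a bounded real-linear map. -/
noncomputable def reL : Complexification X →L[ℝ] X :=
  LinearMap.mkContinuous ⟨⟨re, re_add⟩, re_real_smul⟩ 1 fun p => by
    simpa using! norm_re_le p

/-- The imaginary part as a bounded real-linear map. -/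
noncomputable def imL : Complexification X →L[ℝ] X :=
  LinearMap.mkContinuous ⟨⟨im, im_add⟩, im_real_smul⟩ 1 fun p => by
    simpa using! norm_im_le p

@[simp] theorem reL_apply (p : Complexification X) : reL p = p.re := rfl
@[simp] theorem imL_apply (p : Complexification X) : imL p = p.im := rfl

/-- The map `(x, y) ↦ x + i y`. -/
noncomputable def mkL : X × X →L[ℝ] Complexification X :=
  LinearMap.mkContinuous
    ⟨⟨fun q => ⟨q.1, q.2⟩, fun _ _ => rfl⟩, fun r q => by
      ext
      · exact (re_real_smul r ⟨q.1, q.2⟩).symm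
      · exact (im_real_smul r ⟨q.1, q.2⟩).symm⟩ 2 fun q => by
    refine (norm_le _).trans ?_
    rw [two_mul]
    exact add_le_add (norm_fst_le q) (norm_snd_le q)

@[simp] theorem mkL_apply (q : X × X) : mkL q = ⟨q.1, q.2⟩ := rfl

/-- The topological isomorphism `X_ℂ ≃ X × X` over the reals. -/
noncomputable def prodEquiv : Complexification X ≃L[ℝ] X × X :=
  ContinuousLinearEquiv.equivOfInverse (reL.prod imL) mkL (fun _ => rfl) (fun _ => rfl)

instance [CompleteSpace X] : CompleteSpace (Complexification X) :=
  (completeSpace_congr (e := (prodEquiv (X := X)).toLinearEquiv.toEquiv)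
    (prodEquiv (X := X)).isUniformEmbedding).2 inferInstance

/-- The embedding `x ↦ x + i 0` of the real space. -/
noncomputable def ofRealL : X →L[ℝ] Complexification X :=
  mkL.comp (ContinuousLinearMap.inl ℝ X X)

@[simp] theorem ofRealL_apply (x : X) : ofRealL x = ⟨x, 0⟩ := rfl

theorem norm_ofRealL_le (x : X) : ‖ofRealL x‖ ≤ ‖x‖ := by
  simpa using norm_le (ofRealL x)

/-- Complex conjugation `x + i y ↦ x - i y`. -/
noncomputable def conjL : Complexification X →L[ℝ] Complexification X :=
  mkL.comp (reL.prod (-imL))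

@[simp] theorem conjL_apply (p : Complexification X) : conjL p = ⟨p.re, -p.im⟩ := rfl

theorem conjL_smul (z : ℂ) (p : Complexification X) :
    conjL (z • p) = (starRingEnd ℂ z) • conjL p := by
  ext
  · simp
  · simp
    abel

theorem eq_ofRealL_of_conjL_eq {p : Complexification X} (h : conjL p = p) :
    p = ofRealL p.re := by
  ext
  · rfl
  · have h1 : -p.im = p.im := congrArg im h
    have h2 : (2 : ℝ) • p.im = 0 := by
      rw [two_smul]
      nth_rewrite 1 [← h1]
      exact neg_add_cancel _
    exact (smul_eq_zero.1 h2).resolve_left two_ne_zero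

/-- The complexification `C x + i C y` of a bounded operator. -/
noncomputable def mapL (C : X →L[ℝ] X) : Complexification X →L[ℂ] Complexification X where
  toFun p := ⟨C p.re, C p.im⟩
  map_add' p q := by ext <;> simp
  map_smul' z p := by ext <;> simp
  cont := (mkL.comp ((C.comp reL).prod (C.comp imL))).continuous

@[simp] theorem mapL_apply (C : X →L[ℝ] X) (p : Complexification X) :
    mapL C p = ⟨C p.re, C p.im⟩ := rfl

theorem isCompactOperator_mapL {C : X →L[ℝ] X} (hC : IsCompactOperator C) :
    IsCompactOperator (mapL C) := by
  have h1 : IsCompactOperator (ofRealL ∘ (C ∘ (reL : Complexification X → X))) :=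
    (hC.comp_clm reL).clm_comp ofRealL
  have h2 : IsCompactOperator
      ((mkL.comp (ContinuousLinearMap.inr ℝ X X)) ∘ (C ∘ (imL : Complexification X → X))) :=
    (hC.comp_clm imL).clm_comp _
  have h3 := h1.add h2
  have e : (mapL C : Complexification X → Complexification X) =
      ofRealL ∘ (C ∘ (reL : Complexification X → X)) +
      (mkL.comp (ContinuousLinearMap.inr ℝ X X)) ∘ (C ∘ (imL : Complexification X → X)) := by
    funext p
    ext <;> simp
  rw [e]
  exact h3

end Complexification

namespace LinearPMap

section General
variable {𝕜 E : Type*} [NontriviallyNormedField 𝕜] [NormedAddCommGroup E] [NormedSpace 𝕜 E]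
  {A : E →ₗ.[𝕜] E}

theorem IsResolventAt.injective {z : 𝕜} {R : E →L[𝕜] E} (h : A.IsResolventAt z R) :
    Function.Injective R := by
  rw [injective_iff_map_eq_zero]
  intro x hx
  obtain ⟨hx', e⟩ := h.1 x
  have h0 : (⟨R x, hx'⟩ : A.domain) = 0 := Subtype.ext hx
  rw [h0, hx, smul_zero, A.map_zero, sub_zero] at e
  exact e.symm

theorem IsResolventAt.range_eq {z : 𝕜} {R : E →L[𝕜] E} (h : A.IsResolventAt z R) :
    Set.range R = A.domain := by
  ext x
  constructor
  · rintro ⟨y, rfl⟩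
    exact (h.1 y).1
  · intro hx
    exact ⟨_, h.2 ⟨x, hx⟩⟩

/-- The first resolvent identity. -/
theorem IsResolventAt.sub_eq {z w : 𝕜} {R Q : E →L[𝕜] E} (h : A.IsResolventAt z R)
    (h' : A.IsResolventAt w Q) : R - Q = (w - z) • (R * Q) := by
  ext x
  obtain ⟨hx, e⟩ := h'.1 x
  have h1 := h.2 ⟨Q x, hx⟩
  change R (z • Q x - A ⟨Q x, hx⟩) = Q x at h1
  change R x - Q x = (w - z) • R (Q x)
  calc R x - Q x = R (w • Q x - A ⟨Q x, hx⟩) - R (z • Q x - A ⟨Q x, hx⟩) := by rw [e, h1]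
    _ = (w - z) • R (Q x) := by
      rw [← _root_.map_sub, ← _root_.map_smul R]
      refine congrArg R ?_
      rw [sub_sub_sub_cancel_right, sub_smul]

end General

section Real
open Complexification
variable {X : Type*} [NormedAddCommGroup X] [NormedSpace ℝ X] {A : X →ₗ.[ℝ] X}

theorem complexify_apply_eq (p : A.complexify.domain) :
    A.complexify p = ⟨A ⟨p.1.re, p.2.1⟩, A ⟨p.1.im, p.2.2⟩⟩ := rfl

theorem dense_complexify_domain (h : Dense (A.domain : Set X)) :
    Dense (A.complexify.domain : Set (Complexification X)) := by
  have h1 : Dense ((A.domain : Set X) ×ˢ (A.domain : Set X)) := h.prod h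
  have h2 := h1.preimage (prodEquiv (X := X)).toHomeomorph.isOpenMap
  exact h2

theorem dense_domain_of_complexify (h : Dense (A.complexify.domain : Set (Complexification X))) :
    Dense (A.domain : Set X) := by
  have hs : Function.Surjective (reL : Complexification X → X) := fun x => ⟨ofRealL x, rfl⟩
  have h1 := hs.denseRange.dense_image reL.continuous h
  refine h1.mono ?_
  rintro _ ⟨p, hp, rfl⟩
  exact hp.1

/-- The resolvents of a complexified operator at conjugate points are conjugate. -/
theorem IsResolventAt.conjL_apply {z : ℂ} {R R' : Complexification X →L[ℂ] Complexification X}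
    (h : A.complexify.IsResolventAt z R)
    (h' : A.complexify.IsResolventAt (starRingEnd ℂ z) R') (p : Complexification X) :
    conjL (R p) = R' (conjL p) := by
  obtain ⟨hp, e⟩ := h.1 p
  have hp' : conjL (R p) ∈ A.complexify.domain := ⟨hp.1, A.domain.neg_mem hp.2⟩
  have h1 := h'.2 ⟨_, hp'⟩
  have e2 : (starRingEnd ℂ z) • conjL (R p) - A.complexify ⟨_, hp'⟩ = conjL p := by
    have h3 := (_root_.map_sub conjL _ _).symm.trans (congrArg conjL e)
    rw [conjL_smul] at h3
    refine Eq.trans ?_ h3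
    congr 1
    ext
    · rfl
    · exact A.map_neg ⟨(R p).im, hp.2⟩
  exact h1.symm.trans (congrArg R' e2)

/-- At a real point the resolvent of the complexification is the complexification of a
resolvent of the real operator. -/
theorem IsResolventAt.exists_real {r : ℝ} {R : Complexification X →L[ℂ] Complexification X}
    (h : A.complexify.IsResolventAt (r : ℂ) R) :
    ∃ J : X →L[ℝ] X, A.IsResolventAt r J ∧ ∀ x, R (ofRealL x) = ofRealL (J x) := by
  have hreal : ∀ x, R (ofRealL x) = ofRealL (R (ofRealL x)).re := fun x => by
    refine eq_ofRealL_of_conjL_eq ?_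
    rw [h.conjL_apply (R' := R) (by rwa [Complex.conj_ofReal])]
    congr 1
    ext <;> simp
  refine ⟨(reL.comp (R.restrictScalars ℝ)).comp ofRealL, ⟨fun x => ?_, fun x => ?_⟩, hreal⟩
  · obtain ⟨hp, e⟩ := h.1 (ofRealL x)
    refine ⟨hp.1, ?_⟩
    have := congrArg re e
    rw [re_sub, re_smul] at this
    simpa using! this
  · have hx : ofRealL (x : X) ∈ A.complexify.domain := ⟨x.2, A.domain.zero_mem⟩
    have h1 := congrArg re (h.2 ⟨_, hx⟩)
    have e : (r : ℂ) • ofRealL (x : X) - A.complexify ⟨_, hx⟩ = ofRealL (r • (x : X) - A x) := by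
      ext
      · rw [re_sub, re_smul]; simp [complexify_apply_eq]
      · rw [im_sub, im_smul, complexify_apply_eq]
        have : A ⟨(ofRealL (x : X)).im, hx.2⟩ = 0 := A.map_zero
        simp only [this]
        simp
    change (R ((r : ℂ) • ofRealL (x : X) - A.complexify ⟨_, hx⟩)).re = _ at h1
    rw [e] at h1
    exact h1

end Real
end LinearPMap

/-! ### Generation of analytic semigroups by real operators -/

namespace LinearPMap
open Complexification
variable {X : Type*} [NormedAddCommGroup X] [NormedSpace ℝ X]

/-- `S` is the semigroup `e^{-t B}`; it is of type `-a`, maps into the domain of `B` for `t > 0`,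
is differentiable there, and satisfies `‖(B - a) e^{-t B}‖ ≤ K e^{-a t} / t`. -/
structure IsAnalyticSemigroup (B : X →ₗ.[ℝ] X) (S : ℝ → X →L[ℝ] X) (a K : ℝ) : Prop extends
    B.GeneratesSemigroup S where
  norm_le : ∀ t : ℝ, 0 ≤ t → ‖S t‖ ≤ K * Real.exp (-a * t)
  smoothing : ∀ t : ℝ, 0 < t → ∀ x : X, ∃ h : S t x ∈ B.domain,
    HasDerivAt (fun s => S s x) (-B ⟨S t x, h⟩) t ∧
      ‖B ⟨S t x, h⟩ - a • S t x‖ ≤ K * Real.exp (-a * t) / t * ‖x‖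

variable {B : X →ₗ.[ℝ] X} {a M : ℝ}

/-- The function `z ↦ (z + B - a)⁻¹` assembled from the resolvents of `B` left of `a`. -/
theorem exists_isHalfPlaneResolvent
    (hres : ∀ z : ℂ, z.re < a → ∃ R : Complexification X →L[ℂ] Complexification X,
      B.complexify.IsResolventAt z R ∧ ‖R‖ ≤ M / ‖z - a‖) :
    ∃ L : ℂ → Complexification X →L[ℂ] Complexification X, IsHalfPlaneResolvent L M ∧
      ∀ z : ℂ, 0 < z.re → B.complexify.IsResolventAt (a - z) (-L z) := by
  choose! R hR hM using hres
  have hre : ∀ z : ℂ, 0 < z.re → ((a : ℂ) - z).re < a := fun z hz => by simpa using hz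
  refine ⟨fun z => -R (a - z), ⟨fun z w hz hw => ?_, fun z hz => ?_⟩, fun z hz => ?_⟩
  · have := (hR _ (hre z hz)).sub_eq (hR _ (hre w hw))
    rw [neg_mul_neg, neg_sub_neg, ← neg_sub, this, ← neg_smul]
    congr 1
    ring
  · rw [norm_neg]
    simpa using hM _ (hre z hz)
  · rw [neg_neg]
    exact hR _ (hre z hz)

theorem scaledRes_neg {L : ℂ → Complexification X →L[ℂ] Complexification X}
    (hR : ∀ z : ℂ, 0 < z.re → B.complexify.IsResolventAt (a - z) (-L z)) {t : ℝ} (ht : 0 < t)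
    (y : ℝ) (p : Complexification X) :
    conjL (scaledRes L t y p) = scaledRes L t (-y) (conjL p) := by
  have e : starRingEnd ℂ (linePt y / t) = linePt (-y) / t := by
    simp [linePt]
  have h1 := hR _ (re_linePt_div_pos ht y)
  have h2 := hR _ (re_linePt_div_pos ht (-y))
  rw [← e] at h2
  have h3 := h1.conjL_apply (R' := -L (linePt (-y) / t)) (by simpa [e] using h2) p
  change conjL (-L (linePt y / t) p) = -L (linePt (-y) / t) (conjL p) at h3
  rw [_root_.map_neg, neg_inj] at h3
  change conjL ((t : ℂ)⁻¹ • L (linePt y / t) p) = (t : ℂ)⁻¹ • L (linePt (-y) / t) (conjL p)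
  rw [conjL_smul, h3, map_inv₀, Complex.conj_ofReal]

variable [CompleteSpace X]

/-- The semigroup is real, since its integrand at `-y` is the conjugate of that at `y`. -/
theorem dunfordSemi_ofRealL {L : ℂ → Complexification X →L[ℂ] Complexification X}
    (hL : IsHalfPlaneResolvent L M)
    (hR : ∀ z : ℂ, 0 < z.re → B.complexify.IsResolventAt (a - z) (-L z)) {t : ℝ} (ht : 0 < t)
    (x : X) : dunfordSemi L t (ofRealL x) = ofRealL (dunfordSemi L t (ofRealL x)).re := by
  refine eq_ofRealL_of_conjL_eq ?_
  have hx : conjL (ofRealL x) = ofRealL x := by ext <;> simp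
  have hi := (hL.integrable_semi ht).apply_continuousLinearMap (ofRealL x)
  have e : dunfordSemi L t (ofRealL x) = ((2 * Real.pi : ℝ) : ℂ)⁻¹ •
      ∫ y : ℝ, (Complex.exp (linePt y) • (scaledRes L t y * scaledRes L t y)) (ofRealL x) := by
    rw [dunfordSemi, _root_.smul_apply,
      ContinuousLinearMap.integral_apply (hL.integrable_semi ht)]
  rw [e, conjL_smul, map_inv₀, Complex.conj_ofReal, ← conjL.integral_comp_comm hi,
    ← integral_neg_eq_self]
  congr 2
  funext y
  change conjL (Complex.exp (linePt (-y)) • scaledRes L t (-y) (scaledRes L t (-y) (ofRealL x)))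
    = Complex.exp (linePt y) • scaledRes L t y (scaledRes L t y (ofRealL x))
  rw [conjL_smul, scaledRes_neg hR ht, scaledRes_neg hR ht, hx, neg_neg, ← Complex.exp_conj]
  congr 2
  simp [linePt]

/-- If the resolvent of a densely defined operator `B` satisfies `‖(z - B)⁻¹‖ ≤ M / ‖z - a‖` on the
half plane `Re z < a`, then `-B` generates an analytic semigroup of type `-a`. -/
theorem exists_isAnalyticSemigroup (hd : Dense (B.domain : Set X))
    (hres : ∀ z : ℂ, z.re < a → ∃ R : Complexification X →L[ℂ] Complexification X,
      B.complexify.IsResolventAt z R ∧ ‖R‖ ≤ M / ‖z - a‖) :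
    ∃ (S : ℝ → X →L[ℝ] X) (K : ℝ), B.IsAnalyticSemigroup S a K := by
  obtain ⟨L, hL, hR⟩ := exists_isHalfPlaneResolvent hres
  have hM := hL.M_nonneg
  have hR1 : B.complexify.IsResolventAt (((a - 1 : ℝ) : ℂ)) (-L 1) := by
    simpa using hR 1 (by simp)
  obtain ⟨J', hJ', hJr'⟩ := hR1.exists_real
  -- `J` is the real operator `(1 + B - a)⁻¹`.
  obtain ⟨J, hJ⟩ : ∃ J : X →L[ℝ] X, J = -J' := ⟨_, rfl⟩
  have hJL : ∀ x, L 1 (ofRealL x) = ofRealL (J x) := fun x => by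
    have h1 : -(L 1 (ofRealL x)) = ofRealL (J' x) := hJr' x
    rw [hJ, _root_.neg_apply, _root_.map_neg, ← h1, neg_neg]
  have hJdom : ∀ x, ∃ h : J x ∈ B.domain, J x + B ⟨J x, h⟩ - a • J x = x := fun x => by
    obtain ⟨h, e⟩ := hJ'.1 (-x)
    have e1 : J' (-x) = J x := by rw [hJ, _root_.map_neg, _root_.neg_apply]
    have h' : J x ∈ B.domain := e1 ▸ h
    have e2 : B ⟨J' (-x), h⟩ = B ⟨J x, h'⟩ := by congr 1; exact Subtype.ext e1
    refine ⟨h', ?_⟩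
    rw [e2, e1] at e
    linear_combination (norm := module) -e
  have hJinv : ∀ x : B.domain, J ((x : X) + B x - a • (x : X)) = x := fun x => by
    have := hJ'.2 x
    rw [hJ, _root_.neg_apply, ← _root_.map_neg]
    refine Eq.trans (congrArg J' ?_) this
    module
  have hLinj : Function.Injective (L 1) := fun x y e => hR1.injective (by
    change -(L 1 x) = -(L 1 y)
    rw [e])
  have hLd : DenseRange (L 1) := by
    have h1 : Dense (Set.range (-L 1)) := by
      rw [hR1.range_eq]; exact dense_complexify_domain hd
    refine h1.mono ?_
    rintro _ ⟨x, rfl⟩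
    exact ⟨-x, by rw [_root_.map_neg]; rfl⟩
  obtain ⟨T, hT⟩ : ∃ T : ℝ → X →L[ℝ] X, T = fun t =>
    (reL.comp ((dunfordSemi L t).restrictScalars ℝ)).comp ofRealL := ⟨_, rfl⟩
  obtain ⟨V, hV⟩ : ∃ V : ℝ → X →L[ℝ] X, V = fun t =>
    (reL.comp ((dunfordGen L t).restrictScalars ℝ)).comp ofRealL := ⟨_, rfl⟩
  have hTr : ∀ t, 0 < t → ∀ x, dunfordSemi L t (ofRealL x) = ofRealL (T t x) := fun t ht x => by
    rw [hT]; exact dunfordSemi_ofRealL hL hR ht x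
  have hof : Function.Injective (ofRealL (X := X)) := fun x y e => congrArg re e
  have hTadd : ∀ s t, 0 < s → 0 < t → ∀ x, T (s + t) x = T s (T t x) := fun s t hs ht x => by
    apply hof
    rw [← hTr _ (add_pos hs ht), ← hTr s hs, ← hTr t ht, hL.dunfordSemi_add hLinj hLd hs ht]
    rfl
  have hTlim : ∀ x, Tendsto (fun t => T t x) (𝓝[>] 0) (𝓝 x) := fun x => by
    have := (reL.continuous.tendsto _).comp (hL.tendsto_dunfordSemi hLd (ofRealL x))
    rw [hT]; exact this
  have hTJ : ∀ t, 0 < t → ∀ x, T t (J x) = J (T t x) := fun t ht x => by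
    apply hof
    rw [← hJL, ← hTr t ht, ← hTr t ht, ← hJL]
    exact (congrArg (fun F => F (ofRealL x))
      (hL.commute_dunfordSemi_resolvent ht (z := 1) (by simp))).symm
  have hJTV : ∀ t, 0 < t → ∀ x, J (T t x + V t x) = T t x := fun t ht x => by
    have h1 := congrArg (fun F => (F (ofRealL x)).re) (hL.resolvent_mul_add ht)
    have h2 : ∀ p, (L 1 p).re = J p.re := fun p => by
      have e : p = ofRealL p.re + Complex.I • ofRealL p.im := by ext <;> simp
      conv_lhs => rw [e]
      rw [_root_.map_add, _root_.map_smul, hJL, hJL]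
      simp
    change (L 1 (dunfordSemi L t (ofRealL x) + dunfordGen L t (ofRealL x))).re = _ at h1
    rw [h2, re_add] at h1
    rw [hT, hV]
    exact h1
  have hTdom : ∀ t, 0 < t → ∀ x, ∃ h : T t x ∈ B.domain, B ⟨T t x, h⟩ = a • T t x + V t x := by
    intro t ht x
    obtain ⟨h, e⟩ := hJdom (T t x + V t x)
    have e1 := hJTV t ht x
    have h' : T t x ∈ B.domain := e1 ▸ h
    have e2 : B ⟨J (T t x + V t x), h⟩ = B ⟨T t x, h'⟩ := by congr 1; exact Subtype.ext e1
    refine ⟨h', ?_⟩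
    rw [e2, e1] at e
    linear_combination (norm := module) e
  have hTder : ∀ t, 0 < t → ∀ x, HasDerivAt (fun s => T s x) (-V t x) t := fun t ht x => by
    have h1 := ((ContinuousLinearMap.apply ℂ _ (ofRealL x)).restrictScalars ℝ).hasFDerivAt.comp_hasDerivAt t
      (hL.hasDerivAt_dunfordSemi ht)
    have h2 := reL.hasFDerivAt.comp_hasDerivAt t h1
    rw [hT, hV]
    refine h2.congr_deriv ?_
    change (-(dunfordGen L t (ofRealL x))).re = _
    rw [re_neg]
    rfl
  have hTnorm : ∀ t, 0 < t → ‖T t‖ ≤ Real.exp 1 * M ^ 2 / 2 := fun t ht => by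
    refine ContinuousLinearMap.opNorm_le_bound _ (by positivity) fun x => ?_
    rw [hT]
    refine (norm_re_le _).trans (((dunfordSemi L t).le_opNorm _).trans ?_)
    gcongr
    · exact hL.norm_dunfordSemi_le ht
    · exact norm_ofRealL_le x
  have hVnorm : ∀ t, 0 < t → ∀ x, ‖V t x‖ ≤ Real.exp 1 * (M ^ 2 + M ^ 3) / t * ‖x‖ :=
    fun t ht x => by
    rw [hV]
    refine (norm_re_le _).trans (((dunfordGen L t).le_opNorm _).trans ?_)
    gcongr
    · exact hL.norm_dunfordGen_le ht
    · exact norm_ofRealL_le x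
  obtain ⟨S, hS⟩ : ∃ S : ℝ → X →L[ℝ] X, S = fun t =>
    if 0 < t then Real.exp (-a * t) • T t else ContinuousLinearMap.id ℝ X := ⟨_, rfl⟩
  have hSpos : ∀ t, 0 < t → ∀ x, S t x = Real.exp (-a * t) • T t x := fun t ht x => by
    rw [hS]; simp [ht]
  have hS0 : S 0 = ContinuousLinearMap.id ℝ X := by rw [hS]; simp
  have hSlim : ∀ x, Tendsto (fun t => S t x) (𝓝[>] 0) (𝓝 x) := fun x => by
    have h1 : Tendsto (fun t : ℝ => Real.exp (-a * t)) (𝓝[>] 0) (𝓝 1) := by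
      have : ContinuousAt (fun t : ℝ => Real.exp (-a * t)) 0 := by fun_prop
      have := this.tendsto
      rw [mul_zero, Real.exp_zero] at this
      exact this.mono_left nhdsWithin_le_nhds
    have h2 := h1.smul (hTlim x)
    rw [one_smul] at h2
    refine h2.congr' ?_
    filter_upwards [self_mem_nhdsWithin] with t ht
    exact (hSpos t ht x).symm
  have hSdom : ∀ t, 0 < t → ∀ x, ∃ h : S t x ∈ B.domain,
      B ⟨S t x, h⟩ = Real.exp (-a * t) • (a • T t x + V t x) := fun t ht x => by
    obtain ⟨h, e⟩ := hTdom t ht x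
    have h' : S t x ∈ B.domain := by rw [hSpos t ht]; exact B.domain.smul_mem _ h
    refine ⟨h', ?_⟩
    rw [← e, ← B.map_smul]
    congr 1
    exact Subtype.ext (hSpos t ht x)
  have hSder : ∀ t, 0 < t → ∀ x, HasDerivAt (fun s => S s x)
      (-(Real.exp (-a * t) • (a • T t x + V t x))) t := fun t ht x => by
    have h1 : HasDerivAt (fun s : ℝ => Real.exp (-a * s)) (Real.exp (-a * t) * (-a)) t := by
      simpa using ((hasDerivAt_id t).const_mul (-a)).exp
    have h2 := h1.smul (hTder t ht x)
    have h3 : HasDerivAt (fun s => S s x) _ t := h2.congr_of_eventuallyEq (by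
      filter_upwards [lt_mem_nhds ht] with s hs
      exact hSpos s hs x)
    refine h3.congr_deriv ?_
    module
  -- On the domain, `B` commutes with the semigroup.
  have hSB : ∀ t, 0 < t → ∀ x : B.domain, Real.exp (-a * t) • (a • T t x + V t x) = S t (B x) := by
    intro t ht x
    have h1 := hTJ t ht ((x : X) + B x - a • (x : X))
    rw [hJinv x] at h1
    have h2 := hJTV t ht x
    have hJi : Function.Injective J := fun u v e => hJ'.injective (by
      rw [hJ] at e
      exact neg_injective e)
    have h3 := hJi (h2.trans h1)
    rw [_root_.map_sub, _root_.map_add, _root_.map_smul] at h3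
    rw [hSpos t ht]
    congr 1
    linear_combination (norm := module) h3
  refine ⟨S, Real.exp 1 * (M ^ 2 + M ^ 3) + 1, ⟨⟨hS0, ?_, hSlim, ?_⟩, ?_, ?_⟩⟩
  · intro s t hs ht
    rcases hs.eq_or_lt with rfl | hs
    · rw [zero_add, hS0]; rfl
    rcases ht.eq_or_lt with rfl | ht
    · rw [add_zero, hS0]; rfl
    ext x
    change S (s + t) x = S s (S t x)
    rw [hSpos _ (add_pos hs ht), hSpos t ht, _root_.map_smul, hSpos s hs, hTadd s t hs ht,
      smul_smul, ← Real.exp_add]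
    congr 2
    ring
  · have hfwd : ∀ x : B.domain, Tendsto (fun t : ℝ => t⁻¹ • (S t (x : X) - (x : X))) (𝓝[>] 0)
        (𝓝 (-B x)) := by
      intro x
      have hc : ContinuousWithinAt (fun t => S t (x : X)) (Set.Ioi 0) 0 := by
        have := hSlim x
        rw [ContinuousWithinAt, hS0]
        exact this
      have h1 := hasDerivWithinAt_Ici_of_tendsto_deriv (f := fun t => S t (x : X)) (s := Set.Ioi 0)
        (a := 0) (e := -B x)
        (fun t ht => (hSder t ht x).differentiableAt.differentiableWithinAt) hc
        self_mem_nhdsWithin (by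
          refine (hSlim (B x)).neg.congr' ?_
          filter_upwards [self_mem_nhdsWithin] with t ht
          rw [(hSder t ht x).deriv, hSB t ht x])
      have h2 := (hasDerivWithinAt_iff_tendsto_slope' (by simp)).1 (h1.mono Set.Ioi_subset_Ici_self)
      refine h2.congr fun t => ?_
      rw [slope_def_module, sub_zero, hS0]
      rfl
    intro x y
    constructor
    · intro h
      have h1 := (J.continuous.tendsto _).comp h
      obtain ⟨hd1, e1⟩ := hJdom x
      have h2 := hfwd ⟨J x, hd1⟩
      have h3 : J y = -B ⟨J x, hd1⟩ := by
        refine tendsto_nhds_unique h1 (h2.congr' ?_)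
        filter_upwards [self_mem_nhdsWithin] with t ht
        simp only [Function.comp]
        rw [_root_.map_smul, _root_.map_sub, hSpos t ht, hSpos t ht, _root_.map_smul, hTJ t ht]
      have h4 : J (x - a • x - y) = x := by
        rw [_root_.map_sub, _root_.map_sub, _root_.map_smul, h3]
        linear_combination (norm := module) e1
      obtain ⟨hd2, e2⟩ := hJdom (x - a • x - y)
      have hx : x ∈ B.domain := h4 ▸ hd2
      have e3 : B ⟨J (x - a • x - y), hd2⟩ = B ⟨x, hx⟩ := by congr 1; exact Subtype.ext h4
      refine ⟨hx, ?_⟩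
      rw [e3, h4] at e2
      linear_combination (norm := module) e2
    · rintro ⟨hx, rfl⟩
      exact hfwd ⟨x, hx⟩
  · intro t ht
    have hM2 : Real.exp 1 * M ^ 2 / 2 ≤ Real.exp 1 * (M ^ 2 + M ^ 3) + 1 := by
      have : 0 ≤ Real.exp 1 * M ^ 2 := by positivity
      have : 0 ≤ Real.exp 1 * M ^ 3 := by positivity
      linarith
    rcases ht.eq_or_lt with rfl | ht
    · rw [hS0, mul_zero, Real.exp_zero, mul_one]
      refine ContinuousLinearMap.norm_id_le.trans ?_
      have : 0 ≤ Real.exp 1 * (M ^ 2 + M ^ 3) := by positivity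
      linarith
    · have e : S t = Real.exp (-a * t) • T t := by ext x; exact hSpos t ht x
      rw [e, norm_smul, Real.norm_of_nonneg (Real.exp_pos _).le, mul_comm]
      gcongr
      exact (hTnorm t ht).trans hM2
  · intro t ht x
    obtain ⟨h, e⟩ := hSdom t ht x
    refine ⟨h, ?_, ?_⟩
    · rw [e]; exact hSder t ht x
    · have e1 : B ⟨S t x, h⟩ - a • S t x = Real.exp (-a * t) • V t x := by
        rw [e, hSpos t ht]; module
      rw [e1, norm_smul, Real.norm_of_nonneg (Real.exp_pos _).le]
      calc _ ≤ Real.exp (-a * t) * (Real.exp 1 * (M ^ 2 + M ^ 3) / t * ‖x‖) := by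
            gcongr; exact hVnorm t ht x
        _ ≤ Real.exp (-a * t) * ((Real.exp 1 * (M ^ 2 + M ^ 3) + 1) / t * ‖x‖) := by
            gcongr; linarith
        _ = _ := by ring

end LinearPMap

/-! ### Symmetric operators with compact resolvent -/

/-- The Fredholm alternative for `1 + T` with `T` compact. -/
theorem IsCompactOperator.exists_inverse_one_add {𝕜 E : Type*} [NontriviallyNormedField 𝕜]
    [NormedAddCommGroup E] [NormedSpace 𝕜 E] [CompleteSpace E] {T : E →L[𝕜] E}
    (hT : IsCompactOperator T) (hinj : ∀ x, x + T x = 0 → x = 0) :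
    ∃ U : E →L[𝕜] E, (∀ x, U x + T (U x) = x) ∧ ∀ x, U (x + T x) = x := by
  have hne : (-1 : 𝕜) ≠ 0 := neg_ne_zero.2 one_ne_zero
  have hu : IsUnit (1 + T) := by
    rcases hT.hasEigenvalue_or_mem_resolventSet hne with h | h
    · obtain ⟨x, hx⟩ := h.exists_hasEigenvector
      have h1 : T x = (-1 : 𝕜) • x := hx.apply_eq_smul
      exact absurd (hinj x (by rw [h1, neg_one_smul, add_neg_cancel])) hx.2
    · rw [spectrum.mem_resolventSet_iff] at h
      have e : algebraMap 𝕜 (E →L[𝕜] E) (-1) - T = -(1 + T) := by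
        rw [map_neg, map_one]; abel
      rwa [e, IsUnit.neg_iff] at h
  obtain ⟨⟨u, v, h1, h2⟩, rfl : u = 1 + T⟩ := hu
  exact ⟨v, fun x => congrArg (fun F => F x) h1, fun x => congrArg (fun F => F x) h2⟩

/-- `P` is the projection onto `N` which is orthogonal for the inner product `⟨ι x, ι y⟩`.
The embedding `ι` need not be continuous, whereas `P` is. -/
structure IsOrthProjVia {X H : Type*} [NormedAddCommGroup X] [NormedSpace ℝ X]
    [NormedAddCommGroup H] [InnerProductSpace ℝ H] (ι : X →ₗ[ℝ] H) (N : Submodule ℝ X)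
    (P : X →L[ℝ] X) : Prop where
  mem : ∀ x, P x ∈ N
  inner_eq : ∀ x, ∀ v ∈ N, inner ℝ (ι (x - P x)) (ι v) = 0

namespace IsOrthProjVia
variable {X H : Type*} [NormedAddCommGroup X] [NormedSpace ℝ X]
    [NormedAddCommGroup H] [InnerProductSpace ℝ H] {ι : X →ₗ[ℝ] H} {N : Submodule ℝ X}
    {P : X →L[ℝ] X}

theorem eq_zero_of_inner_self (hι : Function.Injective ι) {x : X}
    (h : inner ℝ (ι x) (ι x) = 0) : x = 0 := by
  rw [inner_self_eq_zero] at h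
  exact hι (h.trans ι.map_zero.symm)

theorem apply_eq (h : IsOrthProjVia ι N P) (hι : Function.Injective ι) {x w : X} (hw : w ∈ N)
    (hxw : ∀ v ∈ N, inner ℝ (ι (x - w)) (ι v) = 0) : P x = w := by
  rw [← sub_eq_zero]
  have hm : P x - w ∈ N := N.sub_mem (h.mem x) hw
  refine eq_zero_of_inner_self hι ?_
  have e : ι (P x - w) = ι (x - w) - ι (x - P x) := by rw [← map_sub]; congr 1; abel
  have h1 : inner ℝ (ι (x - w) - ι (x - P x)) (ι (P x - w)) = 0 := by
    rw [inner_sub_left, hxw _ hm, h.inner_eq _ _ hm, sub_zero]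
  rwa [← e] at h1

theorem apply_of_mem (h : IsOrthProjVia ι N P) (hι : Function.Injective ι) {x : X} (hx : x ∈ N) :
    P x = x :=
  h.apply_eq hι hx fun v _ => by rw [sub_self, map_zero, inner_zero_left]

theorem apply_apply (h : IsOrthProjVia ι N P) (hι : Function.Injective ι) (x : X) :
    P (P x) = P x :=
  h.apply_of_mem hι (h.mem x)

theorem inner_apply (h : IsOrthProjVia ι N P) (x y : X) :
    inner ℝ (ι (P x)) (ι y) = inner ℝ (ι x) (ι (P y)) := by
  have h1 := h.inner_eq x (P y) (h.mem y)
  have h2 := h.inner_eq y (P x) (h.mem x)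
  rw [map_sub, inner_sub_left, sub_eq_zero] at h1 h2
  rw [h1, real_inner_comm, h2, real_inner_comm]

theorem apply_eq_zero_of_orth (h : IsOrthProjVia ι N P) (hι : Function.Injective ι) {x : X}
    (hx : ∀ v ∈ N, inner ℝ (ι x) (ι v) = 0) : P x = 0 :=
  h.apply_eq hι N.zero_mem (by simpa using hx)

end IsOrthProjVia

namespace LinearPMap
open Complexification

variable {X H : Type*} [NormedAddCommGroup X] [NormedSpace ℝ X]
    [NormedAddCommGroup H] [InnerProductSpace ℝ H]

/-- Symmetry of `A` for the inner product `⟨ι x, ι y⟩`. -/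
def IsSymmVia (A : X →ₗ.[ℝ] X) (ι : X →ₗ[ℝ] H) : Prop :=
  ∀ x y : A.domain, inner ℝ (ι (A x)) (ι (y : X)) = inner ℝ (ι (x : X)) (ι (A y))

theorem isSymmVia_of_isSelfAdjoint [CompleteSpace H] {A : X →ₗ.[ℝ] X} {ι : X →ₗ[ℝ] H}
    {Ahat : H →ₗ.[ℝ] H} (hAhat : IsSelfAdjoint Ahat)
    (h : ∀ x : A.domain, (ι (x : X), ι (A x)) ∈ Ahat.graph) : A.IsSymmVia ι := by
  intro x y
  have key := Ahat.adjoint_isFormalAdjoint hAhat.dense_domain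
  rw [isSelfAdjoint_def.1 hAhat] at key
  obtain ⟨u, hu, hu'⟩ := (LinearPMap.mem_graph_iff _).1 (h x)
  obtain ⟨v, hv, hv'⟩ := (LinearPMap.mem_graph_iff _).1 (h y)
  simp only at hu hu' hv hv'
  rw [← hu, ← hv, ← hu', ← hv']
  exact key u v

variable {A : X →ₗ.[ℝ] X} {ι : X →ₗ[ℝ] H}

theorem inner_eq_zero_of_mem_kerSub (hA : A.IsSymmVia ι) {μ ν : ℝ} (hne : μ ≠ ν) {v w : X}
    (hv : v ∈ A.kerSub μ) (hw : w ∈ A.kerSub ν) : inner ℝ (ι v) (ι w) = 0 := by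
  obtain ⟨hv, ev⟩ := hv
  obtain ⟨hw, ew⟩ := hw
  have h := hA ⟨v, hv⟩ ⟨w, hw⟩
  rw [ev, ew, _root_.map_smul, _root_.map_smul, inner_smul_left, inner_smul_right] at h
  have h2 : (μ - ν) * inner ℝ (ι v) (ι w) = 0 := by
    rw [sub_mul, sub_eq_zero]; simpa using h
  exact (mul_eq_zero.1 h2).resolve_left (sub_ne_zero.2 hne)

theorem IsResolventAt.mem_kerSub_iff {ρ : ℝ} {J : X →L[ℝ] X} (hJ : A.IsResolventAt ρ J) (μ : ℝ)
    (x : X) : x ∈ A.kerSub μ ↔ (ρ - μ) • J x = x := by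
  constructor
  · rintro ⟨hx, e⟩
    have := hJ.2 ⟨x, hx⟩
    change J (ρ • x - A ⟨x, hx⟩) = x at this
    rwa [e, ← sub_smul, _root_.map_smul] at this
  · intro h
    obtain ⟨hd, e⟩ := hJ.1 x
    have hx : x ∈ A.domain := by rw [← h]; exact A.domain.smul_mem _ hd
    refine ⟨hx, ?_⟩
    have h1 : A ⟨x, hx⟩ = (ρ - μ) • A ⟨J x, hd⟩ := by
      rw [← A.map_smul]; congr 1; exact Subtype.ext h.symm
    rw [h1]
    have h2 : A ⟨J x, hd⟩ = ρ • J x - x := by linear_combination (norm := module) -e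
    rw [h2, smul_sub, smul_comm, h]
    module

theorem IsResolventAt.finiteDimensional_kerSub {ρ : ℝ} {J : X →L[ℝ] X}
    (hJ : A.IsResolventAt ρ J) (hc : IsCompactOperator J) (μ : ℝ) :
    FiniteDimensional ℝ (A.kerSub μ) := by
  have hfix : ∀ v ∈ A.kerSub μ, ((ρ - μ) • J : X →L[ℝ] X) v = v := fun v hv =>
    (hJ.mem_kerSub_iff μ v).1 hv
  have hcl : _root_.IsClosed (A.kerSub μ : Set X) := by
    have : (A.kerSub μ : Set X) = {x | (ρ - μ) • J x = x} := by
      ext x; exact hJ.mem_kerSub_iff μ x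
    rw [this]
    exact isClosed_eq (by fun_prop) continuous_id
  have h1 : IsCompactOperator (((ρ - μ) • J : X →L[ℝ] X) : X →ₗ[ℝ] X) := hc.smul (ρ - μ)
  have h2 := h1.restrict (V := A.kerSub μ)
    (fun v hv => by
      have := hfix v hv
      change ((ρ - μ) • J : X →L[ℝ] X) v ∈ _
      rwa [this]) hcl
  refine FiniteDimensional.of_isCompactOperator_id (𝕜 := ℝ) ?_
  have e : (id : A.kerSub μ → A.kerSub μ) = (((ρ - μ) • J : X →L[ℝ] X) : X →ₗ[ℝ] X).restrict
      (fun v hv => (hfix v hv).symm ▸ hv) := by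
    funext v
    exact Subtype.ext (hfix v v.2).symm
  rw [e]
  exact h2

/-- The orthogonal projection onto an eigenspace is bounded on `X`: with a bounded projection `Q`
onto the eigenspace, `(ρ - μ) J - 1 + Q` is invertible by the Fredholm alternative, and the
projection is `Q` composed with its inverse. -/
theorem IsResolventAt.exists_isOrthProjVia [CompleteSpace X] {ρ : ℝ} {J : X →L[ℝ] X} (hJ : A.IsResolventAt ρ J)
    (hc : IsCompactOperator J) (hA : A.IsSymmVia ι) (hι : Function.Injective ι) (μ : ℝ) :
    ∃ P : X →L[ℝ] X, IsOrthProjVia ι (A.kerSub μ) P := by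
  have hfd := hJ.finiteDimensional_kerSub hc μ
  obtain ⟨q, hq⟩ := Submodule.ClosedComplemented.of_finiteDimensional (A.kerSub μ)
  obtain ⟨Q, hQ⟩ : ∃ Q : X →L[ℝ] X, Q = (A.kerSub μ).subtypeL.comp q := ⟨_, rfl⟩
  have hQmem : ∀ x, Q x ∈ A.kerSub μ := fun x => by rw [hQ]; exact (q x).2
  have hQc : IsCompactOperator Q := by
    have : ProperSpace (A.kerSub μ) := FiniteDimensional.proper ℝ _
    rw [hQ]
    exact (isCompactOperator_of_locallyCompactSpace_dom q).clm_comp (A.kerSub μ).subtypeL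
  have horth : ∀ x, ∀ v ∈ A.kerSub μ, inner ℝ (ι ((ρ - μ) • J x - x)) (ι v) = 0 := by
    rintro x v ⟨hv, ev⟩
    obtain ⟨hd, e⟩ := hJ.1 x
    have h1 : (ρ - μ) • J x - x = A ⟨J x, hd⟩ - μ • J x := by
      linear_combination (norm := module) e
    have h2 := hA ⟨J x, hd⟩ ⟨v, hv⟩
    rw [ev] at h2
    rw [h1, _root_.map_sub, inner_sub_left, h2, _root_.map_smul, _root_.map_smul, inner_smul_left,
      inner_smul_right]
    simp
  have hTc : IsCompactOperator (-((ρ - μ) • J) - Q : X →L[ℝ] X) :=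
    ((hc.smul (ρ - μ)).neg).sub hQc
  obtain ⟨U, hU, -⟩ := hTc.exists_inverse_one_add fun x hx => by
    have h1 : Q x = -((ρ - μ) • J x - x) := by
      have : x + (-((ρ - μ) • J x) - Q x) = 0 := hx
      linear_combination (norm := module) -this
    have h2 : Q x = 0 := by
      refine IsOrthProjVia.eq_zero_of_inner_self hι ?_
      have h3 : inner ℝ (ι (-((ρ - μ) • J x - x))) (ι (Q x)) = 0 := by
        rw [_root_.map_neg, inner_neg_left, horth x _ (hQmem x), neg_zero]
      rwa [← h1] at h3
    have h3 : x ∈ A.kerSub μ := by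
      rw [hJ.mem_kerSub_iff]
      rw [h2] at h1
      linear_combination (norm := module) h1
    have h4 : Q x = x := by rw [hQ]; exact congrArg Subtype.val (hq ⟨x, h3⟩)
    rw [← h4, h2]
  refine ⟨-(Q.comp U), fun x => ?_, fun x v hv => ?_⟩
  · exact (A.kerSub μ).neg_mem (hQmem _)
  · have h1 : U x + (-((ρ - μ) • J (U x)) - Q (U x)) = x := hU x
    have h2 : x - (-(Q.comp U)) x = -((ρ - μ) • J (U x) - U x) := by
      change x - -(Q (U x)) = _
      linear_combination (norm := module) -h1
    rw [h2, _root_.map_neg, inner_neg_left, horth _ v hv, neg_zero]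

/-- The projection onto an `A`-invariant subspace of the domain commutes with `A`. -/
theorem _root_.IsOrthProjVia.map_comm {N : Submodule ℝ X} {P : X →L[ℝ] X}
    (hP : IsOrthProjVia ι N P) (hA : A.IsSymmVia ι) (hι : Function.Injective ι)
    (hN : ∀ v ∈ N, ∃ h : v ∈ A.domain, A ⟨v, h⟩ ∈ N) (x : A.domain) :
    ∃ h : P x ∈ A.domain, A ⟨P x, h⟩ = P (A x) := by
  obtain ⟨h, hm⟩ := hN _ (hP.mem x)
  refine ⟨h, (hP.apply_eq hι hm fun v hv => ?_).symm⟩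
  obtain ⟨hvd, hv'⟩ := hN v hv
  have h1 := hA x ⟨v, hvd⟩
  have h2 := hA ⟨P x, h⟩ ⟨v, hvd⟩
  have h3 := hP.inner_eq x _ hv'
  rw [_root_.map_sub, inner_sub_left] at h3 ⊢
  rw [h1, h2, h3]

theorem kerSub_invariant (A : X →ₗ.[ℝ] X) (μ : ℝ) :
    ∀ v ∈ A.kerSub μ, ∃ h : v ∈ A.domain, A ⟨v, h⟩ ∈ A.kerSub μ := by
  rintro v ⟨h, e⟩
  exact ⟨h, by rw [e]; exact (A.kerSub μ).smul_mem _ ⟨h, e⟩⟩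

theorem IsSymmVia.vadd_continuousLinearMap {F : X →L[ℝ] X} (hA : A.IsSymmVia ι)
    (hF : ∀ x y, inner ℝ (ι (F x)) (ι y) = inner ℝ (ι x) (ι (F y))) :
    ((F : X →ₗ[ℝ] X) +ᵥ A).IsSymmVia ι := by
  intro x y
  have h1 := hA x y
  rw [vadd_apply, vadd_apply, _root_.map_add, _root_.map_add, inner_add_left, inner_add_right]
  exact congrArg₂ (· + ·) (hF x y) h1

/-- The eigenvalues of the complexification of a symmetric operator are real. -/
theorem exists_real_eigenvector (hA : A.IsSymmVia ι) (hι : Function.Injective ι) {z : ℂ}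
    (p : A.complexify.domain) (hp : A.complexify p = z • (p : Complexification X))
    (hne : (p : Complexification X) ≠ 0) :
    z.im = 0 ∧ ∃ v ∈ A.kerSub z.re, v ≠ 0 := by
  obtain ⟨p, hre, him⟩ := p
  have h1 : A ⟨p.re, hre⟩ = z.re • p.re - z.im • p.im := congrArg re hp
  have h2 : A ⟨p.im, him⟩ = z.re • p.im + z.im • p.re := congrArg im hp
  have h3 := hA ⟨p.re, hre⟩ ⟨p.im, him⟩
  rw [h1, h2] at h3
  simp only [_root_.map_sub, _root_.map_add, _root_.map_smul, inner_sub_left, inner_add_right,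
    inner_smul_left, inner_smul_right, conj_trivial] at h3
  have h4 : z.im * (inner ℝ (ι p.re) (ι p.re) + inner ℝ (ι p.im) (ι p.im)) = 0 := by linarith
  have hz : z.im = 0 := by
    refine (mul_eq_zero.1 h4).resolve_right fun h5 => hne ?_
    have h6 := real_inner_self_nonneg (x := ι p.re)
    have h7 := real_inner_self_nonneg (x := ι p.im)
    ext
    · exact IsOrthProjVia.eq_zero_of_inner_self hι (by linarith)
    · exact IsOrthProjVia.eq_zero_of_inner_self hι (by linarith)
  refine ⟨hz, ?_⟩
  rw [hz, zero_smul, sub_zero] at h1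
  rw [hz, zero_smul, add_zero] at h2
  by_cases h0 : p.re = 0
  · refine ⟨p.im, ⟨him, h2⟩, fun h0' => hne ?_⟩
    ext
    · exact h0
    · exact h0'
  · exact ⟨p.re, ⟨hre, h1⟩, h0⟩

/-- A bounded perturbation `A + F` of an operator with compact resolvent has a resolvent at every
point which is not an eigenvalue of its complexification. -/
theorem IsResolventAt.exists_isResolventAt_vadd [CompleteSpace X] {ρ : ℝ} {J : X →L[ℝ] X}
    (hJ : A.IsResolventAt ρ J) (hc : IsCompactOperator J) (F : X →L[ℝ] X) (z : ℂ)
    (hz : ∀ p : ((F : X →ₗ[ℝ] X) +ᵥ A).complexify.domain,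
      ((F : X →ₗ[ℝ] X) +ᵥ A).complexify p = z • (p : Complexification X) →
        (p : Complexification X) = 0) :
    ∃ R : Complexification X →L[ℂ] Complexification X,
      ((F : X →ₗ[ℝ] X) +ᵥ A).complexify.IsResolventAt z R := by
  set B := (F : X →ₗ[ℝ] X) +ᵥ A with hB
  have hdom : ∀ w, mapL J w ∈ B.complexify.domain := fun w => ⟨(hJ.1 w.re).1, (hJ.1 w.im).1⟩
  obtain ⟨T, hT⟩ : ∃ T : Complexification X →L[ℂ] Complexification X,
    T = ((z - ρ) • ContinuousLinearMap.id ℂ _ - mapL F).comp (mapL J) := ⟨_, rfl⟩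
  have hTc : IsCompactOperator T := by
    rw [hT]; exact (isCompactOperator_mapL hc).clm_comp
      ((z - ρ) • ContinuousLinearMap.id ℂ _ - mapL F)
  have key : ∀ w, z • mapL J w - B.complexify ⟨mapL J w, hdom w⟩ = w + T w := by
    intro w
    obtain ⟨h1, e1⟩ := hJ.1 w.re
    obtain ⟨h2, e2⟩ := hJ.1 w.im
    have hT' : T w = (z - ρ) • mapL J w - mapL F (mapL J w) := by rw [hT]; rfl
    have hB' : B.complexify ⟨mapL J w, hdom w⟩ =
      ⟨F (J w.re) + A ⟨J w.re, h1⟩, F (J w.im) + A ⟨J w.im, h2⟩⟩ := rfl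
    have e1' : A ⟨J w.re, h1⟩ = ρ • J w.re - w.re := by linear_combination (norm := module) -e1
    have e2' : A ⟨J w.im, h2⟩ = ρ • J w.im - w.im := by linear_combination (norm := module) -e2
    rw [hT', hB', e1', e2']
    ext
    · simp only [re_sub, re_add, re_smul, mapL_apply, Complex.sub_re, Complex.sub_im,
        Complex.ofReal_re, Complex.ofReal_im]
      module
    · simp only [im_sub, im_add, im_smul, mapL_apply, Complex.sub_re, Complex.sub_im,
        Complex.ofReal_re, Complex.ofReal_im]
      module
  have hJinj : ∀ w, mapL J w = 0 → w = 0 := fun w hw => by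
    have h1 : ∀ y, J y = 0 → y = 0 := fun y hy => hJ.injective (hy.trans (_root_.map_zero J).symm)
    ext
    · exact h1 _ (congrArg re hw)
    · exact h1 _ (congrArg im hw)
  obtain ⟨U, hU1, hU2⟩ := hTc.exists_inverse_one_add fun w hw => by
    rw [← key w, sub_eq_zero] at hw
    exact hJinj w (hz ⟨_, hdom w⟩ hw.symm)
  refine ⟨(mapL J).comp U, fun x => ⟨hdom _, ?_⟩, fun x => ?_⟩
  · exact (key (U x)).trans (hU1 x)
  · obtain ⟨x, hx⟩ := x
    obtain ⟨w, rfl⟩ : ∃ w, mapL J w = x := by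
      refine ⟨⟨ρ • x.re - A ⟨x.re, hx.1⟩, ρ • x.im - A ⟨x.im, hx.2⟩⟩, ?_⟩
      ext
      · exact hJ.2 ⟨x.re, hx.1⟩
      · exact hJ.2 ⟨x.im, hx.2⟩
    change mapL J (U (z • mapL J w - B.complexify ⟨mapL J w, hdom w⟩)) = mapL J w
    rw [key, hU2]

/-- Every real number has a punctured neighbourhood free of eigenvalues: `μ` is not an eigenvalue
of `A + P`, where `P` projects onto `ker (μ - A)`, and other eigenvectors of `A` are annihilated
by `P`. -/
theorem IsResolventAt.exists_eigenvalue_gap [CompleteSpace X] {ρ : ℝ} {J : X →L[ℝ] X} (hJ : A.IsResolventAt ρ J)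
    (hc : IsCompactOperator J) (hA : A.IsSymmVia ι) (hι : Function.Injective ι) (μ : ℝ) :
    ∃ ε : ℝ, 0 < ε ∧ ∀ ν, A.IsEigenvalue ν → ν ≠ μ → ε ≤ |ν - μ| := by
  obtain ⟨P, hP⟩ := hJ.exists_isOrthProjVia hc hA hι μ
  have hBs : ((P : X →ₗ[ℝ] X) +ᵥ A).IsSymmVia ι := IsSymmVia.vadd_continuousLinearMap hA hP.inner_apply
  obtain ⟨R, hR⟩ := hJ.exists_isResolventAt_vadd hc P (μ : ℂ) fun p hp => by
    by_contra hne
    obtain ⟨-, v, ⟨hv, ev⟩, hv0⟩ := exists_real_eigenvector hBs hι p hp hne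
    rw [Complex.ofReal_re, vadd_apply] at ev
    obtain ⟨hd, e⟩ := hP.map_comm hA hι (A.kerSub_invariant μ) ⟨v, hv⟩
    obtain ⟨hd', e1⟩ := hP.mem v
    have e2 : P (P v + A ⟨v, hv⟩) = P (μ • v) := congrArg P ev
    rw [_root_.map_add, hP.apply_apply hι, ← e, _root_.map_smul, e1] at e2
    have e3 : P v = 0 := by linear_combination (norm := module) e2
    have e4 : A ⟨v, hv⟩ = μ • v := by
      have : P v + A ⟨v, hv⟩ = μ • v := ev
      rwa [e3, zero_add] at this
    exact hv0 ((hP.apply_of_mem hι ⟨hv, e4⟩).symm.trans e3)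
  obtain ⟨G, hG, -⟩ := hR.exists_real
  refine ⟨1 / (‖G‖ + 1), by positivity, fun ν hν hne => ?_⟩
  obtain ⟨v, hv, hv0⟩ := (Submodule.ne_bot_iff _).1 hν
  have hPv : P v = 0 := hP.apply_eq_zero_of_orth hι fun w hw =>
    inner_eq_zero_of_mem_kerSub hA hne hv hw
  obtain ⟨hvd, ev⟩ := hv
  have h1 := hG.2 ⟨v, hvd⟩
  rw [vadd_apply] at h1
  change G (μ • v - (P v + A ⟨v, hvd⟩)) = v at h1
  rw [hPv, zero_add, ev, ← sub_smul, _root_.map_smul] at h1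
  have h2 : ‖v‖ ≤ |ν - μ| * (‖G‖ * ‖v‖) := by
    conv_lhs => rw [← h1]
    rw [norm_smul, Real.norm_eq_abs, abs_sub_comm]
    gcongr
    exact G.le_opNorm v
  have hvn : 0 < ‖v‖ := norm_pos_iff.2 hv0
  have h3 : 1 ≤ |ν - μ| * ‖G‖ := by
    refine le_of_mul_le_mul_right ?_ hvn
    linarith
  rw [div_le_iff₀ (by positivity)]
  have := abs_nonneg (ν - μ)
  linarith

/-- Below any bound there are only finitely many eigenvalues, if these are bounded below. -/
theorem IsResolventAt.finite_eigenvalues [CompleteSpace X] {ρ : ℝ} {J : X →L[ℝ] X} (hJ : A.IsResolventAt ρ J)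
    (hc : IsCompactOperator J) (hA : A.IsSymmVia ι) (hι : Function.Injective ι) {b : ℝ}
    (hb : ∀ μ, A.IsEigenvalue μ → b ≤ μ) (c : ℝ) :
    {μ : ℝ | A.IsEigenvalue μ ∧ μ ≤ c}.Finite := by
  by_contra hinf
  obtain ⟨μ, -, hμ⟩ := Set.Infinite.exists_accPt_of_subset_isCompact (K := Set.Icc b c) hinf
    isCompact_Icc fun ν hν => ⟨hb ν hν.1, hν.2⟩
  obtain ⟨ε, hε, hgap⟩ := hJ.exists_eigenvalue_gap hc hA hι μ
  rw [accPt_iff_nhds] at hμ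
  obtain ⟨ν, ⟨h1, h2⟩, hne⟩ := hμ _ (Metric.ball_mem_nhds μ hε)
  have := hgap ν h2.1 hne
  rw [Metric.mem_ball, Real.dist_eq] at h1
  linarith

end LinearPMap

/-! ### Resolvent bounds on half planes -/

namespace LinearPMap
open Complexification

theorem IsResolventAt.norm_le_of_near {E : Type*} [NormedAddCommGroup E] [NormedSpace ℂ E]
    {A : E →ₗ.[ℂ] E} {z w : ℂ} {R Q : E →L[ℂ] E} (hR : A.IsResolventAt z R)
    (hQ : A.IsResolventAt w Q) (h : ‖w - z‖ * ‖R‖ ≤ 1 / 2) : ‖Q‖ ≤ 2 * ‖R‖ := by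
  have h1 := hR.sub_eq hQ
  have h2 : Q = R - (w - z) • (R * Q) := by rw [← h1]; abel
  have h3 : ‖Q‖ ≤ ‖R‖ + 1 / 2 * ‖Q‖ := by
    conv_lhs => rw [h2]
    refine (norm_sub_le _ _).trans ?_
    gcongr
    rw [norm_smul]
    calc _ ≤ ‖w - z‖ * (‖R‖ * ‖Q‖) := by gcongr; exact norm_mul_le _ _
      _ = (‖w - z‖ * ‖R‖) * ‖Q‖ := by ring
      _ ≤ _ := by gcongr
  linarith

/-- Resolvents are uniformly bounded on compact sets. -/
theorem exists_norm_resolvent_le {E : Type*} [NormedAddCommGroup E] [NormedSpace ℂ E]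
    {A : E →ₗ.[ℂ] E} {R : ℂ → E →L[ℂ] E} {k : Set ℂ} (hk : IsCompact k)
    (hR : ∀ z ∈ k, A.IsResolventAt z (R z)) : ∃ C : ℝ, ∀ z ∈ k, ‖R z‖ ≤ C := by
  have key := hk.induction_on (p := fun s => ∃ C : ℝ, ∀ z ∈ s, z ∈ k → ‖R z‖ ≤ C) ⟨0, by simp⟩
    (fun s t hst ⟨C, hC⟩ => ⟨C, fun z hz => hC z (hst hz)⟩)
    (fun s t ⟨C, hC⟩ ⟨D, hD⟩ => ⟨max C D, fun z hz hzk => hz.elim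
      (fun h => (hC z h hzk).trans (le_max_left _ _))
      (fun h => (hD z h hzk).trans (le_max_right _ _))⟩)
    (fun z hz => by
      refine ⟨Metric.ball z (1 / (2 * (‖R z‖ + 1))),
        mem_nhdsWithin_of_mem_nhds (Metric.ball_mem_nhds _ (by positivity)), 2 * ‖R z‖,
        fun w hw hwk => (hR z hz).norm_le_of_near (hR w hwk) ?_⟩
      rw [Metric.mem_ball, dist_eq_norm] at hw
      calc ‖w - z‖ * ‖R z‖ ≤ 1 / (2 * (‖R z‖ + 1)) * (‖R z‖ + 1) := by gcongr; linarith
        _ = 1 / 2 := by field_simp)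
  obtain ⟨C, hC⟩ := key
  exact ⟨C, fun z hz => hC z hz hz⟩

variable {X : Type*} [NormedAddCommGroup X] [NormedSpace ℝ X] {A : X →ₗ.[ℝ] X}

/-- The second resolvent identity turns a small `‖(z - A)⁻¹‖ ‖F‖` into a bound for the resolvent of
`A + F`, whose existence is assumed. -/
theorem IsResolventAt.norm_vadd_le {F : X →L[ℝ] X} {z : ℂ}
    {Q R : Complexification X →L[ℂ] Complexification X} (hQ : A.complexify.IsResolventAt z Q)
    (hR : ((F : X →ₗ[ℝ] X) +ᵥ A).complexify.IsResolventAt z R)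
    (h : ‖Q‖ * ‖mapL F‖ ≤ 1 / 2) : ‖R‖ ≤ 2 * ‖Q‖ := by
  refine ContinuousLinearMap.opNorm_le_bound _ (by positivity) fun p => ?_
  obtain ⟨hd, e⟩ := hR.1 p
  have hd' : R p ∈ A.complexify.domain := hd
  have e1 : z • R p - A.complexify ⟨R p, hd'⟩ = p + mapL F (R p) := by
    have e2 : ((F : X →ₗ[ℝ] X) +ᵥ A).complexify ⟨R p, hd⟩
        = mapL F (R p) + A.complexify ⟨R p, hd'⟩ := rfl
    rw [e2] at e
    linear_combination (norm := module) e
  have h1 : R p = Q (p + mapL F (R p)) := by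
    rw [← e1]; exact (hQ.2 ⟨R p, hd'⟩).symm
  have h2 : ‖R p‖ ≤ ‖Q‖ * ‖p‖ + 1 / 2 * ‖R p‖ := by
    conv_lhs => rw [h1]
    calc _ ≤ ‖Q‖ * (‖p‖ + ‖mapL F‖ * ‖R p‖) :=
          (Q.le_opNorm _).trans (by
            gcongr
            exact (norm_add_le _ _).trans (by gcongr; exact (mapL F).le_opNorm _))
      _ = ‖Q‖ * ‖p‖ + (‖Q‖ * ‖mapL F‖) * ‖R p‖ := by ring
      _ ≤ _ := by gcongr
  linarith

/-- Points of a half plane that are far from `a` lie in the sector `φ ≤ |arg (z - a)|`. -/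
theorem le_abs_arg_of_re_le {φ d : ℝ} (hφ : 0 < φ) (hφ' : φ < Real.pi / 2) {w : ℂ}
    (hw : w ≠ 0) (hre : w.re ≤ d) (hn : d / Real.cos φ ≤ ‖w‖) : φ ≤ |Complex.arg w| := by
  by_contra! hlt
  have hcos : 0 < Real.cos φ := Real.cos_pos_of_mem_Ioo ⟨by linarith, hφ'⟩
  have h1 : Real.cos φ < Real.cos |Complex.arg w| :=
    Real.cos_lt_cos_of_nonneg_of_le_pi (abs_nonneg _) (by linarith [Real.pi_pos]) hlt
  have hpos : 0 < ‖w‖ := norm_pos_iff.2 hw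
  rw [Real.cos_abs, Complex.cos_arg hw, lt_div_iff₀ hpos] at h1
  rw [div_le_iff₀ hcos] at hn
  linarith

/-- A bounded perturbation of a sectorial operator with compact resolvent satisfies the resolvent
bound on every half plane `Re z < d` whose closure is free of eigenvalues: far out this follows
from the bound for `A`, and the remaining part of the closed half plane is compact. -/
theorem exists_halfPlane_bound_vadd [CompleteSpace X] (hsect : A.complexify.IsSectorial)
    {ρ : ℝ} {J : X →L[ℝ] X} (hJ : A.IsResolventAt ρ J) (hc : IsCompactOperator J)
    (F : X →L[ℝ] X) (d : ℝ)
    (hz : ∀ z : ℂ, z.re ≤ d → ∀ p : ((F : X →ₗ[ℝ] X) +ᵥ A).complexify.domain,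
      ((F : X →ₗ[ℝ] X) +ᵥ A).complexify p = z • (p : Complexification X) →
        (p : Complexification X) = 0) :
    ∃ M : ℝ, ∀ z : ℂ, z.re < d → ∃ R : Complexification X →L[ℂ] Complexification X,
      ((F : X →ₗ[ℝ] X) +ᵥ A).complexify.IsResolventAt z R ∧ ‖R‖ ≤ M / ‖z - d‖ := by
  obtain ⟨-, -, a, φ, M, hφ, hφ', hM, hsec⟩ := hsect
  have hex : ∀ z : ℂ, z.re ≤ d → ∃ R : Complexification X →L[ℂ] Complexification X,
      ((F : X →ₗ[ℝ] X) +ᵥ A).complexify.IsResolventAt z R := fun z hzd =>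
    hJ.exists_isResolventAt_vadd hc F z (hz z hzd)
  choose! R hR using hex
  have hcos : 0 < Real.cos φ := Real.cos_pos_of_mem_Ioo ⟨by linarith, hφ'⟩
  -- Outside the ball of radius `N` around `a` the perturbation argument applies.
  obtain ⟨N, hN⟩ : ∃ N : ℝ, N = |d - a| / Real.cos φ + 2 * M * ‖mapL F‖ + |d - a| + 1 := ⟨_, rfl⟩
  have hq : 0 ≤ |d - a| / Real.cos φ := by positivity
  have hq2 : 0 ≤ 2 * M * ‖mapL F‖ := by positivity
  have hN1 : 1 ≤ N := by rw [hN]; linarith [abs_nonneg (d - a)]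
  have hk : IsCompact ({z : ℂ | z.re ≤ d} ∩ Metric.closedBall (a : ℂ) N) :=
    (isCompact_closedBall _ _).inter_left (isClosed_le Complex.continuous_re continuous_const)
  obtain ⟨C, hC⟩ := exists_norm_resolvent_le hk (fun z hz => hR z hz.1)
  refine ⟨max (4 * M) (|C| * (2 * N)), fun z hzd => ⟨R z, hR z hzd.le, ?_⟩⟩
  have hzd0 : z - d ≠ 0 := fun h => by
    rw [sub_eq_zero] at h
    rw [h] at hzd
    simp at hzd
  have hpos : 0 < ‖z - d‖ := norm_pos_iff.2 hzd0
  have hda : ‖((d : ℂ) - a)‖ = |d - a| := by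
    rw [← Complex.ofReal_sub, Complex.norm_real, Real.norm_eq_abs]
  have hdN : |d - a| ≤ N := by rw [hN]; linarith
  rw [le_div_iff₀ hpos]
  by_cases hfar : ‖z - a‖ ≤ N
  · have h1 : ‖R z‖ ≤ |C| := (hC z ⟨hzd.le, by rwa [mem_closedBall_iff_norm]⟩).trans (le_abs_self C)
    have h2 : ‖z - d‖ ≤ 2 * N := by
      calc ‖z - d‖ = ‖(z - a) - (d - a)‖ := by congr 1; ring
        _ ≤ ‖z - a‖ + ‖((d : ℂ) - a)‖ := norm_sub_le _ _
        _ ≤ _ := by rw [hda]; linarith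
    exact (mul_le_mul h1 h2 (norm_nonneg _) (abs_nonneg _)).trans (le_max_right _ _)
  · push Not at hfar
    have hza : 0 < ‖z - a‖ := by linarith
    have hza0 : z - a ≠ 0 := norm_pos_iff.1 hza
    obtain ⟨Q, hQ, hQn⟩ := hsec z (sub_ne_zero.1 hza0)
      (le_abs_arg_of_re_le hφ hφ' hza0 (d := d - a) (by simpa using hzd.le) (by
        have : (d - a) / Real.cos φ ≤ |d - a| / Real.cos φ := by gcongr; exact le_abs_self _
        rw [hN] at hfar
        linarith [abs_nonneg (d - a)]))
    have hsmall : ‖Q‖ * ‖mapL F‖ ≤ 1 / 2 := by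
      calc _ ≤ M / ‖z - a‖ * ‖mapL F‖ := by gcongr
        _ ≤ 1 / 2 := by
          rw [div_mul_eq_mul_div, div_le_iff₀ hza]
          rw [hN] at hfar
          linarith [abs_nonneg (d - a)]
    have h1 : ‖R z‖ ≤ 2 * (M / ‖z - a‖) :=
      (hQ.norm_vadd_le (hR z hzd.le) hsmall).trans (by gcongr)
    have h2 : ‖z - d‖ ≤ 2 * ‖z - a‖ := by
      calc ‖z - d‖ = ‖(z - a) - (d - a)‖ := by congr 1; ring
        _ ≤ ‖z - a‖ + ‖((d : ℂ) - a)‖ := norm_sub_le _ _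
        _ ≤ _ := by rw [hda]; linarith
    calc ‖R z‖ * ‖z - d‖ ≤ 2 * (M / ‖z - a‖) * (2 * ‖z - a‖) := by gcongr
      _ = 4 * M := by field_simp; ring
      _ ≤ _ := le_max_left _ _

/-- The resolvent set of a sectorial operator contains real points, at which the operator itself
has a resolvent, and its eigenvalues are bounded below. -/
theorem exists_real_resolvent_of_isSectorial (hsect : A.complexify.IsSectorial) :
    ∃ a : ℝ, (∀ r < a, ∃ J : X →L[ℝ] X, A.IsResolventAt r J) ∧
      ∀ μ, A.IsEigenvalue μ → a ≤ μ := by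
  obtain ⟨-, -, a, φ, M, hφ, hφ', hM, hsec⟩ := hsect
  have h : ∀ r < a, ∃ J : X →L[ℝ] X, A.IsResolventAt r J := fun r hr => by
    have hneg : (r - a : ℝ) < 0 := by linarith
    obtain ⟨R, hR, -⟩ := hsec (r : ℂ) (by exact_mod_cast hr.ne) (by
      rw [← Complex.ofReal_sub, Complex.arg_ofReal_of_neg hneg, abs_of_pos Real.pi_pos]
      linarith [Real.pi_pos])
    obtain ⟨J, hJ, -⟩ := hR.exists_real
    exact ⟨J, hJ⟩
  refine ⟨a, h, fun μ hμ => ?_⟩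
  by_contra! hlt
  obtain ⟨J, hJ⟩ := h μ hlt
  refine hμ ((Submodule.eq_bot_iff _).2 fun x hx => ?_)
  have := (hJ.mem_kerSub_iff μ x).1 hx
  rw [sub_self, zero_smul] at this
  exact this.symm

end LinearPMap

/-! ### Fractional powers of the generator of an exponentially stable semigroup -/

section FractionalPower

theorem integrableOn_rpow_smul_of_le_exp {Y : Type*} [NormedAddCommGroup Y] [NormedSpace ℝ Y]
    {F : ℝ → Y} {K ω s : ℝ} (hF : ContinuousOn F (Set.Ioi 0)) (hω : 0 < ω)
    (hK : ∀ t, 0 < t → ‖F t‖ ≤ K * Real.exp (-ω * t)) (hs : -1 < s) :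
    IntegrableOn (fun t => t ^ s • F t) (Set.Ioi 0) := by
  have h1 := (integrableOn_rpow_mul_exp_neg_mul_rpow (s := s) (p := 1) (b := ω) hs one_pos
    hω).const_mul K
  refine h1.mono' ?_ ?_
  · refine ContinuousOn.aestronglyMeasurable ?_ measurableSet_Ioi
    exact (continuousOn_id.rpow_const fun t ht => Or.inl (ne_of_gt ht)).smul hF
  · refine (ae_restrict_mem measurableSet_Ioi).mono fun t ht => ?_
    rw [norm_smul, Real.norm_of_nonneg (Real.rpow_nonneg (le_of_lt ht) s), Real.rpow_one]
    calc _ ≤ t ^ s * (K * Real.exp (-ω * t)) :=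
          mul_le_mul_of_nonneg_left (hK t ht) (Real.rpow_nonneg (le_of_lt ht) s)
      _ = _ := by ring

theorem integrableOn_of_le_exp {Y : Type*} [NormedAddCommGroup Y] [NormedSpace ℝ Y]
    {F : ℝ → Y} {K ω : ℝ} (hF : ContinuousOn F (Set.Ioi 0)) (hω : 0 < ω)
    (hK : ∀ t, 0 < t → ‖F t‖ ≤ K * Real.exp (-ω * t)) : IntegrableOn F (Set.Ioi 0) := by
  simpa using integrableOn_rpow_smul_of_le_exp hF hω hK (s := 0) (by norm_num)

theorem integrableOn_rpow_mul_inv_one_add {α : ℝ} (h0 : 0 < α) (h1 : α < 1) :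
    IntegrableOn (fun w : ℝ => w ^ (-α) * (1 + w)⁻¹) (Set.Ioi 0) := by
  have hm : ∀ s : Set ℝ, MeasurableSet s → s ⊆ Set.Ioi 0 →
      AEStronglyMeasurable (fun w : ℝ => w ^ (-α) * (1 + w)⁻¹) (volume.restrict s) :=
    fun s hs hsub => by
    refine ContinuousOn.aestronglyMeasurable (fun w hw => ?_) hs
    have hw' : 0 < w := hsub hw
    have : 1 + w ≠ 0 := by positivity
    exact (((Real.continuousAt_rpow_const w _ (Or.inl hw'.ne')).mul
      (by fun_prop (disch := assumption)))).continuousWithinAt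
  rw [← Set.Ioc_union_Ioi_eq_Ioi (zero_le_one (α := ℝ))]
  refine IntegrableOn.union ?_ ?_
  · have h2 : IntegrableOn (fun w : ℝ => w ^ (-α)) (Set.Ioc 0 1) := by
      rw [← intervalIntegrable_iff_integrableOn_Ioc_of_le zero_le_one]
      exact intervalIntegral.intervalIntegrable_rpow' (by linarith)
    refine h2.mono' (hm _ measurableSet_Ioc fun w hw => hw.1) ?_
    refine (ae_restrict_mem measurableSet_Ioc).mono fun w hw => ?_
    have hw0 : 0 < w := hw.1
    rw [Real.norm_of_nonneg (by positivity)]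
    refine mul_le_of_le_one_right (by positivity) (inv_le_one_of_one_le₀ (by linarith))
  · have h2 : IntegrableOn (fun w : ℝ => w ^ (-α - 1)) (Set.Ioi 1) :=
      integrableOn_Ioi_rpow_of_lt (by linarith) one_pos
    refine h2.mono' (hm _ measurableSet_Ioi fun w hw => Set.mem_Ioi.2 (lt_trans one_pos hw)) ?_
    refine (ae_restrict_mem measurableSet_Ioi).mono fun w hw => ?_
    have hw0 : 0 < w := lt_trans one_pos hw
    rw [Real.norm_of_nonneg (by positivity), Real.rpow_sub_one hw0.ne', div_eq_mul_inv]
    gcongr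
    linarith

/-- The convolution identity behind `B^{-α} B^{-(1 - α)} = B⁻¹`, with an unspecified constant:
the substitution `s = r w` separates the variables. -/
theorem integral_rpow_integral_rpow_add {Y : Type*} [NormedAddCommGroup Y] [NormedSpace ℝ Y]
    [CompleteSpace Y]
    {F : ℝ → Y} {K ω α : ℝ} (hF : ContinuousOn F (Set.Ioi 0)) (hω : 0 < ω)
    (hK : ∀ t, 0 < t → ‖F t‖ ≤ K * Real.exp (-ω * t)) (h0 : 0 < α) (h1 : α < 1) :
    ∫ r in Set.Ioi (0 : ℝ), r ^ (α - 1) • ∫ s in Set.Ioi (0 : ℝ), s ^ (-α) • F (r + s)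
      = (∫ w in Set.Ioi (0 : ℝ), w ^ (-α) * (1 + w)⁻¹) • ∫ u in Set.Ioi (0 : ℝ), F u := by
  have hFi := integrableOn_of_le_exp hF hω hK
  have e1 : ∀ r ∈ Set.Ioi (0 : ℝ),
      r ^ (α - 1) • ∫ s in Set.Ioi (0 : ℝ), s ^ (-α) • F (r + s)
        = ∫ w in Set.Ioi (0 : ℝ), w ^ (-α) • F (r * (1 + w)) := by
    intro r hr
    have hr0 : 0 < r := hr
    have h2 := integral_comp_mul_left_Ioi (fun s => s ^ (-α) • F (r + s)) 0 hr0
    rw [mul_zero] at h2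
    have h3 : ∫ s in Set.Ioi (0 : ℝ), s ^ (-α) • F (r + s) =
        r • ∫ w in Set.Ioi (0 : ℝ), (r * w) ^ (-α) • F (r + r * w) := by
      rw [h2, smul_smul, mul_inv_cancel₀ hr0.ne', one_smul]
    rw [h3, smul_smul, ← integral_smul]
    refine setIntegral_congr_fun measurableSet_Ioi fun w hw => ?_
    have hw0 : 0 < w := hw
    simp only [smul_smul]
    rw [Real.mul_rpow hr0.le hw0.le, mul_one_add]
    congr 1
    have : r ^ (α - 1) * r * r ^ (-α) = 1 := by
      rw [← Real.rpow_add_one hr0.ne', ← Real.rpow_add hr0]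
      simp
    linear_combination w ^ (-α) * this
  have e2 : ∀ w ∈ Set.Ioi (0 : ℝ), ∀ G : ℝ → ℝ,
      ∫ r in Set.Ioi (0 : ℝ), G (r * (1 + w)) = (1 + w)⁻¹ * ∫ u in Set.Ioi (0 : ℝ), G u := by
    intro w hw G
    have hw0 : 0 < 1 + w := by have : 0 < w := hw; positivity
    have := integral_comp_mul_right_Ioi G 0 hw0
    rwa [zero_mul] at this
  have hint : Integrable (Function.uncurry fun r w : ℝ => w ^ (-α) • F (r * (1 + w)))
      ((volume.restrict (Set.Ioi 0)).prod (volume.restrict (Set.Ioi 0))) := by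
    rw [integrable_prod_iff']
    · constructor
      · refine (ae_restrict_mem measurableSet_Ioi).mono fun w hw => ?_
        have hw0 : 0 < 1 + w := by have : 0 < w := hw; positivity
        have := (integrableOn_Ioi_comp_mul_right_iff F 0 hw0).2 (by rwa [zero_mul])
        exact Integrable.smul (w ^ (-α)) this
      · have h2 := (integrableOn_rpow_mul_inv_one_add h0 h1).mul_const
          (∫ u in Set.Ioi (0 : ℝ), ‖F u‖)
        refine h2.congr ((ae_restrict_mem measurableSet_Ioi).mono fun w hw => ?_)
        have hw0 : 0 < w := hw
        simp only [Function.uncurry, norm_smul]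
        rw [integral_const_mul, e2 w hw fun u => ‖F u‖,
          Real.norm_of_nonneg (by positivity), mul_assoc]
    · rw [Measure.prod_restrict]
      refine ContinuousOn.aestronglyMeasurable ?_ (measurableSet_Ioi.prod measurableSet_Ioi)
      refine ContinuousOn.smul ?_ ?_
      · exact continuousOn_snd.rpow_const fun p hp => Or.inl (ne_of_gt hp.2)
      · refine hF.comp (by fun_prop) fun p hp => ?_
        have h2 : 0 < p.1 := hp.1
        have h3 : 0 < p.2 := hp.2
        exact mul_pos h2 (by positivity)
  rw [setIntegral_congr_fun measurableSet_Ioi e1, integral_integral_swap hint,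
    ← integral_smul_const]
  refine setIntegral_congr_fun measurableSet_Ioi fun w hw => ?_
  have hw0 : 0 < 1 + w := by have : 0 < w := hw; positivity
  have h2 := integral_comp_mul_right_Ioi F 0 hw0
  rw [zero_mul] at h2
  rw [integral_smul, h2, smul_smul]

theorem integral_rpow_mul_inv_one_add {α : ℝ} (h0 : 0 < α) (h1 : α < 1) :
    ∫ w in Set.Ioi (0 : ℝ), w ^ (-α) * (1 + w)⁻¹ = Real.Gamma α * Real.Gamma (1 - α) := by
  have key := integral_rpow_integral_rpow_add (F := fun u : ℝ => Real.exp (-u)) (K := 1) (ω := 1)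
    (by fun_prop) one_pos (fun t _ => by simp) h0 h1
  rw [integral_exp_neg_Ioi_zero, smul_eq_mul, mul_one] at key
  rw [← key, Real.Gamma_eq_integral h0, Real.Gamma_eq_integral (by linarith : 0 < 1 - α),
    ← integral_mul_const]
  refine setIntegral_congr_fun measurableSet_Ioi fun r _ => ?_
  simp only [smul_eq_mul]
  rw [← integral_const_mul, ← integral_const_mul]
  refine integral_congr_ae (Eventually.of_forall fun s => ?_)
  simp only
  rw [neg_add, Real.exp_add, show 1 - α - 1 = -α by ring]
  ring

/-- The scaling `∫ s^{-α} / (s + t) ds = C t^{-α}`, in the form of an estimate. -/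
theorem norm_integral_rpow_smul_le {Y : Type*} [NormedAddCommGroup Y] [NormedSpace ℝ Y]
    {F : ℝ → Y} {α t C : ℝ} (h0 : 0 < α) (h1 : α < 1) (ht : 0 < t)
    (hF : ∀ s, 0 < s → ‖F s‖ ≤ C * (s + t)⁻¹) :
    ‖∫ s in Set.Ioi (0 : ℝ), s ^ (-α) • F s‖
      ≤ C * (Real.Gamma α * Real.Gamma (1 - α)) * t ^ (-α) := by
  obtain ⟨g, hg⟩ : ∃ g : ℝ → ℝ, g = fun s => s ^ (-α) * (s + t)⁻¹ := ⟨_, rfl⟩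
  have e : ∀ w ∈ Set.Ioi (0 : ℝ), g (t * w) = (t ^ (-α) * t⁻¹) * (w ^ (-α) * (1 + w)⁻¹) := by
    intro w hw
    have hw0 : 0 < w := hw
    simp only [hg]
    rw [Real.mul_rpow ht.le hw0.le, show t * w + t = t * (1 + w) by ring, mul_inv]
    ring
  have hi' : IntegrableOn (fun w : ℝ => (t ^ (-α) * t⁻¹) * (w ^ (-α) * (1 + w)⁻¹)) (Set.Ioi 0) :=
    (integrableOn_rpow_mul_inv_one_add h0 h1).const_mul _
  have hi : IntegrableOn (fun w => g (t * w)) (Set.Ioi 0) :=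
    hi'.congr_fun (fun w hw => (e w hw).symm) measurableSet_Ioi
  have hgi : IntegrableOn g (Set.Ioi 0) := by
    have := (integrableOn_Ioi_comp_mul_left_iff g 0 ht).1 hi
    rwa [mul_zero] at this
  have hgv : ∫ s in Set.Ioi (0 : ℝ), g s = (Real.Gamma α * Real.Gamma (1 - α)) * t ^ (-α) := by
    have h2 := integral_comp_mul_left_Ioi g 0 ht
    rw [mul_zero, setIntegral_congr_fun measurableSet_Ioi e, integral_const_mul,
      integral_rpow_mul_inv_one_add h0 h1, smul_eq_mul] at h2
    have h3 : t⁻¹ ≠ 0 := inv_ne_zero ht.ne'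
    apply mul_left_cancel₀ h3
    rw [← h2]
    ring
  have h4 := norm_integral_le_of_norm_le (f := fun s => s ^ (-α) • F s) (hgi.const_mul C)
    ((ae_restrict_mem measurableSet_Ioi).mono fun s hs => by
      have hs0 : 0 < s := hs
      rw [norm_smul, Real.norm_of_nonneg (by positivity)]
      calc _ ≤ s ^ (-α) * (C * (s + t)⁻¹) := by gcongr; exact hF s hs0
        _ = C * g s := by rw [hg]; ring)
  rw [integral_const_mul, hgv] at h4
  rwa [mul_assoc]

variable {X : Type*} [NormedAddCommGroup X] [NormedSpace ℝ X] [CompleteSpace X]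

/-- Let `T t = e^{-t B}` decay exponentially. If `∫ T u w du = v`, that is `v = B⁻¹ w`, then `v`
lies in the domain of `B ^ α`, and `B ^ α v = B ^ {-(1 - α)} w`. -/
theorem exists_fracPow_apply_eq {T : ℝ → X →L[ℝ] X} {K ω : ℝ} (hω : 0 < ω)
    (hcont : ∀ x, ContinuousOn (fun t => T t x) (Set.Ioi 0))
    (hK : ∀ t, 0 < t → ‖T t‖ ≤ K * Real.exp (-ω * t))
    (hadd : ∀ s t, 0 < s → 0 < t → ∀ x, T (s + t) x = T s (T t x))
    (hinj : ∀ y, ∫ u in Set.Ioi (0 : ℝ), T u y = 0 → y = 0) {α : ℝ} (h0 : 0 < α) (h1 : α < 1)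
    {v w : X} (hv : ∫ u in Set.Ioi (0 : ℝ), T u w = v) :
    ∃ h : v ∈ (fracPow T α).domain, fracPow T α ⟨v, h⟩ =
      (Real.Gamma (1 - α))⁻¹ • ∫ s in Set.Ioi (0 : ℝ), s ^ (-α) • T s w := by
  have hKx : ∀ x t, 0 < t → ‖T t x‖ ≤ (K * ‖x‖) * Real.exp (-ω * t) := fun x t ht => by
    calc _ ≤ ‖T t‖ * ‖x‖ := (T t).le_opNorm x
      _ ≤ (K * Real.exp (-ω * t)) * ‖x‖ := by gcongr; exact hK t ht
      _ = _ := by ring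
  have hint : ∀ (x : X) (s : ℝ), -1 < s → IntegrableOn (fun t => t ^ s • T t x) (Set.Ioi 0) := fun x s hs =>
    integrableOn_rpow_smul_of_le_exp (hcont x) hω (hKx x) hs
  have hG : Real.Gamma α ≠ 0 := (Real.Gamma_pos_of_pos h0).ne'
  have hG' : Real.Gamma (1 - α) ≠ 0 := (Real.Gamma_pos_of_pos (by linarith)).ne'
  have hconv : ∀ x, ∫ r in Set.Ioi (0 : ℝ), r ^ (α - 1) • ∫ s in Set.Ioi (0 : ℝ),
      s ^ (-α) • T (r + s) x = (Real.Gamma α * Real.Gamma (1 - α)) •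
        ∫ u in Set.Ioi (0 : ℝ), T u x := fun x => by
    rw [integral_rpow_integral_rpow_add (hcont x) hω (hKx x) h0 h1,
      integral_rpow_mul_inv_one_add h0 h1]
  have hT : ∀ x, ∀ r ∈ Set.Ioi (0 : ℝ), T r (∫ s in Set.Ioi (0 : ℝ), s ^ (-α) • T s x)
      = ∫ s in Set.Ioi (0 : ℝ), s ^ (-α) • T (r + s) x := fun x r hr => by
    rw [← (T r).integral_comp_comm (hint x (-α) (by linarith))]
    refine setIntegral_congr_fun measurableSet_Ioi fun s hs => ?_
    rw [map_smul, hadd r s hr hs]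
  -- The graph is that of an operator, since `B^{-α}` is injective.
  have hfun : ∀ p ∈ fracPowGraph T α, p.1 = 0 → p.2 = 0 := by
    rintro ⟨p1, y⟩ hp (rfl : p1 = 0)
    rcases hp with ⟨h, -⟩ | ⟨-, -, h⟩
    · exact absurd h h0.ne'
    have h2 : ∫ t in Set.Ioi (0 : ℝ), t ^ (α - 1) • T t y = 0 :=
      (smul_eq_zero.1 h.symm).resolve_left (inv_ne_zero hG)
    have h3 := integral_rpow_integral_rpow_add (α := 1 - α) (hcont y) hω (hKx y) (by linarith)
      (by linarith)
    rw [integral_rpow_mul_inv_one_add (by linarith) (by linarith)] at h3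
    have h4 : ∫ r in Set.Ioi (0 : ℝ), r ^ (1 - α - 1) • ∫ s in Set.Ioi (0 : ℝ),
        s ^ (-(1 - α)) • T (r + s) y = 0 := by
      refine setIntegral_eq_zero_of_forall_eq_zero fun r hr => ?_
      have e : ∫ s in Set.Ioi (0 : ℝ), s ^ (-(1 - α)) • T (r + s) y
          = T r (∫ t in Set.Ioi (0 : ℝ), t ^ (α - 1) • T t y) := by
        rw [← (T r).integral_comp_comm (hint y (α - 1) (by linarith))]
        refine setIntegral_congr_fun measurableSet_Ioi fun s hs => ?_
        rw [map_smul, hadd r s hr hs, neg_sub]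
      rw [e, h2, map_zero, smul_zero]
    rw [h4, sub_sub_cancel] at h3
    exact hinj y ((smul_eq_zero.1 h3.symm).resolve_left (mul_ne_zero hG' hG))
  obtain ⟨y, hy⟩ : ∃ y, y = (Real.Gamma (1 - α))⁻¹ • ∫ s in Set.Ioi (0 : ℝ), s ^ (-α) • T s w :=
    ⟨_, rfl⟩
  have hmem : (v, y) ∈ fracPowGraph T α := by
    refine Or.inr ⟨h0.ne', hint y (α - 1) (by linarith), ?_⟩
    have e : ∫ t in Set.Ioi (0 : ℝ), t ^ (α - 1) • T t y = (Real.Gamma (1 - α))⁻¹ •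
        ∫ r in Set.Ioi (0 : ℝ), r ^ (α - 1) • ∫ s in Set.Ioi (0 : ℝ), s ^ (-α) • T (r + s) w := by
      rw [← integral_smul]
      refine setIntegral_congr_fun measurableSet_Ioi fun r hr => ?_
      rw [hy, map_smul, hT w r hr, smul_comm]
    change v = (Real.Gamma α)⁻¹ • ∫ t in Set.Ioi (0 : ℝ), t ^ (α - 1) • T t y
    rw [e, hconv, hv, smul_smul, smul_smul]
    field_simp
    rw [one_smul]
  have hdom : v ∈ (fracPow T α).domain := ⟨(v, y), hmem, rfl⟩
  refine ⟨hdom, ?_⟩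
  have h5 := Submodule.mem_graph_toLinearPMap hfun ⟨v, hdom⟩
  have h6 := hfun _ ((fracPowGraph T α).sub_mem h5 hmem) (sub_self v)
  rw [← hy]
  exact sub_eq_zero.1 h6

theorem exists_fracPow_zero_apply_eq {X : Type*} [NormedAddCommGroup X] [NormedSpace ℝ X]
    (T : ℝ → X →L[ℝ] X) (v : X) :
    ∃ h : v ∈ (fracPow T 0).domain, fracPow T 0 ⟨v, h⟩ = v := by
  have hfun : ∀ p ∈ fracPowGraph T 0, p.1 = 0 → p.2 = 0 := by
    rintro p (⟨-, h⟩ | ⟨h, -⟩) h0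
    · rw [← h, h0]
    · exact absurd rfl h
  have hdom : v ∈ (fracPow T 0).domain := ⟨(v, v), Or.inl ⟨rfl, rfl⟩, rfl⟩
  refine ⟨hdom, ?_⟩
  rcases Submodule.mem_graph_toLinearPMap hfun ⟨v, hdom⟩ with ⟨-, h⟩ | ⟨h, -⟩
  · exact h.symm
  · exact absurd rfl h

end FractionalPower

/-! ### Semigroups on eigenspaces and under commuting projections -/

theorem eq_exp_smul_of_hasDerivAt {Y : Type*} [NormedAddCommGroup Y] [NormedSpace ℝ Y]
    {f : ℝ → Y} {c : ℝ} {y : Y} (hf : ∀ t, 0 < t → HasDerivAt f (-(c • f t)) t)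
    (hy : Tendsto f (𝓝[>] 0) (𝓝 y)) {t : ℝ} (ht : 0 < t) : f t = Real.exp (-c * t) • y := by
  have hexp : ∀ s, HasDerivAt (fun s : ℝ => Real.exp (c * s)) (Real.exp (c * s) * c) s := fun s => by
    simpa using ((hasDerivAt_id s).const_mul c).exp
  have hg : ∀ s ∈ Set.Ioi (0 : ℝ), HasDerivAt (fun s => Real.exp (c * s) • f s) 0 s :=
    fun s hs => ((hexp s).smul (hf s hs)).congr_deriv (by module)
  have hconst : ∀ s ∈ Set.Ioi (0 : ℝ), Real.exp (c * s) • f s = Real.exp (c * t) • f t :=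
    fun s hs => isOpen_Ioi.is_const_of_deriv_eq_zero isPreconnected_Ioi
      (fun s hs => (hg s hs).differentiableAt.differentiableWithinAt)
      (fun s hs => (hg s hs).deriv) hs ht
  have hlim : Tendsto (fun s => Real.exp (c * s) • f s) (𝓝[>] 0) (𝓝 y) := by
    have h1 : Tendsto (fun s : ℝ => Real.exp (c * s)) (𝓝[>] 0) (𝓝 1) := by
      have := (hexp 0).continuousAt.tendsto
      rw [mul_zero, Real.exp_zero] at this
      exact this.mono_left nhdsWithin_le_nhds
    simpa using h1.smul hy
  have h2 : Real.exp (c * t) • f t = y := by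
    refine tendsto_nhds_unique (tendsto_const_nhds.congr' ?_) hlim
    filter_upwards [self_mem_nhdsWithin] with s hs
    exact (hconst s hs).symm
  rw [← h2, smul_smul, ← Real.exp_add, neg_mul, neg_add_cancel, Real.exp_zero, one_smul]

theorem expNeg_apply_of_eigenvector {E : Type*} [NormedAddCommGroup E] [NormedSpace ℝ E]
    [CompleteSpace E] {B : E →L[ℝ] E} {μ : ℝ} {v : E} (h : B v = μ • v) (t : ℝ) :
    expNeg B t v = Real.exp (-μ * t) • v := by
  have h1 := NormedSpace.exp_series_hasSum_exp' (𝕂 := ℝ) ((-t) • B)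
  have h2 := (ContinuousLinearMap.apply ℝ E v).hasSum h1
  have h3 := (NormedSpace.exp_series_hasSum_exp' (𝕂 := ℝ) (-μ * t)).smul_const v
  rw [← Real.exp_eq_exp_ℝ] at h3
  -- Compare the two exponential series term by term.
  have hpow : ∀ n : ℕ, (((-t) • B) ^ n) v = (-μ * t) ^ n • v := by
    intro n
    induction n with
    | zero => simp
    | succ n ih =>
      have e : ((-t) • B) v = (-μ * t) • v := by
        change (-t) • B v = _
        rw [h]; module
      rw [pow_succ]
      change (((-t) • B) ^ n) (((-t) • B) v) = _
      rw [e, map_smul, ih, smul_smul, pow_succ, mul_comm]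
  refine h2.unique ?_
  convert h3 using 2 with n
  change ((n.factorial : ℝ)⁻¹ • (((-t) • B) ^ n) v) = _
  rw [hpow, smul_smul, smul_eq_mul]

namespace LinearPMap
variable {X : Type*} [NormedAddCommGroup X] [NormedSpace ℝ X]
  {B : X →ₗ.[ℝ] X} {S : ℝ → X →L[ℝ] X}

/-- A semigroup leaves the domain of its generator invariant and commutes with it there. -/
theorem GeneratesSemigroup.apply_comm (hS : B.GeneratesSemigroup S) {t : ℝ} (ht : 0 ≤ t)
    (x : B.domain) : ∃ h : S t x ∈ B.domain, B ⟨S t x, h⟩ = S t (B x) := by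
  have h1 := (hS.generator x (-B x)).2 ⟨x.2, rfl⟩
  have h2 := ((S t).continuous.tendsto _).comp h1
  have h3 : Tendsto (fun s : ℝ => s⁻¹ • (S s (S t x) - S t x)) (𝓝[>] 0) (𝓝 (S t (-B x))) := by
    refine h2.congr' ?_
    filter_upwards [self_mem_nhdsWithin] with s hs
    have e : S s (S t x) = S t (S s x) := by
      have e1 := congrArg (fun T => T (x : X)) (hS.map_add s t (le_of_lt hs) ht)
      have e2 := congrArg (fun T => T (x : X)) (hS.map_add t s ht (le_of_lt hs))
      rw [add_comm] at e2
      exact e1.symm.trans e2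
    simp only [Function.comp]
    rw [e, _root_.map_smul, _root_.map_sub]
  obtain ⟨h, e⟩ := (hS.generator _ _).1 h3
  refine ⟨h, ?_⟩
  rw [_root_.map_neg, neg_inj] at e
  exact e.symm

/-- Orbits starting in the domain satisfy `d/dt S t x = -S t (B x)`; differentiability, which for an
analytic semigroup is known anyway, upgrades the right derivative to a derivative. -/
theorem GeneratesSemigroup.hasDerivAt (hS : B.GeneratesSemigroup S) {t : ℝ} (ht : 0 ≤ t)
    (x : B.domain) (hd : DifferentiableAt ℝ (fun s => S s (x : X)) t) :
    HasDerivAt (fun s => S s (x : X)) (-S t (B x)) t := by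
  have h1 := (hS.generator x (-B x)).2 ⟨x.2, rfl⟩
  have h2 := ((S t).continuous.tendsto _).comp h1
  have h3 := hd.hasDerivAt.tendsto_slope_zero_right
  have h4 : deriv (fun s => S s (x : X)) t = S t (-B x) := by
    refine tendsto_nhds_unique h3 (h2.congr' ?_)
    filter_upwards [self_mem_nhdsWithin] with s hs
    have e1 := congrArg (fun T => T (x : X)) (hS.map_add t s ht (le_of_lt hs))
    change S (t + s) x = S t (S s x) at e1
    simp only [Function.comp]
    rw [e1, _root_.map_smul, _root_.map_sub]
  rw [← _root_.map_neg, ← h4]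
  exact hd.hasDerivAt

theorem IsAnalyticSemigroup.apply_of_mem_kerSub {a K : ℝ} (hS : B.IsAnalyticSemigroup S a K)
    {μ : ℝ} {v : X} (hv : v ∈ B.kerSub μ) {t : ℝ} (ht : 0 ≤ t) :
    S t v = Real.exp (-μ * t) • v := by
  rcases ht.eq_or_lt with rfl | ht
  · rw [hS.map_zero, mul_zero, Real.exp_zero, one_smul]; rfl
  refine eq_exp_smul_of_hasDerivAt (f := fun t => S t v) (fun s hs => ?_)
    (hS.strongly_continuous v) ht
  obtain ⟨hvd, e⟩ := hv
  obtain ⟨hd', h1, -⟩ := hS.smoothing s hs v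
  have h2 := hS.hasDerivAt hs.le ⟨v, hvd⟩ h1.differentiableAt
  rwa [e, _root_.map_smul] at h2

/-- A bounded `C` with `C B = μ C` intertwines `e^{-t B}` with `e^{-μ t}`. -/
theorem IsAnalyticSemigroup.map_apply {a K : ℝ} (hS : B.IsAnalyticSemigroup S a K) {μ : ℝ}
    {C : X →L[ℝ] X} (hC : ∀ x : B.domain, C (B x) = μ • C x) {t : ℝ} (ht : 0 ≤ t) (x : X) :
    C (S t x) = Real.exp (-μ * t) • C x := by
  rcases ht.eq_or_lt with rfl | ht
  · rw [hS.map_zero, mul_zero, Real.exp_zero, one_smul]; rfl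
  refine eq_exp_smul_of_hasDerivAt (f := fun t => C (S t x)) (fun s hs => ?_)
    ((C.continuous.tendsto _).comp (hS.strongly_continuous x)) ht
  obtain ⟨h, h1, -⟩ := hS.smoothing s hs x
  have h2 := C.hasFDerivAt.comp_hasDerivAt s h1
  rw [_root_.map_neg, hC ⟨_, h⟩] at h2
  exact h2

/-- If `P` is a bounded projection commuting with `e^{-t (A + κ P)}`, then
`e^{-t A} = e^{-t (A + κ P)} e^{κ t P}`. -/
theorem GeneratesSemigroup.of_vadd_smul_projection {A : X →ₗ.[ℝ] X} {P : X →L[ℝ] X} {κ : ℝ}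
    (hS : (((κ • P : X →L[ℝ] X) : X →ₗ[ℝ] X) +ᵥ A).GeneratesSemigroup S)
    (hP : ∀ x, P (P x) = P x) (hcomm : ∀ t, 0 ≤ t → ∀ x, P (S t x) = S t (P x)) :
    A.GeneratesSemigroup
      (fun t => (S t).comp (ContinuousLinearMap.id ℝ X + (Real.exp (κ * t) - 1) • P)) := by
  have happ : ∀ t x, ((S t).comp (ContinuousLinearMap.id ℝ X + (Real.exp (κ * t) - 1) • P)) x
      = S t x + (Real.exp (κ * t) - 1) • S t (P x) := fun t x => by
    change S t (x + (Real.exp (κ * t) - 1) • P x) = _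
    rw [_root_.map_add, _root_.map_smul]
  have hexp : Tendsto (fun t : ℝ => Real.exp (κ * t) - 1) (𝓝[>] 0) (𝓝 0) := by
    have : ContinuousAt (fun t : ℝ => Real.exp (κ * t) - 1) 0 := by fun_prop
    have := this.tendsto
    rw [mul_zero, Real.exp_zero, sub_self] at this
    exact this.mono_left nhdsWithin_le_nhds
  have hexp' : Tendsto (fun t : ℝ => t⁻¹ • (Real.exp (κ * t) - 1)) (𝓝[>] 0) (𝓝 κ) := by
    have : HasDerivAt (fun t : ℝ => Real.exp (κ * t)) κ 0 := by
      simpa using ((hasDerivAt_id (0 : ℝ)).const_mul κ).exp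
    simpa using this.tendsto_slope_zero_right
  refine ⟨?_, fun s t hs ht => ?_, fun x => ?_, fun x y => ?_⟩
  · ext x
    rw [happ, hS.map_zero, mul_zero, Real.exp_zero, sub_self, zero_smul, add_zero]
  · ext x
    have h1 : ∀ y, S (s + t) y = S s (S t y) := fun y =>
      congrArg (fun T => T y) (hS.map_add s t hs ht)
    rw [ContinuousLinearMap.comp_apply (f := (S t).comp _), happ, happ, happ, h1, h1]
    simp only [_root_.map_add, _root_.map_smul, hcomm t ht, hP, mul_add, Real.exp_add]
    module
  · have h2 := (hS.strongly_continuous x).add (hexp.smul (hS.strongly_continuous (P x)))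
    rw [zero_smul, add_zero] at h2
    exact h2.congr fun t => (happ t x).symm
  · have h2 := hexp'.smul (hS.strongly_continuous (P x))
    have e : ∀ t : ℝ, t⁻¹ • (((S t).comp
        (ContinuousLinearMap.id ℝ X + (Real.exp (κ * t) - 1) • P)) x - x)
        = t⁻¹ • (S t x - x) + (t⁻¹ • (Real.exp (κ * t) - 1)) • S t (P x) := fun t => by
      rw [happ]; module
    have h3 : Tendsto (fun t : ℝ => t⁻¹ • (((S t).comp
        (ContinuousLinearMap.id ℝ X + (Real.exp (κ * t) - 1) • P)) x - x)) (𝓝[>] 0) (𝓝 y) ↔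
        Tendsto (fun t : ℝ => t⁻¹ • (S t x - x)) (𝓝[>] 0) (𝓝 (y - κ • P x)) := by
      constructor
      · intro h
        refine (h.sub h2).congr fun t => ?_
        rw [e, add_sub_cancel_right]
      · intro h
        have := h.add h2
        rw [sub_add_cancel] at this
        exact this.congr fun t => (e t).symm
    rw [h3, hS.generator]
    refine exists_congr fun h => ?_
    change y - κ • P x = -(κ • P x + A ⟨x, h⟩) ↔ _
    constructor <;> intro h' <;> linear_combination (norm := module) h'

/-! ### Sums of eigenspaces -/

variable {H : Type*} [NormedAddCommGroup H] [InnerProductSpace ℝ H] {ι : X →ₗ[ℝ] H}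
  {A : X →ₗ.[ℝ] X}

theorem iSupIndep_of_inner_eq_zero (hι : Function.Injective ι)
    {J : Type*} {V : J → Submodule ℝ X}
    (h : ∀ i j, i ≠ j → ∀ u ∈ V i, ∀ v ∈ V j, inner ℝ (ι u) (ι v) = 0) : iSupIndep V := by
  intro i
  rw [Submodule.disjoint_def]
  intro x hx hx'
  have key : ∀ y ∈ ⨆ j, ⨆ (_ : j ≠ i), V j, inner ℝ (ι x) (ι y) = 0 := by
    have hle : (⨆ j, ⨆ (_ : j ≠ i), V j) ≤ LinearMap.ker ((innerₗ H (ι x)).comp ι) :=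
      iSup_le fun j => iSup_le fun hj v hv => h i j (Ne.symm hj) x hx v hv
    exact fun y hy => hle hy
  exact IsOrthProjVia.eq_zero_of_inner_self hι (key x hx')

theorem finrank_iSup_eq_sum {J : Type*} [Fintype J] {V : J → Submodule ℝ X}
    (hV : iSupIndep V) [∀ j, FiniteDimensional ℝ (V j)] :
    Module.finrank ℝ (⨆ j, V j : Submodule ℝ X) = ∑ j, Module.finrank ℝ (V j) := by
  classical
  rw [Submodule.iSup_eq_range_dfinsupp_lsum,
    LinearMap.finrank_range_of_inj hV.dfinsupp_lsum_injective,
    (DFinsupp.linearEquivFunOnFintype (R := ℝ) (M := fun j => V j)).finrank_eq,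
    Module.finrank_pi_fintype]

/-- Distinct eigenspaces are orthogonal, so the sum of their projections is the projection onto their
sum. -/
theorem isOrthProjVia_sum {J : Type*} [Fintype J] {ev : J → ℝ} (hev : Function.Injective ev)
    (hA : A.IsSymmVia ι) {P : J → X →L[ℝ] X} (hP : ∀ j, IsOrthProjVia ι (A.kerSub (ev j)) (P j)) :
    IsOrthProjVia ι (⨆ j, A.kerSub (ev j)) (∑ j, P j) := by
  classical
  have happ : ∀ x, (∑ j, P j) x = ∑ j, P j x := fun x => by simp
  refine ⟨fun x => ?_, fun x v hv => ?_⟩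
  · rw [happ]
    exact Submodule.sum_mem _ fun j _ => Submodule.mem_iSup_of_mem j ((hP j).mem x)
  · have hle : (⨆ j, A.kerSub (ev j)) ≤
        LinearMap.ker ((innerₗ H (ι (x - (∑ j, P j) x))).comp ι) := by
      refine iSup_le fun j v hv => ?_
      change inner ℝ (ι (x - (∑ j, P j) x)) (ι v) = 0
      have e : x - (∑ j, P j) x = (x - P j x) - ∑ i ∈ Finset.univ.erase j, P i x := by
        rw [happ, ← Finset.add_sum_erase _ _ (Finset.mem_univ j)]
        abel
      rw [e, _root_.map_sub, inner_sub_left, (hP j).inner_eq x v hv, map_sum, sum_inner,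
        Finset.sum_eq_zero, sub_zero]
      intro i hi
      exact inner_eq_zero_of_mem_kerSub hA (hev.ne (Finset.ne_of_mem_erase hi)) ((hP i).mem x) hv
    exact hle hv

theorem iSup_kerSub_invariant {J : Type*} (ev : J → ℝ) :
    ∀ v ∈ ⨆ j, A.kerSub (ev j), ∃ h : v ∈ A.domain, A ⟨v, h⟩ ∈ ⨆ j, A.kerSub (ev j) := by
  intro v hv
  have hle : (⨆ j, A.kerSub (ev j)) ≤
      (Submodule.comap A.toFun (⨆ j, A.kerSub (ev j))).map A.domain.subtype := by
    refine iSup_le fun j v hv => ?_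
    obtain ⟨h, hm⟩ := A.kerSub_invariant (ev j) v hv
    exact ⟨⟨v, h⟩, Submodule.mem_iSup_of_mem j hm, rfl⟩
  obtain ⟨⟨w, hw⟩, hm, rfl⟩ := hle hv
  exact ⟨hw, hm⟩

theorem ofReal_mem_complexSpectrum_shift {μ : ℝ} (hμ : A.IsEigenvalue μ) (δ : ℝ) :
    ((μ + δ : ℝ) : ℂ) ∈ (A.shift δ).complexSpectrum := by
  rintro ⟨R, hR⟩
  obtain ⟨J, hJ, -⟩ := hR.exists_real
  obtain ⟨v, ⟨hv, e⟩, hv0⟩ := (Submodule.ne_bot_iff _).1 hμ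
  have h1 := hJ.2 ⟨v, hv⟩
  have e2 : A.shift δ ⟨v, hv⟩ = δ • v + A ⟨v, hv⟩ := rfl
  have e3 : (μ + δ) • v - A.shift δ ⟨v, hv⟩ = 0 := by rw [e2, e]; module
  change J ((μ + δ) • v - A.shift δ ⟨v, hv⟩) = v at h1
  rw [e3, _root_.map_zero] at h1
  exact hv0 h1.symm

theorem exists_shift_apply_eq {δ : ℝ} (h : (0 : ℂ) ∉ (A.shift δ).complexSpectrum) (y : X) :
    ∃ v : A.domain, A v + δ • (v : X) = y := by
  obtain ⟨R, hR⟩ := not_not.1 h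
  obtain ⟨J, hJ, -⟩ := IsResolventAt.exists_real (r := 0) (by simpa using hR)
  obtain ⟨hd, e⟩ := hJ.1 (-y)
  refine ⟨⟨J (-y), hd⟩, ?_⟩
  have e2 : A.shift δ ⟨J (-y), hd⟩ = δ • J (-y) + A ⟨J (-y), hd⟩ := rfl
  rw [e2] at e
  linear_combination (norm := module) -e

end LinearPMap

namespace LinearPMap
variable {X H : Type*} [NormedAddCommGroup X] [NormedSpace ℝ X] [CompleteSpace X]
  [NormedAddCommGroup H] [InnerProductSpace ℝ H] {ι : X →ₗ[ℝ] H} {A : X →ₗ.[ℝ] X}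

/-! ### The semigroup and its spectral splitting -/

/-- Let `ev` list the eigenvalues `≤ b` of `A`. Adding a large multiple of the projection onto the
sum of their eigenspaces pushes them to the right of `b`, so that the perturbed operator generates
a semigroup of decay `e^{-b t}`; this semigroup agrees with `e^{-t A}` on the kernel of the
projection. -/
theorem exists_semigroup_splitting (hsect : A.complexify.IsSectorial) {ρ : ℝ} {J : X →L[ℝ] X}
    (hJ : A.IsResolventAt ρ J) (hc : IsCompactOperator J) (hA : A.IsSymmVia ι)
    (hι : Function.Injective ι) {I : Type*} [Fintype I] {ev : I → ℝ}
    (hev : Function.Injective ev) {P : I → X →L[ℝ] X}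
    (hP : ∀ i, IsOrthProjVia ι (A.kerSub (ev i)) (P i)) {b : ℝ}
    (hb : ∀ μ, A.IsEigenvalue μ → μ ≤ b → ∃ i, ev i = μ) :
    ∃ (S : ℝ → X →L[ℝ] X) (K : ℝ), 0 ≤ K ∧ A.GeneratesSemigroup S ∧
      (∀ t, 0 ≤ t → ∀ i, ∀ v ∈ A.kerSub (ev i), S t v = Real.exp (-ev i * t) • v) ∧
      (∀ t, 0 ≤ t → ∀ i x, P i (S t x) = Real.exp (-ev i * t) • P i x) ∧
      (∀ t, 0 ≤ t → ∀ x, (∑ i, P i) x = 0 → ‖S t x‖ ≤ K * Real.exp (-b * t) * ‖x‖) ∧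
      ∀ t, 0 < t → ∀ x, (∑ i, P i) x = 0 → ∃ h : S t x ∈ A.domain,
        HasDerivAt (fun s => S s x) (-A ⟨S t x, h⟩) t ∧
          ‖A ⟨S t x, h⟩ - b • S t x‖ ≤ K * Real.exp (-b * t) / t * ‖x‖ := by
  classical
  obtain ⟨Q, hQ⟩ : ∃ Q : X →L[ℝ] X, Q = ∑ i, P i := ⟨_, rfl⟩
  rw [← hQ]
  have hQapp : ∀ x, Q x = ∑ i, P i x := fun x => by rw [hQ]; simp
  have hQP : IsOrthProjVia ι (⨆ i, A.kerSub (ev i)) Q := hQ ▸ isOrthProjVia_sum hev hA hP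
  have hQcomm := hQP.map_comm hA hι (iSup_kerSub_invariant ev)
  have hQmem : ∀ i, ∀ v ∈ A.kerSub (ev i), Q v = v := fun i v hv =>
    hQP.apply_of_mem hι (Submodule.mem_iSup_of_mem i hv)
  have hPQ : ∀ i x, P i (Q x) = P i x := fun i x => by
    have h0 : P i (x - Q x) = 0 := (hP i).apply_eq_zero_of_orth hι fun v hv =>
      hQP.inner_eq x v (Submodule.mem_iSup_of_mem i hv)
    rw [_root_.map_sub, sub_eq_zero] at h0
    exact h0.symm
  have hPA : ∀ i (x : A.domain), P i (A x) = ev i • P i x := fun i x => by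
    obtain ⟨hd, e⟩ := (hP i).map_comm hA hι (A.kerSub_invariant (ev i)) x
    obtain ⟨hd', e'⟩ := (hP i).mem x
    rw [← e, e']
  -- On the eigenspaces `A + κ Q` acts as `ev i + κ`, which has to exceed `b`.
  obtain ⟨κ, hκ⟩ : ∃ κ : ℝ, ∀ i, b < ev i + κ := by
    refine ⟨b + 1 + ∑ i, |ev i|, fun i => ?_⟩
    have h1 := Finset.single_le_sum (f := fun i => |ev i|) (fun i _ => abs_nonneg _)
      (Finset.mem_univ i)
    have h2 := neg_abs_le (ev i)
    linarith
  have hBs : (((κ • Q : X →L[ℝ] X) : X →ₗ[ℝ] X) +ᵥ A).IsSymmVia ι := by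
    refine IsSymmVia.vadd_continuousLinearMap hA fun x y => ?_
    simp only [_root_.smul_apply, _root_.map_smul, inner_smul_left, inner_smul_right,
      conj_trivial, hQP.inner_apply x y]
  have hPB : ∀ i (x : (((κ • Q : X →L[ℝ] X) : X →ₗ[ℝ] X) +ᵥ A).domain),
      P i ((((κ • Q : X →L[ℝ] X) : X →ₗ[ℝ] X) +ᵥ A) x) = (ev i + κ) • P i x := fun i x => by
    change P i (κ • Q x + A ⟨x, x.2⟩) = _
    rw [_root_.map_add, _root_.map_smul, hPQ, hPA i ⟨x, x.2⟩]
    module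
  obtain ⟨M, hM⟩ := exists_halfPlane_bound_vadd hsect hJ hc (κ • Q) b fun z hz p hp => by
    by_contra hne
    obtain ⟨-, v, ⟨hv, e⟩, hv0⟩ := exists_real_eigenvector hBs hι p hp hne
    -- An eigenvector of `A + κ Q` left of `b` is orthogonal to all `ker (ev i - A)`, hence it is an
    -- eigenvector of `A` and belongs to one of them, which is absurd.
    have h1 : ∀ i, P i v = 0 := fun i => by
      have h2 := hPB i ⟨v, hv⟩
      rw [e, _root_.map_smul] at h2
      have h3 : (ev i + κ - z.re) • P i v = 0 := by linear_combination (norm := module) -h2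
      exact (smul_eq_zero.1 h3).resolve_left (by linarith [hκ i])
    have hQv : Q v = 0 := by rw [hQapp]; exact Finset.sum_eq_zero fun i _ => h1 i
    have hAv : A ⟨v, hv⟩ = z.re • v := by
      change κ • Q v + A ⟨v, hv⟩ = z.re • v at e
      rwa [hQv, smul_zero, zero_add] at e
    have hmem : v ∈ A.kerSub z.re := ⟨hv, hAv⟩
    obtain ⟨i, hi⟩ := hb z.re ((Submodule.ne_bot_iff _).2 ⟨v, hmem, hv0⟩) hz
    rw [← hi] at hmem
    exact hv0 ((hQmem i v hmem).symm.trans hQv)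
  obtain ⟨T, K, hT⟩ := exists_isAnalyticSemigroup
    (B := ((κ • Q : X →L[ℝ] X) : X →ₗ[ℝ] X) +ᵥ A) (dense_domain_of_complexify hsect.2.1) hM
  have hK : 0 ≤ K := by
    have := hT.norm_le 0 le_rfl
    rw [mul_zero, Real.exp_zero, mul_one] at this
    exact (norm_nonneg _).trans this
  have hPT : ∀ t, 0 ≤ t → ∀ i x, P i (T t x) = Real.exp (-(ev i + κ) * t) • P i x :=
    fun t ht i x => hT.map_apply (hPB i) ht x
  have hTv : ∀ t, 0 ≤ t → ∀ i, ∀ v ∈ A.kerSub (ev i), T t v = Real.exp (-(ev i + κ) * t) • v := by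
    intro t ht i v hv
    refine hT.apply_of_mem_kerSub ?_ ht
    have hQv := hQmem i v hv
    obtain ⟨hd, e⟩ := hv
    refine ⟨hd, ?_⟩
    change κ • Q v + A ⟨v, hd⟩ = _
    rw [hQv, e]; module
  have hcomm : ∀ t, 0 ≤ t → ∀ x, Q (T t x) = T t (Q x) := fun t ht x => by
    rw [hQapp, hQapp, map_sum]
    exact Finset.sum_congr rfl fun i _ => by rw [hPT t ht, hTv t ht i _ ((hP i).mem x)]
  have hgen := hT.of_vadd_smul_projection (hQP.apply_apply hι) hcomm
  obtain ⟨S, hS⟩ : ∃ S : ℝ → X →L[ℝ] X, S = fun t => (T t).comp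
    (ContinuousLinearMap.id ℝ X + (Real.exp (κ * t) - 1) • Q) := ⟨_, rfl⟩
  rw [← hS] at hgen
  have happ : ∀ t x, S t x = T t x + (Real.exp (κ * t) - 1) • T t (Q x) := fun t x => by
    rw [hS]
    change T t (x + (Real.exp (κ * t) - 1) • Q x) = _
    rw [_root_.map_add, _root_.map_smul]
  have hST : ∀ t x, Q x = 0 → S t x = T t x := fun t x hx => by
    rw [happ, hx, _root_.map_zero, smul_zero, add_zero]
  have hexp : ∀ t i, Real.exp (-(ev i + κ) * t) + (Real.exp (κ * t) - 1) *
      Real.exp (-(ev i + κ) * t) = Real.exp (-ev i * t) := fun t i => by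
    rw [sub_mul, one_mul, add_sub_cancel, ← Real.exp_add]
    congr 1; ring
  refine ⟨S, K, hK, hgen, fun t ht i v hv => ?_, fun t ht i x => ?_, fun t ht x hx => ?_,
    fun t ht x hx => ?_⟩
  · rw [happ, hQmem i v hv, hTv t ht i v hv, smul_smul, ← add_smul, hexp]
  · rw [happ, _root_.map_add, _root_.map_smul, hPT t ht, hPT t ht, hPQ, smul_smul, ← add_smul, hexp]
  · rw [hST t x hx]
    refine ((T t).le_opNorm x).trans ?_
    gcongr
    exact hT.norm_le t ht
  · obtain ⟨h, h1, h2⟩ := hT.smoothing t ht x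
    have h3 : ∀ hd : T t x ∈ A.domain,
        (((κ • Q : X →L[ℝ] X) : X →ₗ[ℝ] X) +ᵥ A) ⟨T t x, h⟩ = A ⟨T t x, hd⟩ := fun hd => by
      change κ • Q (T t x) + A ⟨T t x, hd⟩ = _
      rw [hcomm t ht.le, hx, _root_.map_zero, smul_zero, zero_add]
    have h4 : (fun s => S s x) = fun s => T s x := funext fun s => hST s x hx
    have h5 : S t x = T t x := hST t x hx
    rw [h4]
    simp only [h5]
    refine ⟨h, ?_, ?_⟩
    · rw [← h3 h]; exact h1
    · rw [← h3 h]; exact h2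

/-! ### Fractional powers on the stable part -/

/-- On the domain of `A`, `A_δ ^ α v = Γ(1 - α)⁻¹ ∫ s^{-α} e^{-δ s} S s (A_δ v) ds`. -/
theorem GeneratesSemigroup.exists_fracPow_shift_apply_eq {S : ℝ → X →L[ℝ] X} {δ ω C : ℝ}
    (hS : A.GeneratesSemigroup S) (hdiff : ∀ t, 0 < t → ∀ x, DifferentiableAt ℝ (fun s => S s x) t)
    (hC : ∀ t, 0 ≤ t → ‖S t‖ ≤ C * Real.exp (-ω * t)) (hω : 0 < ω + δ)
    (h0 : (0 : ℂ) ∉ (A.shift δ).complexSpectrum) {α : ℝ} (hα0 : 0 < α) (hα1 : α < 1)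
    (v : A.domain) :
    ∃ h : (v : X) ∈ (fracPow (fun s => Real.exp (-δ * s) • S s) α).domain,
      fracPow (fun s => Real.exp (-δ * s) • S s) α ⟨v, h⟩ = (Real.Gamma (1 - α))⁻¹ •
        ∫ s in Set.Ioi (0 : ℝ), s ^ (-α) • Real.exp (-δ * s) • S s (A v + δ • (v : X)) := by
  have hexp : ∀ s, HasDerivAt (fun s : ℝ => Real.exp (-δ * s)) (Real.exp (-δ * s) * -δ) s :=
    fun s => by simpa using ((hasDerivAt_id s).const_mul (-δ)).exp
  have hbd : ∀ t, 0 ≤ t → ‖Real.exp (-δ * t) • S t‖ ≤ C * Real.exp (-(ω + δ) * t) :=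
    fun t ht => by
      rw [norm_smul, Real.norm_of_nonneg (Real.exp_pos _).le]
      calc _ ≤ Real.exp (-δ * t) * (C * Real.exp (-ω * t)) := by gcongr; exact hC t ht
        _ = C * (Real.exp (-δ * t) * Real.exp (-ω * t)) := by ring
        _ = _ := by rw [← Real.exp_add]; congr 2; ring
  have hcont : ∀ x, ContinuousOn (fun t => (Real.exp (-δ * t) • S t) x) (Set.Ioi 0) :=
    fun x t ht => ((hexp t).continuousAt.smul (hdiff t ht x).continuousAt).continuousWithinAt
  -- The fundamental theorem of calculus for `-e^{-δ t} S t v`.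
  have hint : ∀ v : A.domain, ∫ u in Set.Ioi (0 : ℝ),
      (Real.exp (-δ * u) • S u) (A v + δ • (v : X)) = v := fun v => by
    have hder : ∀ t ∈ Set.Ioi (0 : ℝ), HasDerivAt (fun u => -(Real.exp (-δ * u) • S u (v : X)))
        ((Real.exp (-δ * t) • S t) (A v + δ • (v : X))) t := fun t ht => by
      refine ((hexp t).smul (hS.hasDerivAt (le_of_lt ht) v (hdiff t ht v))).neg.congr_deriv ?_
      rw [_root_.smul_apply, _root_.map_add, _root_.map_smul]
      module
    have hzero : ContinuousWithinAt (fun u => -(Real.exp (-δ * u) • S u (v : X)))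
        (Set.Ici 0) 0 := by
      refine continuousWithinAt_Ioi_iff_Ici.1 ?_
      have h2 : S 0 (v : X) = v := by rw [hS.map_zero]; rfl
      have h3 := hS.strongly_continuous v
      rw [← h2] at h3
      exact ((hexp 0).continuousAt.continuousWithinAt.smul (f := fun u => Real.exp (-δ * u))
        (g := fun u => S u (v : X)) (by simpa only [ContinuousWithinAt, h2] using h3)).neg
    have htop : Tendsto (fun u => -(Real.exp (-δ * u) • S u (v : X))) atTop (𝓝 0) := by
      have h2 : Tendsto (fun u : ℝ => C * Real.exp (-(ω + δ) * u) * ‖(v : X)‖) atTop (𝓝 0) := by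
        have h3 : Tendsto (fun u : ℝ => -(ω + δ) * u) atTop atBot :=
          tendsto_id.const_mul_atTop_of_neg (by linarith)
        simpa using ((Real.tendsto_exp_atBot.comp h3).const_mul C).mul_const ‖(v : X)‖
      refine squeeze_zero_norm' ?_ h2
      filter_upwards [eventually_ge_atTop 0] with u hu
      rw [norm_neg]
      refine ((Real.exp (-δ * u) • S u).le_opNorm (v : X)).trans ?_
      gcongr
      exact hbd u hu
    have hi : IntegrableOn (fun u => (Real.exp (-δ * u) • S u) (A v + δ • (v : X)))
        (Set.Ioi 0) :=
      integrableOn_of_le_exp (hcont _) hω (K := C * ‖A v + δ • (v : X)‖) fun t ht => by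
        refine ((Real.exp (-δ * t) • S t).le_opNorm _).trans ?_
        calc _ ≤ (C * Real.exp (-(ω + δ) * t)) * ‖A v + δ • (v : X)‖ := by
              gcongr; exact hbd t (le_of_lt ht)
          _ = _ := by ring
    have := integral_Ioi_of_hasDerivAt_of_tendsto hzero hder hi htop
    rw [this, mul_zero, Real.exp_zero, one_smul, hS.map_zero]
    simp
  refine exists_fracPow_apply_eq (T := fun s => Real.exp (-δ * s) • S s) (K := C) hω hcont
    (fun t ht => hbd t (le_of_lt ht)) (fun s t hs ht x => ?_) (fun y hy => ?_) hα0 hα1 (hint v)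
  · have h1 : S (s + t) x = S s (S t x) :=
      congrArg (fun T => T x) (hS.map_add s t (le_of_lt hs) (le_of_lt ht))
    simp only [_root_.smul_apply, _root_.map_smul]
    rw [h1, smul_smul, ← Real.exp_add]
    congr 2; ring
  · obtain ⟨w, rfl⟩ := exists_shift_apply_eq h0 y
    have h1 : w = 0 := Subtype.ext ((hint w).symm.trans hy)
    rw [h1, A.map_zero]; simp

/-- A bound `K e^{-b r} / r` for `A_δ S r x` interpolates to a bound `K Γ(α) e^{-b t} t^{-α}` for
`A_δ ^ α S t x`. -/
theorem GeneratesSemigroup.exists_norm_fracPow_shift_le {S : ℝ → X →L[ℝ] X} {δ ω C b K : ℝ}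
    (hS : A.GeneratesSemigroup S) (hdiff : ∀ t, 0 < t → ∀ x, DifferentiableAt ℝ (fun s => S s x) t)
    (hC : ∀ t, 0 ≤ t → ‖S t‖ ≤ C * Real.exp (-ω * t)) (hω : 0 < ω + δ)
    (h0 : (0 : ℂ) ∉ (A.shift δ).complexSpectrum) {α : ℝ} (hα0 : 0 < α) (hα1 : α < 1)
    (hb : 0 ≤ b + δ) {x : X} (hx : ∀ r, 0 < r → ∃ h : S r x ∈ A.domain,
      ‖A ⟨S r x, h⟩ + δ • S r x‖ ≤ K * Real.exp (-b * r) / r) {t : ℝ} (ht : 0 < t) :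
    ∃ h : S t x ∈ (fracPow (fun s => Real.exp (-δ * s) • S s) α).domain,
      ‖fracPow (fun s => Real.exp (-δ * s) • S s) α ⟨S t x, h⟩‖
        ≤ K * Real.Gamma α * Real.exp (-b * t) * t ^ (-α) := by
  obtain ⟨hd, hK⟩ := hx t ht
  have hK0 : 0 ≤ K := by
    have h1 := (norm_nonneg _).trans hK
    rw [mul_div_assoc] at h1
    exact nonneg_of_mul_nonneg_left h1 (by positivity)
  obtain ⟨h, e⟩ := hS.exists_fracPow_shift_apply_eq hdiff hC hω h0 hα0 hα1 ⟨S t x, hd⟩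
  refine ⟨h, ?_⟩
  rw [e, norm_smul, Real.norm_of_nonneg (by
    have := Real.Gamma_pos_of_pos (by linarith : 0 < 1 - α); positivity)]
  have h1 := norm_integral_rpow_smul_le (t := t) (C := K * Real.exp (-b * t)) hα0 hα1 ht
    (F := fun s => Real.exp (-δ * s) • S s (A ⟨S t x, hd⟩ + δ • S t x)) fun s hs => by
    obtain ⟨hd2, hK2⟩ := hx (s + t) (by linarith)
    obtain ⟨hd1, e1⟩ := hS.apply_comm hs.le ⟨S t x, hd⟩
    have e2 : S (s + t) x = S s (S t x) :=
      congrArg (fun T => T x) (hS.map_add s t hs.le ht.le)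
    simp only [e2] at hK2
    rw [e1] at hK2
    have hG : Real.exp (-δ * s) * Real.exp (-b * (s + t)) ≤ Real.exp (-b * t) := by
      rw [← Real.exp_add]
      apply Real.exp_le_exp.2
      nlinarith
    rw [norm_smul, Real.norm_of_nonneg (Real.exp_pos _).le, _root_.map_add, _root_.map_smul]
    calc _ ≤ Real.exp (-δ * s) * (K * Real.exp (-b * (s + t)) / (s + t)) := by gcongr
      _ = K * (Real.exp (-δ * s) * Real.exp (-b * (s + t))) * (s + t)⁻¹ := by ring
      _ ≤ _ := by gcongr
  have hG : Real.Gamma (1 - α) ≠ 0 := (Real.Gamma_pos_of_pos (by linarith)).ne'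
  calc _ ≤ (Real.Gamma (1 - α))⁻¹ * (K * Real.exp (-b * t) *
        (Real.Gamma α * Real.Gamma (1 - α)) * t ^ (-α)) := by
        gcongr
    _ = _ := by field_simp

end LinearPMap

/-! ### The decomposition -/

theorem Set.Finite.exists_strictMono_fin {s : Set ℝ} (hs : s.Finite) {l : ℝ} (hl : l ∈ s)
    (hmax : ∀ x ∈ s, x ≤ l) :
    ∃ (m : ℕ) (f : Fin (m + 1) → ℝ), StrictMono f ∧ f (Fin.last m) = l ∧ Set.range f = s := by
  obtain ⟨F, rfl⟩ := hs.exists_finset_coe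
  have hl' : l ∈ F := by simpa using hl
  obtain ⟨m, hm⟩ : ∃ m, F.card = m + 1 :=
    Nat.exists_eq_succ_of_ne_zero (Finset.card_ne_zero_of_mem hl')
  refine ⟨m, F.orderEmbOfFin hm, (F.orderEmbOfFin hm).strictMono, ?_, F.range_orderEmbOfFin hm⟩
  have hr : l ∈ Set.range (F.orderEmbOfFin hm) := by rw [F.range_orderEmbOfFin hm]; exact hl
  obtain ⟨i, hi⟩ := hr
  refine le_antisymm (hmax _ (F.orderEmbOfFin_mem hm _)) ?_
  rw [← hi]
  exact (F.orderEmbOfFin hm).monotone (Fin.le_last i)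

theorem mainTheorem7
    {X : Type*} [NormedAddCommGroup X] [NormedSpace ℝ X] [CompleteSpace X]
    {H : Type*} [NormedAddCommGroup H] [InnerProductSpace ℝ H] [CompleteSpace H]
    (A : X →ₗ.[ℝ] X)
    (hsect : A.complexify.IsSectorial)
    (hA1 : ∀ (ρ : ℝ) (R : X →L[ℝ] X), A.IsResolventAt ρ R → IsCompactOperator R)
    (ι : X →ₗ[ℝ] H) (hA2 : Function.Injective ι)
    (Ahat : H →ₗ.[ℝ] H) (hAhat : IsSelfAdjoint Ahat)
    (hA3 : ∀ x : A.domain, (ι (x : X), ι (A x)) ∈ Ahat.graph)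
    (lam : ℝ) (hlam : A.IsEigenvalue lam) :
    ∃ S : ℝ → X →L[ℝ] X, A.GeneratesSemigroup S ∧
    -- `ev 0 < ... < ev m = lam` are the eigenvalues `≤ lam`, i.e. `λ₁ < ... < λ_k`, `k = m + 1`
    ∃ (m : ℕ) (ev : Fin (m + 1) → ℝ), StrictMono ev ∧ ev (Fin.last m) = lam ∧
      Set.range ev = {μ : ℝ | A.IsEigenvalue μ ∧ μ ≤ lam} ∧
    ∃ Xp Xm X0 : Submodule ℝ X,
      IsClosed (Xp : Set X) ∧ IsClosed (Xm : Set X) ∧ IsClosed (X0 : Set X) ∧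
      DirectSum.IsInternal ![Xp, Xm, X0] ∧
      (∀ t : ℝ, 0 ≤ t →
        (∀ x ∈ Xp, S t x ∈ Xp) ∧ (∀ x ∈ Xm, S t x ∈ Xm) ∧ (∀ x ∈ X0, S t x ∈ X0)) ∧
      -- (i)
      X0 = A.kerSub lam ∧
      FiniteDimensional ℝ Xm ∧
      iSupIndep (fun i : Fin m => A.kerSub (ev i.castSucc)) ∧
      Xm = ⨆ i : Fin m, A.kerSub (ev i.castSucc) ∧
      Module.finrank ℝ Xm = ∑ i : Fin m, Module.finrank ℝ (A.kerSub (ev i.castSucc)) ∧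
      -- (ii); `Am` is the part of `A` in `Xm`, and `S t = exp (-t Am)` on `Xm`
      (∃ Am : Xm →L[ℝ] Xm,
        (∀ x : Xm, ((x : X), ((Am x : Xm) : X)) ∈ A.graph) ∧
        (∀ t : ℝ, 0 ≤ t → ∀ x : Xm, S t (x : X) = ((expNeg Am t x : Xm) : X)) ∧
        ∀ δ : ℝ, 0 ≤ δ → (∀ z ∈ (A.shift δ).complexSpectrum, 0 < z.re) →
        ∀ α : ℝ, 0 ≤ α → α < 1 →
        ∃ c K : ℝ, 0 < c ∧ 0 < K ∧
          (∀ x ∈ Xp, ∀ t : ℝ, 0 < t →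
            ∃ h : S t x ∈ (fracPow (fun s => Real.exp (-δ * s) • S s) α).domain,
              ‖fracPow (fun s => Real.exp (-δ * s) • S s) α ⟨S t x, h⟩‖
                ≤ K * Real.exp (-(lam + c) * t) * t ^ (-α) * ‖x‖) ∧
          (∀ x ∈ Xp, ∀ t : ℝ, 0 ≤ t →
            ‖Real.exp (lam * t) • S t x‖ ≤ K * Real.exp (-c * t) * ‖x‖) ∧
          (∀ x : Xm, ∀ t : ℝ, t ≤ 0 →
            ‖Real.exp (lam * t) • expNeg Am t x‖
              ≤ K * Real.exp (c * t) * ‖x‖)) ∧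
      -- (iii)
      (∀ u ∈ Xp, ∀ v ∈ Xm, inner ℝ (ι u) (ι v) = 0) ∧
      (∀ u ∈ Xp, ∀ v ∈ X0, inner ℝ (ι u) (ι v) = 0) ∧
      (∀ u ∈ Xm, ∀ v ∈ X0, inner ℝ (ι u) (ι v) = 0) := by
  classical
  have hA : A.IsSymmVia ι := LinearPMap.isSymmVia_of_isSelfAdjoint hAhat hA3
  obtain ⟨a, hres, hlow⟩ := LinearPMap.exists_real_resolvent_of_isSectorial hsect
  obtain ⟨J, hJ⟩ := hres (a - 1) (by linarith)
  have hc := hA1 _ J hJ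
  obtain ⟨m, ev, hmono, hlast, hrange⟩ :=
    (hJ.finite_eigenvalues hc hA hA2 hlow lam).exists_strictMono_fin ⟨hlam, le_rfl⟩
      fun x hx => hx.2
  choose P hP using fun i => hJ.exists_isOrthProjVia hc hA hA2 (ev i)
  obtain ⟨ε, hε, hgap⟩ := hJ.exists_eigenvalue_gap hc hA hA2 lam
  -- On `Xp` the decay rate is `lam + 2 c`: one `c` absorbs a factor `t`, the other one remains.
  obtain ⟨c, rfl⟩ : ∃ c, ε = 3 * c := ⟨ε / 3, by ring⟩
  have hc0 : 0 < c := by linarith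
  obtain ⟨S, K, hK0, hS, hSker, hPS, hdecay, hsmooth⟩ :=
    LinearPMap.exists_semigroup_splitting hsect hJ hc hA hA2 hmono.injective hP (b := lam + 2 * c)
      fun μ hμ hle => by
        have h1 : μ ≤ lam := by
          by_contra! hlt
          have := hgap μ hμ hlt.ne'
          rw [abs_of_pos (by linarith)] at this
          linarith
        have h2 : μ ∈ Set.range ev := by rw [hrange]; exact ⟨hμ, h1⟩
        exact h2
  refine ⟨S, hS, m, ev, hmono, hlast, hrange, ?_⟩
  have hle : ∀ i, ev i ≤ lam := fun i => hlast ▸ hmono.monotone (Fin.le_last i)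
  have hfd : ∀ μ, FiniteDimensional ℝ (A.kerSub μ) := hJ.finiteDimensional_kerSub hc
  have hmono' : Function.Injective fun i : Fin m => ev i.castSucc :=
    hmono.injective.comp (Fin.castSucc_injective m)
  have hevlt : ∀ i : Fin m, ev i.castSucc ≠ lam := fun i =>
    hlast ▸ (hmono (Fin.castSucc_lt_last i)).ne
  -- `Q` projects onto the sum of all listed eigenspaces, `Q'` omits that of `lam`.
  obtain ⟨Q, hQdef⟩ : ∃ Q : X →L[ℝ] X, Q = ∑ i, P i := ⟨_, rfl⟩
  obtain ⟨Q', hQ'def⟩ : ∃ Q' : X →L[ℝ] X, Q' = ∑ i : Fin m, P i.castSucc := ⟨_, rfl⟩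
  have hQapp : ∀ x, Q x = ∑ i, P i x := fun x => by rw [hQdef]; simp
  have hQ'app : ∀ x, Q' x = ∑ i : Fin m, P i.castSucc x := fun x => by rw [hQ'def]; simp
  have hQQ' : ∀ x, Q x = Q' x + P (Fin.last m) x := fun x => by
    rw [hQapp, hQ'app, Fin.sum_univ_castSucc]
  have hQ : IsOrthProjVia ι (⨆ i, A.kerSub (ev i)) Q :=
    hQdef ▸ LinearPMap.isOrthProjVia_sum hmono.injective hA hP
  have hQ' : IsOrthProjVia ι (⨆ i : Fin m, A.kerSub (ev i.castSucc)) Q' :=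
    hQ'def ▸ LinearPMap.isOrthProjVia_sum hmono' hA fun i => hP i.castSucc
  rw [← hQdef] at hdecay hsmooth
  have hPp : ∀ x, Q x = 0 → ∀ i, P i x = 0 := fun x hx i => by
    refine (hP i).apply_eq_zero_of_orth hA2 fun v hv => ?_
    have := hQ.inner_eq x v (Submodule.mem_iSup_of_mem i hv)
    rwa [hx, sub_zero] at this
  have hker : ∀ x, Q (x - Q x) = 0 := fun x => by
    rw [map_sub, hQ.apply_apply hA2, sub_self]
  -- The explicit form of the semigroup, which gives its regularity and global growth.
  have hSform : ∀ t, 0 ≤ t → ∀ x,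
      S t x = S t (x - Q x) + ∑ i, Real.exp (-ev i * t) • P i x := fun t ht x => by
    have h1 : S t (Q x) = ∑ i, Real.exp (-ev i * t) • P i x := by
      rw [hQapp, map_sum]
      exact Finset.sum_congr rfl fun i _ => hSker t ht i _ ((hP i).mem x)
    rw [← h1, ← map_add, sub_add_cancel]
  have hdiff : ∀ t, 0 < t → ∀ x, DifferentiableAt ℝ (fun s => S s x) t := fun t ht x => by
    obtain ⟨hd, h1, -⟩ := hsmooth t ht (x - Q x) (hker x)
    have h2 : DifferentiableAt ℝ (fun s => ∑ i, Real.exp (-ev i * s) • P i x) t := by fun_prop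
    refine (h1.differentiableAt.add h2).congr_of_eventuallyEq ?_
    filter_upwards [lt_mem_nhds ht] with s hs
    exact hSform s hs.le x
  obtain ⟨C, hC⟩ : ∃ C, ∀ t, 0 ≤ t → ‖S t‖ ≤ C * Real.exp (-ev 0 * t) := by
    refine ⟨K * ‖ContinuousLinearMap.id ℝ X - Q‖ + ∑ i, ‖P i‖, fun t ht => ?_⟩
    refine ContinuousLinearMap.opNorm_le_bound _ (by positivity) fun x => ?_
    have h1 : ‖S t (x - Q x)‖ ≤ K * Real.exp (-ev 0 * t) *
        (‖ContinuousLinearMap.id ℝ X - Q‖ * ‖x‖) := by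
      refine (hdecay t ht _ (hker x)).trans ?_
      gcongr
      · linarith [hle 0]
      · exact (ContinuousLinearMap.id ℝ X - Q).le_opNorm x
    have h2 : ‖∑ i, Real.exp (-ev i * t) • P i x‖ ≤
        ∑ i, Real.exp (-ev 0 * t) * (‖P i‖ * ‖x‖) := by
      refine norm_sum_le_of_le _ fun i _ => ?_
      rw [norm_smul, Real.norm_of_nonneg (Real.exp_pos _).le]
      gcongr
      · exact hmono.monotone (Fin.zero_le i)
      · exact (P i).le_opNorm x
    rw [hSform t ht x]
    refine (norm_add_le _ _).trans ((add_le_add h1 h2).trans_eq ?_)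
    rw [← Finset.mul_sum, ← Finset.sum_mul]
    ring
  have hinv : ∀ t, 0 ≤ t → ∀ i, ∀ v ∈ A.kerSub (ev i), S t v ∈ A.kerSub (ev i) :=
    fun t ht i v hv => by
      rw [hSker t ht i v hv]; exact Submodule.smul_mem _ _ hv
  -- `Xp`, `Xm`, `X0` are pairwise orthogonal.
  have horth_pm : ∀ u ∈ LinearMap.ker (Q : X →ₗ[ℝ] X),
      ∀ v ∈ ⨆ i : Fin m, A.kerSub (ev i.castSucc), inner ℝ (ι u) (ι v) = 0 := fun u hu v hv => by
    have h1 : (⨆ i : Fin m, A.kerSub (ev i.castSucc)) ≤ ⨆ i, A.kerSub (ev i) :=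
      iSup_le fun i => le_iSup (fun i => A.kerSub (ev i)) i.castSucc
    have h2 := hQ.inner_eq u v (h1 hv)
    have hu' : Q u = 0 := hu
    rwa [hu', sub_zero] at h2
  have horth_p0 : ∀ u ∈ LinearMap.ker (Q : X →ₗ[ℝ] X), ∀ v ∈ A.kerSub lam,
      inner ℝ (ι u) (ι v) = 0 := fun u hu v hv => by
    rw [← hlast] at hv
    have h2 := hQ.inner_eq u v (Submodule.mem_iSup_of_mem _ hv)
    have hu' : Q u = 0 := hu
    rwa [hu', sub_zero] at h2
  have horth_m0 : ∀ u ∈ ⨆ i : Fin m, A.kerSub (ev i.castSucc), ∀ v ∈ A.kerSub lam,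
      inner ℝ (ι u) (ι v) = 0 := fun u hu v hv => by
    have h1 : (⨆ i : Fin m, A.kerSub (ev i.castSucc)) ≤
        LinearMap.ker ((innerₗ H (ι v)).comp ι) := iSup_le fun i w hw =>
      LinearPMap.inner_eq_zero_of_mem_kerSub hA (hevlt i).symm hv hw
    rw [real_inner_comm]
    exact h1 hu
  have hindep : iSupIndep fun i : Fin m => A.kerSub (ev i.castSucc) :=
    LinearPMap.iSupIndep_of_inner_eq_zero hA2 fun i j hij u hu v hv =>
      LinearPMap.inner_eq_zero_of_mem_kerSub hA (hmono'.ne hij) hu hv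
  have hXmfd : FiniteDimensional ℝ (⨆ i : Fin m, A.kerSub (ev i.castSucc) : Submodule ℝ X) :=
    inferInstance
  refine ⟨LinearMap.ker (Q : X →ₗ[ℝ] X), ⨆ i : Fin m, A.kerSub (ev i.castSucc), A.kerSub lam,
    Q.isClosed_ker, Submodule.closed_of_finiteDimensional _, Submodule.closed_of_finiteDimensional _,
    ?_, fun t ht => ⟨fun x hx => ?_, fun x hx => ?_, ?_⟩, rfl, hXmfd, hindep, rfl,
    LinearPMap.finrank_iSup_eq_sum hindep, ?_, horth_pm, horth_p0, horth_m0⟩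
  · rw [DirectSum.isInternal_submodule_iff_iSupIndep_and_iSup_eq_top]
    constructor
    · refine LinearPMap.iSupIndep_of_inner_eq_zero hA2 fun i j hij u hu v hv => ?_
      fin_cases i <;> fin_cases j <;> first | exact absurd rfl hij | skip
      · exact horth_pm u hu v hv
      · exact horth_p0 u hu v hv
      · rw [real_inner_comm]; exact horth_pm v hv u hu
      · exact horth_m0 u hu v hv
      · rw [real_inner_comm]; exact horth_p0 v hv u hu
      · rw [real_inner_comm]; exact horth_m0 v hv u hu
    · refine eq_top_iff.2 fun x _ => ?_
      have e : x = (x - Q x) + Q' x + P (Fin.last m) x := by rw [hQQ']; abel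
      rw [e]
      refine Submodule.add_mem _ (Submodule.add_mem _ ?_ ?_) ?_
      · exact Submodule.mem_iSup_of_mem (0 : Fin 3) (hker x)
      · exact Submodule.mem_iSup_of_mem (1 : Fin 3) (hQ'.mem x)
      · refine Submodule.mem_iSup_of_mem (2 : Fin 3) ?_
        have := (hP (Fin.last m)).mem x
        rwa [hlast] at this
  · change Q (S t x) = 0
    rw [hQapp]
    exact Finset.sum_eq_zero fun i _ => by rw [hPS t ht, hPp x hx i, smul_zero]
  · have h1 : (⨆ i : Fin m, A.kerSub (ev i.castSucc)) ≤ Submodule.comap (S t : X →ₗ[ℝ] X)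
        (⨆ i : Fin m, A.kerSub (ev i.castSucc)) := iSup_le fun i v hv =>
      Submodule.mem_iSup_of_mem i (hinv t ht i.castSucc v hv)
    exact h1 hx
  · have := hinv t ht (Fin.last m)
    rwa [hlast] at this
  obtain ⟨Xm, hXm⟩ : ∃ Xm : Submodule ℝ X, Xm = ⨆ i : Fin m, A.kerSub (ev i.castSucc) := ⟨_, rfl⟩
  rw [← hXm] at hXmfd hQ' ⊢
  have hAXm := LinearPMap.iSup_kerSub_invariant (A := A) fun i : Fin m => ev i.castSucc
  rw [← hXm] at hAXm
  have hPmem : ∀ (i : Fin m) x, P i.castSucc x ∈ Xm := fun i x => by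
    rw [hXm]; exact Submodule.mem_iSup_of_mem i ((hP i.castSucc).mem x)
  choose hdom hmem using hAXm
  obtain ⟨Al, hAl⟩ : ∃ Al : Xm →ₗ[ℝ] Xm, ∀ x : Xm, ((Al x : Xm) : X) = A ⟨x, hdom x x.2⟩ := by
    refine ⟨{ toFun := fun x => ⟨A ⟨x, hdom x x.2⟩, hmem x x.2⟩
              map_add' := fun x y => Subtype.ext (A.map_add ⟨x, hdom x x.2⟩ ⟨y, hdom y y.2⟩)
              map_smul' := fun r x => Subtype.ext (A.map_smul r ⟨x, hdom x x.2⟩) }, fun x => rfl⟩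
  obtain ⟨Am, hAm⟩ : ∃ Am : Xm →L[ℝ] Xm, ∀ x : Xm, ((Am x : Xm) : X) = A ⟨x, hdom x x.2⟩ :=
    ⟨LinearMap.toContinuousLinearMap Al, hAl⟩
  have hcomplete : CompleteSpace Xm := FiniteDimensional.complete ℝ Xm
  have hexpNeg : ∀ t (x : Xm), ((expNeg Am t x : Xm) : X) =
      ∑ i : Fin m, Real.exp (-ev i.castSucc * t) • P i.castSucc x := fun t x => by
    have h1 : x = ∑ i : Fin m, (⟨P i.castSucc x, hPmem i x⟩ : Xm) := by
      refine Subtype.ext ?_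
      rw [Submodule.coe_sum, ← hQ'app]
      exact (hQ'.apply_of_mem hA2 x.2).symm
    have h2 : ∀ i : Fin m, expNeg Am t ⟨P i.castSucc x, hPmem i x⟩ =
        Real.exp (-ev i.castSucc * t) • (⟨P i.castSucc x, hPmem i x⟩ : Xm) := fun i => by
      refine expNeg_apply_of_eigenvector (Subtype.ext ?_) t
      rw [hAm]
      exact ((hP i.castSucc).mem x).2
    conv_lhs => rw [h1]
    rw [map_sum, Submodule.coe_sum]
    exact Finset.sum_congr rfl fun i _ => congrArg Subtype.val (h2 i)
  refine ⟨Am, fun x => (LinearPMap.mem_graph_iff _).2 ⟨⟨x, hdom x x.2⟩, rfl, (hAm x).symm⟩,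
    fun t ht x => ?_, fun δ hδ hspec α hα0 hα1 => ?_⟩
  · rw [hexpNeg]
    conv_lhs => rw [← hQ'.apply_of_mem hA2 x.2, hQ'app, map_sum]
    exact Finset.sum_congr rfl fun i _ => hSker t ht _ _ ((hP i.castSucc).mem x)
  -- The hypothesis on `δ` applies to the lowest eigenvalue, so `e^{-δ t} S t` decays on all of `X`.
  have hev0 : A.IsEigenvalue (ev 0) := by
    have h1 : ev 0 ∈ Set.range ev := ⟨0, rfl⟩
    rw [hrange] at h1
    exact h1.1
  have hω : 0 < ev 0 + δ := hspec _ (LinearPMap.ofReal_mem_complexSpectrum_shift hev0 δ)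
  have hlamδ : 0 < lam + δ := by linarith [hle 0]
  have h0spec : (0 : ℂ) ∉ (A.shift δ).complexSpectrum := fun h => by
    simpa using hspec 0 h
  -- `A_δ = (A - (lam + 2 c)) + (lam + 2 c + δ)`, and `e^{-c r} ≤ 1 / (c r)` bounds the second term.
  obtain ⟨L, hL⟩ : ∃ L, L = K * (1 + (lam + 2 * c + δ) / c) := ⟨_, rfl⟩
  have hL0 : 0 ≤ L := by
    rw [hL]
    have : 0 ≤ lam + 2 * c + δ := by linarith
    positivity
  have hsm : ∀ x, Q x = 0 → ∀ r, 0 < r → ∃ h : S r x ∈ A.domain,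
      ‖A ⟨S r x, h⟩ + δ • S r x‖ ≤ (L * ‖x‖) * Real.exp (-(lam + c) * r) / r := by
    intro x hx r hr
    obtain ⟨hd, -, h1⟩ := hsmooth r hr x hx
    refine ⟨hd, ?_⟩
    have h2 := hdecay r hr.le x hx
    have e1 : A ⟨S r x, hd⟩ + δ • S r x =
        (A ⟨S r x, hd⟩ - (lam + 2 * c) • S r x) + (lam + 2 * c + δ) • S r x := by module
    have hexp : Real.exp (-(lam + 2 * c) * r) ≤ Real.exp (-(lam + c) * r) :=
      Real.exp_le_exp.2 (by nlinarith)
    have hexp' : Real.exp (-(lam + 2 * c) * r) ≤ Real.exp (-(lam + c) * r) / (c * r) := by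
      rw [le_div_iff₀ (by positivity)]
      have h3 : c * r ≤ Real.exp (c * r) := by linarith [Real.add_one_le_exp (c * r)]
      calc _ ≤ Real.exp (-(lam + 2 * c) * r) * Real.exp (c * r) := by gcongr
        _ = _ := by rw [← Real.exp_add]; congr 1; ring
    rw [e1]
    refine (norm_add_le _ _).trans ?_
    rw [norm_smul, Real.norm_of_nonneg (by linarith : 0 ≤ lam + 2 * c + δ)]
    calc _ ≤ K * Real.exp (-(lam + c) * r) / r * ‖x‖ +
          (lam + 2 * c + δ) * (K * (Real.exp (-(lam + c) * r) / (c * r)) * ‖x‖) := by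
          refine add_le_add (h1.trans ?_) (mul_le_mul_of_nonneg_left (h2.trans ?_) (by linarith))
          · gcongr
          · gcongr
      _ = _ := by rw [hL]; field_simp
  have hG : 0 ≤ |Real.Gamma α| := abs_nonneg _
  have hPn : 0 ≤ ∑ i : Fin m, ‖P i.castSucc‖ := by positivity
  obtain ⟨N, hN⟩ : ∃ N, N = L * |Real.Gamma α| + K + (∑ i : Fin m, ‖P i.castSucc‖) + 1 := ⟨_, rfl⟩
  have hLG : 0 ≤ L * |Real.Gamma α| := by positivity
  refine ⟨c, N, hc0, by linarith, fun x hx t ht => ?_, fun x hx t ht => ?_, fun x t ht => ?_⟩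
  · have hx' : Q x = 0 := hx
    rcases hα0.eq_or_lt with rfl | hα0
    · obtain ⟨h, e⟩ := exists_fracPow_zero_apply_eq (fun s => Real.exp (-δ * s) • S s) (S t x)
      refine ⟨h, ?_⟩
      rw [e, neg_zero, Real.rpow_zero, mul_one]
      refine (hdecay t ht.le x hx').trans ?_
      gcongr <;> linarith
    · obtain ⟨h, hb⟩ := hS.exists_norm_fracPow_shift_le hdiff hC hω h0spec hα0 hα1
        (b := lam + c) (by linarith) (hsm x hx') ht
      refine ⟨h, hb.trans ?_⟩
      have h1 : L * Real.Gamma α ≤ N := by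
        have : L * Real.Gamma α ≤ L * |Real.Gamma α| := by gcongr; exact le_abs_self _
        linarith
      calc _ = (L * Real.Gamma α) * Real.exp (-(lam + c) * t) * t ^ (-α) * ‖x‖ := by ring
        _ ≤ _ := by gcongr
  · rw [norm_smul, Real.norm_of_nonneg (Real.exp_pos _).le]
    have h1 : Real.exp (lam * t) * Real.exp (-(lam + 2 * c) * t) ≤ Real.exp (-c * t) := by
      rw [← Real.exp_add]
      exact Real.exp_le_exp.2 (by nlinarith)
    calc _ ≤ Real.exp (lam * t) * (K * Real.exp (-(lam + 2 * c) * t) * ‖x‖) := by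
          gcongr; exact hdecay t ht x hx
      _ = K * (Real.exp (lam * t) * Real.exp (-(lam + 2 * c) * t)) * ‖x‖ := by ring
      _ ≤ _ := by gcongr <;> linarith
  · rw [norm_smul, Real.norm_of_nonneg (Real.exp_pos _).le, Submodule.coe_norm, hexpNeg]
    have h1 : ∀ i : Fin m, ‖Real.exp (-ev i.castSucc * t) • P i.castSucc x‖ ≤
        Real.exp (-(lam - c) * t) * (‖P i.castSucc‖ * ‖x‖) := fun i => by
      have hevi : A.IsEigenvalue (ev i.castSucc) := by
        have h1 : ev i.castSucc ∈ Set.range ev := ⟨_, rfl⟩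
        rw [hrange] at h1
        exact h1.1
      have h2 := hgap _ hevi (hevlt i)
      rw [abs_of_nonpos (by linarith [hle i.castSucc])] at h2
      rw [norm_smul, Real.norm_of_nonneg (Real.exp_pos _).le]
      exact mul_le_mul (Real.exp_le_exp.2 (by nlinarith)) ((P i.castSucc).le_opNorm x)
        (norm_nonneg _) (Real.exp_pos _).le
    calc _ ≤ Real.exp (lam * t) * ∑ i : Fin m, Real.exp (-(lam - c) * t) *
          (‖P i.castSucc‖ * ‖(x : X)‖) := by gcongr; exact norm_sum_le_of_le _ fun i _ => h1 i
      _ = (∑ i : Fin m, ‖P i.castSucc‖) * (Real.exp (lam * t) * Real.exp (-(lam - c) * t)) *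
          ‖x‖ := by
          rw [← Finset.mul_sum, ← Finset.sum_mul, Submodule.coe_norm]; ring
      _ = (∑ i : Fin m, ‖P i.castSucc‖) * Real.exp (c * t) * ‖x‖ := by
          rw [← Real.exp_add]; congr 3; ring
      _ ≤ _ := by gcongr; linarith
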